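/- For an integer $N\ge 1$ let $\Omega$ be either $[N]=\{1,\dots,N\}$ (with ambient group $\mathbb{Z}$) or $\mathbb{Z}/N\mathbb{Z}$ (with ambient group $\mathbb{Z}/N\mathbb{Z}$). For an integer $k\ge 3$ and $y\in\mathbb{R}^\Omega$ put $$T_k(y)=\sum_{a,b} y_a\,y_{a+b}\,y_{a+2b}\cdots y_{a+(k-1)b},$$ where $a$ and $b$ range over the ambient group and $y_c=0$ for $c\notin\Omega$; let $\nabla T_k$ be the usual gradient of the function $T_k:\mathbb{R}^\Omega\to\mathbb{R}$. Let $$\mathrm{GW}(T_k/N)=\mathbb{E}\Big[\sup_{y\in\{0,1\}^\Omega}\big\langle \tfrac1N\nabla T_k(y),Z\big\rangle\Big],$$ with $Z$ a standard Gaussian random vector in $\mathbb{R}^\Omega$, be the Gaussian width of the set $\{\nabla T_k(y)/N : y\in\{0,1\}^\Omega\}$. **Theorem.** In each of the two settings $\Omega=[N]$ and $\Omega=\mathbb{Z}/N\mathbb{Z}$, as $N\to\infty$ (over all positive integers): 1. for every fixed $k\ge 3$, $\mathrm{GW}(T_k/N)=O\big(N^{1-\frac{1}{2(k-1)}}\big)$,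 where the implied constant may depend on $k$; 2. for $k=3$, $\mathrm{GW}(T_3/N)=\Theta\big(\sqrt{N\log N}\big)$; 3. for $k=4$, $\mathrm{GW}(T_4/N)=O\big(N^{3/4}(\log N)^{1/4}\big)$. -/

import Mathlib

open MeasureTheory ProbabilityTheory Filter Asymptotics

noncomputable section

/-- The Gaussian width `GW(K) = 𝔼 [sup_{x ∈ K} ⟨x, Z⟩]` of `K ⊆ ℝ^ι`, where `Z` is a standard Gaussian
random vector in `ℝ^ι`. (It is only used for finite non-empty `K`, where the supremum is a maximum
of finitely many linear forms, hence integrable.) -/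
def gaussianWidth {ι : Type*} [Fintype ι] (K : Set (EuclideanSpace ℝ ι)) : ℝ :=
  ∫ z, sSup ((fun x => inner ℝ x z) '' K) ∂(stdGaussian (EuclideanSpace ℝ ι))

/-- The extension of `y ∈ ℝ^Ω` by zero to the ambient group `G`. -/
def zeroExtend {G : Type*} [DecidableEq G] {Ω : Finset G} (y : EuclideanSpace ℝ Ω) (a : G) : ℝ :=
  if h : a ∈ Ω then y ⟨a, h⟩ else 0

/-- The weighted count of `k`-term arithmetic progressions
`T_k(y) = ∑_{a, b} y_a y_{a+b} ⋯ y_{a+(k-1)b}`, as a function on `ℝ^Ω`, where `a` and `b` range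
over the whole ambient group `G` and `y` is extended by zero outside `Ω`.
(For `k ≥ 2` only finitely many terms are non-zero when `G` is `ℤ` or finite.) -/
def apCount {G : Type*} [AddCommGroup G] [DecidableEq G] (k : ℕ) (Ω : Finset G)
    (y : EuclideanSpace ℝ Ω) : ℝ :=
  ∑ᶠ p : G × G, ∏ i ∈ Finset.range k, zeroExtend y (p.1 + i • p.2)

/-- The set `{∇T_k(y) / N : y ∈ {0,1}^Ω}`, where `N = |Ω|`. -/
def apGradients {G : Type*} [AddCommGroup G] [DecidableEq G] (k : ℕ) (Ω : Finset G) :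
    Set (EuclideanSpace ℝ Ω) :=
  (fun y => (Ω.card : ℝ)⁻¹ • gradient (apCount k Ω) y) '' {y | ∀ a, y a = 0 ∨ y a = 1}

/-- `GW(T_k / N)` for `Ω = [N] = {1, …, N}` in the ambient group `ℤ`. -/
def apWidthInterval (k N : ℕ) : ℝ :=
  gaussianWidth (apGradients k (Finset.Icc (1 : ℤ) N))

/-- `GW(T_k / N)` for `Ω = ℤ/Nℤ`, the ambient group being `ℤ/Nℤ` itself. -/
def apWidthCyclic (k N : ℕ) [NeZero N] : ℝ :=
  gaussianWidth (apGradients k (Finset.univ : Finset (ZMod N)))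

end

/-!
# Gaussian width of the gradients of progression counts

For fixed `z`, the number `⟨∇T_k(y), z⟩` is the sum over `j < k` of the forms
`∑_p z_{p_j} ∏_{i ≠ j} y_{p_i}`, where `p` runs over the progressions inside `Ω`
(`inner_gradient_apCount`). The only arithmetic used for the upper bounds is that two terms of a
progression determine it up to boundedly many choices (`PairBounded`, `pairBounded_apPos`), which
holds in both ambient groups because an equation `d b = w` with `0 < d < k` has boundedly many
solutions `b`. Each upper bound exhibits an integrable majorant of the supremum over `y`
(`ExpSupLE`).

*General `k`.* Colour the variables of each of the `k - 1` slots at random with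
`m ≈ N ^ (1 / (k - 1))` colours. This splits the form into `m ^ (k - 1) ≈ N` pieces, each involving
only about `N / m` variables, hence taking at most `2 ^ O(N / m)` different values, while for a
suitable colouring the variances of all pieces add up to `O(N ^ 2)`
(`exists_coloring_collisions_le`). The maximal inequality for Gaussian variables, applied to each
piece and summed, gives `N ^ (2 - 1 / (2 (k - 1)))` (`expSupLE_multilinear`), and dividing by `N`
gives the bound.

*`k = 3`.* The form is quadratic in `y`, with matrix the Gaussian series `∑_c z_c A_c` in symmetric
matrices `A_c` with bounded row sums. The noncommutative Khintchine inequality bounds its top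
eigenvalue by `O(√(N log N))` (`integral_seriesMajorant_le`, `expSupLE_quadratic`). It is proved by
the trace moment method: Gaussian integration by parts turns `𝔼 tr X ^ (2s+2)` into a sum of terms
`tr (A_c X ^ q A_c X ^ (2s-q))`, and each of them is at most `tr (A_c ^ 2 X ^ (2s))`
(`trace_mul_pow_mul_pow_le`).

*`k = 4`.* Cauchy–Schwarz in one of the three variables leaves a sum of squares of linear forms in
`z`. Comparing `z` with an independent copy and rotating by `π / 4` decouples it
(`ExpSupLE.of_decoupled`), and conditionally on one of the two Gaussian vectors the result is a
quadratic form in the `N ^ 2` variables `y_a y_b` to which Khintchine's inequality applies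
(`expSupLE_cubic`).

*Lower bound for `k = 3`.* Let `z` live on a block `(5m, 6m]`, and let `y` live on `[1, m]` and
`(9m, 12m]`. Then only progressions with middle term in the first block and endpoints in the other
two contribute, and the derivative is a bilinear form in two independent functions
(`sum_apSet_blocks`). Choosing both equal to the weight `(1 + cos (2π r x / m)) / 2`, which may be
rounded to `{0, 1}` by bilinearity, the derivative in direction `z` becomes `m / 4` times the
Fourier coefficient of `z` at frequency `2 r`, up to the mean of `z`. Hence, after projecting to the
span of the cosines, the width is at least of order `N ^ (1/2)` times the expected maximum of about
`N` independent Gaussian variables (`le_gaussianWidth_of_orthonormal`), that is `√(N log N)`.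
-/

/-! ### Gaussian integration by parts for polynomials -/

section IntegrationByParts

theorem integrable_pow_gaussianReal (n : ℕ) :
    Integrable (fun x : ℝ => x ^ n) (gaussianReal 0 1) := by
  have h := (memLp_id_gaussianReal' (μ := 0) (v := 1) (n : ENNReal) (by simp)).integrable_norm_pow'
  have h2 : Integrable (fun x : ℝ => ‖x ^ n‖) (gaussianReal 0 1) := by
    simpa [norm_pow] using h
  exact (integrable_norm_iff (by fun_prop)).1 h2

theorem integrable_pow_mul_gaussianPDFReal (n : ℕ) :
    Integrable (fun x : ℝ => x ^ n * gaussianPDFReal 0 1 x) := by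
  have h := integrable_pow_gaussianReal n
  rw [gaussianReal_of_var_ne_zero 0 one_ne_zero,
    integrable_withDensity_iff (measurable_gaussianPDF 0 1)
      (ae_of_all _ fun x => gaussianPDF_lt_top)] at h
  simpa [toReal_gaussianPDF] using h

/-- The moment recursion of the standard normal law: integration by parts for monomials. -/
theorem integral_pow_succ_gaussianReal (n : ℕ) :
    ∫ x, x ^ (n + 1) ∂(gaussianReal 0 1) = n * ∫ x, x ^ (n - 1) ∂(gaussianReal 0 1) := by
  simp only [integral_gaussianReal_eq_integral_smul one_ne_zero, smul_eq_mul]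
  have hder : ∀ x : ℝ, HasDerivAt (fun x => -gaussianPDFReal 0 1 x)
      (x * gaussianPDFReal 0 1 x) x := by
    intro x
    simp only [gaussianPDFReal_def]
    have h1 : HasDerivAt (fun x : ℝ => -(x - 0) ^ 2 / (2 * ((1 : NNReal) : ℝ))) (-x) x := by
      refine (((((hasDerivAt_id x).sub_const 0).pow 2).neg).div_const
        (2 * ((1 : NNReal) : ℝ))).congr_deriv ?_
      simp only [NNReal.coe_one, id, Nat.cast_ofNat]
      ring
    refine (h1.exp.const_mul ((√(2 * Real.pi * ((1 : NNReal) : ℝ)))⁻¹)).neg.congr_deriv ?_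
    ring
  have h := integral_mul_deriv_eq_deriv_mul_of_integrable (A := ℝ)
    (u := fun x => x ^ n) (u' := fun x => n * x ^ (n - 1))
    (v := fun x => -gaussianPDFReal 0 1 x) (v' := fun x => x * gaussianPDFReal 0 1 x)
    (fun x _ => hasDerivAt_pow n x) (fun x _ => hder x)
    ((integrable_pow_mul_gaussianPDFReal (n + 1)).congr
      (ae_of_all _ fun x => by simp only [Pi.mul_apply]; ring))
    (((integrable_pow_mul_gaussianPDFReal (n - 1)).const_mul (-(n : ℝ))).congr
      (ae_of_all _ fun x => by simp only [Pi.mul_apply]; ring))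
    ((integrable_pow_mul_gaussianPDFReal n).neg.congr
      (ae_of_all _ fun x => by simp only [Pi.mul_apply, Pi.neg_apply]; ring))
  calc ∫ x, gaussianPDFReal 0 1 x * x ^ (n + 1)
      = ∫ x, x ^ n * (x * gaussianPDFReal 0 1 x) := by congr 1; ext x; ring
    _ = - ∫ x, (n * x ^ (n - 1)) * (-gaussianPDFReal 0 1 x) := h
    _ = n * ∫ x, gaussianPDFReal 0 1 x * x ^ (n - 1) := by
        rw [← integral_neg, ← integral_const_mul]; congr 1; ext x; ring

variable {ι : Type*} [Fintype ι]

theorem integrable_stdGaussian_iff {f : EuclideanSpace ℝ ι → ℝ}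
    (hf : AEStronglyMeasurable f (stdGaussian (EuclideanSpace ℝ ι))) :
    Integrable f (stdGaussian (EuclideanSpace ℝ ι)) ↔
      Integrable (fun x : ι → ℝ => f (WithLp.toLp 2 x)) (Measure.pi fun _ => gaussianReal 0 1) := by
  rw [← map_pi_eq_stdGaussian] at hf ⊢
  exact integrable_map_measure hf (by fun_prop)

theorem integral_stdGaussian {f : EuclideanSpace ℝ ι → ℝ}
    (hf : AEStronglyMeasurable f (stdGaussian (EuclideanSpace ℝ ι))) :
    ∫ z, f z ∂(stdGaussian (EuclideanSpace ℝ ι)) =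
      ∫ x : ι → ℝ, f (WithLp.toLp 2 x) ∂(Measure.pi fun _ => gaussianReal 0 1) := by
  rw [← map_pi_eq_stdGaussian] at hf ⊢
  exact integral_map (by fun_prop) hf

omit [Fintype ι] in
theorem continuous_eval_euclidean (P : MvPolynomial ι ℝ) :
    Continuous fun z : EuclideanSpace ℝ ι => MvPolynomial.eval (fun i => z i) P :=
  (MvPolynomial.continuous_eval P).comp (by fun_prop)

theorem eval_monomial_fintype (z : ι → ℝ) (d : ι →₀ ℕ) (a : ℝ) :
    MvPolynomial.eval z (MvPolynomial.monomial d a) = a * ∏ i, z i ^ d i := by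
  rw [MvPolynomial.eval_monomial, Finsupp.prod_fintype _ _ (by simp)]

theorem integrable_eval_stdGaussian (P : MvPolynomial ι ℝ) :
    Integrable (fun z : EuclideanSpace ℝ ι => MvPolynomial.eval (fun i => z i) P)
      (stdGaussian (EuclideanSpace ℝ ι)) := by
  refine (integrable_stdGaussian_iff
    (continuous_eval_euclidean P).aestronglyMeasurable).2 ?_
  induction P using MvPolynomial.induction_on' with
  | monomial d a =>
    simp only [eval_monomial_fintype]
    exact (Integrable.fintype_prod (f := fun i x => x ^ d i)
      fun i => integrable_pow_gaussianReal (d i)).const_mul a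
  | add p q hp hq =>
    simp only [map_add]
    exact hp.add hq

/-- Expectation of a polynomial in the coordinates of a standard Gaussian vector, as a linear
functional. -/
noncomputable def gaussianExpect (ι : Type*) [Fintype ι] : MvPolynomial ι ℝ →ₗ[ℝ] ℝ where
  toFun P := ∫ z, MvPolynomial.eval (fun i => z i) P ∂(stdGaussian (EuclideanSpace ℝ ι))
  map_add' P Q := by
    simp only [map_add]
    exact integral_add (integrable_eval_stdGaussian P) (integrable_eval_stdGaussian Q)
  map_smul' a P := by
    simp only [MvPolynomial.smul_eval, RingHom.id_apply, smul_eq_mul]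
    exact integral_const_mul _ _

theorem gaussianExpect_apply (P : MvPolynomial ι ℝ) : gaussianExpect ι P =
    ∫ z, MvPolynomial.eval (fun i => z i) P ∂(stdGaussian (EuclideanSpace ℝ ι)) := rfl

theorem gaussianExpect_monomial (d : ι →₀ ℕ) (a : ℝ) :
    gaussianExpect ι (MvPolynomial.monomial d a) =
      a * ∏ i, ∫ x, x ^ d i ∂(gaussianReal 0 1) := by
  rw [gaussianExpect_apply,
    integral_stdGaussian (continuous_eval_euclidean _).aestronglyMeasurable]
  simp only [eval_monomial_fintype]
  rw [integral_const_mul, integral_fintype_prod_eq_prod (fun i x => x ^ d i)]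

/-- Gaussian integration by parts, for polynomials. -/
theorem gaussianExpect_X_mul (c : ι) (P : MvPolynomial ι ℝ) :
    gaussianExpect ι (MvPolynomial.X c * P) = gaussianExpect ι (MvPolynomial.pderiv c P) := by
  classical
  induction P using MvPolynomial.induction_on' with
  | monomial d a =>
    rw [MvPolynomial.X, MvPolynomial.monomial_mul, MvPolynomial.pderiv_monomial,
      gaussianExpect_monomial, gaussianExpect_monomial,
      ← Finset.mul_prod_erase _ _ (Finset.mem_univ c),
      ← Finset.mul_prod_erase Finset.univ
        (fun i => ∫ x, x ^ ((d - Finsupp.single c 1 : ι →₀ ℕ) i) ∂(gaussianReal 0 1)) (Finset.mem_univ c)]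
    have h1 : (Finsupp.single c 1 + d : ι →₀ ℕ) c = d c + 1 := by simp [add_comm]
    have h2 : (d - Finsupp.single c 1 : ι →₀ ℕ) c = d c - 1 := by simp
    rw [h1, h2, integral_pow_succ_gaussianReal]
    have h3 : ∏ x ∈ Finset.univ.erase c,
          ∫ t, t ^ ((Finsupp.single c 1 + d : ι →₀ ℕ) x) ∂(gaussianReal 0 1) =
        ∏ x ∈ Finset.univ.erase c,
          ∫ t, t ^ ((d - Finsupp.single c 1 : ι →₀ ℕ) x) ∂(gaussianReal 0 1) := by
      refine Finset.prod_congr rfl fun x hx => ?_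
      have hx : c ≠ x := (Finset.ne_of_mem_erase hx).symm
      simp [Finsupp.single_eq_of_ne' hx]
    rw [h3]
    ring
  | add p q hp hq => rw [mul_add, map_add, map_add, map_add, hp, hq]

end IntegrationByParts

/-! ### Trace inequalities for real symmetric matrices -/

section Trace

open Matrix

variable {V : Type*} [Fintype V] [DecidableEq V]

theorem exists_orthogonal_diagonalization {X : Matrix V V ℝ} (hX : Xᵀ = X) :
    ∃ (U : Matrix V V ℝ) (l : V → ℝ), Uᵀ * U = 1 ∧ U * Uᵀ = 1 ∧
      ∀ n : ℕ, X ^ n = U * diagonal (fun i => l i ^ n) * Uᵀ := by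
  have hH : X.IsHermitian := by rw [IsHermitian, conjTranspose_eq_transpose_of_trivial, hX]
  set U : Matrix V V ℝ := (hH.eigenvectorUnitary : Matrix V V ℝ)
  have h1 : Uᵀ * U = 1 := by
    have := Unitary.coe_star_mul_self hH.eigenvectorUnitary
    rwa [star_eq_conjTranspose, conjTranspose_eq_transpose_of_trivial] at this
  have h2 : U * Uᵀ = 1 := by
    have := Unitary.mul_star_self_of_mem hH.eigenvectorUnitary.2
    rwa [star_eq_conjTranspose, conjTranspose_eq_transpose_of_trivial] at this
  refine ⟨U, hH.eigenvalues, h1, h2, fun n => ?_⟩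
  have h3 : X = U * diagonal hH.eigenvalues * Uᵀ := by
    have := hH.spectral_theorem
    rw [Unitary.conjStarAlgAut_apply] at this
    simpa [star_eq_conjTranspose, conjTranspose_eq_transpose_of_trivial] using this
  induction n with
  | zero => simp [h2]
  | succ n ih =>
    rw [pow_succ, ih]
    nth_rw 2 [h3]
    calc U * diagonal (fun i => hH.eigenvalues i ^ n) * Uᵀ * (U * diagonal hH.eigenvalues * Uᵀ)
        = U * diagonal (fun i => hH.eigenvalues i ^ n) * (Uᵀ * U) * diagonal hH.eigenvalues * Uᵀ := by
          simp only [Matrix.mul_assoc]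
      _ = _ := by
          rw [h1, Matrix.mul_one, Matrix.mul_assoc U, diagonal_mul_diagonal]
          simp only [pow_succ]

theorem abs_pow_mul_abs_pow_add_le (x y : ℝ) (q r : ℕ) :
    |x| ^ q * |y| ^ r + |x| ^ r * |y| ^ q ≤ |x| ^ (q + r) + |y| ^ (q + r) := by
  have key : 0 ≤ (|x| ^ q - |y| ^ q) * (|x| ^ r - |y| ^ r) := by
    rcases le_total |x| |y| with h | h
    · exact mul_nonneg_of_nonpos_of_nonpos
        (sub_nonpos.2 (pow_le_pow_left₀ (abs_nonneg _) h _))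
        (sub_nonpos.2 (pow_le_pow_left₀ (abs_nonneg _) h _))
    · exact mul_nonneg (sub_nonneg.2 (pow_le_pow_left₀ (abs_nonneg _) h _))
        (sub_nonneg.2 (pow_le_pow_left₀ (abs_nonneg _) h _))
  rw [pow_add, pow_add]
  nlinarith [key]

/-- Splitting the powers of `X` on both sides of `A` only decreases the trace: in an eigenbasis
of `X` this is `|x|^q |y|^r + |x|^r |y|^q ≤ |x|^(q+r) + |y|^(q+r)`. -/
theorem trace_mul_pow_mul_pow_le {A X : Matrix V V ℝ} (hA : Aᵀ = A) (hX : Xᵀ = X) {q r s : ℕ}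
    (h : q + r = 2 * s) :
    trace (A * X ^ q * A * X ^ r) ≤ trace (A * A * X ^ (2 * s)) := by
  obtain ⟨U, l, h1, h2, hp⟩ := exists_orthogonal_diagonalization hX
  set B : Matrix V V ℝ := Uᵀ * A * U with hB
  have hBt : ∀ i j, B i j = B j i := by
    intro i j
    have : Bᵀ = B := by
      rw [hB]; simp only [transpose_mul, transpose_transpose, hA, Matrix.mul_assoc]
    conv_lhs => rw [← this]
    rfl
  have hL : trace (A * X ^ q * A * X ^ r) = ∑ i, ∑ j, B i j ^ 2 * (l j ^ q * l i ^ r) := by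
    have : trace (A * X ^ q * A * X ^ r) =
        trace (B * diagonal (fun i => l i ^ q) * (B * diagonal (fun i => l i ^ r))) := by
      rw [hp, hp]
      calc trace (A * (U * diagonal (fun i => l i ^ q) * Uᵀ) * A *
            (U * diagonal (fun i => l i ^ r) * Uᵀ))
          = trace ((A * U * diagonal (fun i => l i ^ q) * Uᵀ * A *
            U * diagonal (fun i => l i ^ r)) * Uᵀ) := by simp only [Matrix.mul_assoc]
        _ = trace (Uᵀ * (A * U * diagonal (fun i => l i ^ q) * Uᵀ * A *
            U * diagonal (fun i => l i ^ r))) := trace_mul_comm _ _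
        _ = _ := by rw [hB]; simp only [Matrix.mul_assoc]
    rw [this, trace]
    refine Finset.sum_congr rfl fun i _ => ?_
    rw [diag_apply, mul_apply]
    refine Finset.sum_congr rfl fun j _ => ?_
    rw [mul_diagonal, mul_diagonal, hBt j i]
    ring
  have hR : trace (A * A * X ^ (2 * s)) = ∑ i, ∑ j, B i j ^ 2 * l i ^ (2 * s) := by
    have : trace (A * A * X ^ (2 * s)) =
        trace (B * (B * diagonal (fun i => l i ^ (2 * s)))) := by
      rw [hp]
      calc trace (A * A * (U * diagonal (fun i => l i ^ (2 * s)) * Uᵀ))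
          = trace ((A * (U * Uᵀ) * A * U * diagonal (fun i => l i ^ (2 * s))) * Uᵀ) := by
            rw [h2, Matrix.mul_one]; simp only [Matrix.mul_assoc]
        _ = trace (Uᵀ * (A * (U * Uᵀ) * A * U * diagonal (fun i => l i ^ (2 * s)))) :=
            trace_mul_comm _ _
        _ = _ := by rw [hB]; simp only [Matrix.mul_assoc]
    rw [this, trace]
    refine Finset.sum_congr rfl fun i _ => ?_
    rw [diag_apply, mul_apply]
    refine Finset.sum_congr rfl fun j _ => ?_
    rw [mul_diagonal, hBt j i]
    ring
  have hswap : ∀ a b : ℕ, ∑ i, ∑ j, B i j ^ 2 * (l j ^ a * l i ^ b) =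
      ∑ i, ∑ j, B i j ^ 2 * (l j ^ b * l i ^ a) := by
    intro a b
    rw [Finset.sum_comm]
    refine Finset.sum_congr rfl fun i _ => Finset.sum_congr rfl fun j _ => ?_
    rw [hBt j i]; ring
  have hR2 : ∑ i, ∑ j, B i j ^ 2 * l i ^ (2 * s) = ∑ i, ∑ j, B i j ^ 2 * l j ^ (2 * s) := by
    simpa using hswap 0 (2 * s)
  have key : ∑ i, ∑ j, (B i j ^ 2 * (l j ^ q * l i ^ r) + B i j ^ 2 * (l j ^ r * l i ^ q)) ≤
      ∑ i, ∑ j, (B i j ^ 2 * l i ^ (2 * s) + B i j ^ 2 * l j ^ (2 * s)) := by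
    refine Finset.sum_le_sum fun i _ => Finset.sum_le_sum fun j _ => ?_
    rw [← mul_add, ← mul_add]
    refine mul_le_mul_of_nonneg_left ?_ (sq_nonneg _)
    have e := abs_pow_mul_abs_pow_add_le (l j) (l i) q r
    have e1 : l j ^ q * l i ^ r ≤ |l j| ^ q * |l i| ^ r := by
      rw [← abs_pow, ← abs_pow, ← abs_mul]; exact le_abs_self _
    have e2 : l j ^ r * l i ^ q ≤ |l j| ^ r * |l i| ^ q := by
      rw [← abs_pow, ← abs_pow, ← abs_mul]; exact le_abs_self _
    rw [h, pow_mul, pow_mul, sq_abs, sq_abs, ← pow_mul, ← pow_mul] at e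
    linarith
  simp only [Finset.sum_add_distrib] at key
  rw [hL, hR]
  rw [hswap r q, ← hR2] at key
  linarith

theorem trace_pow_two_mul {X : Matrix V V ℝ} (hX : Xᵀ = X) (s : ℕ) :
    trace (X ^ (2 * s)) = ∑ j, ∑ i, (X ^ s) i j ^ 2 := by
  have hs : (X ^ s)ᵀ = X ^ s := by rw [transpose_pow, hX]
  have : X ^ (2 * s) = (X ^ s)ᵀ * X ^ s := by rw [hs, two_mul, pow_add]
  rw [this, trace]
  refine Finset.sum_congr rfl fun j _ => ?_
  rw [diag_apply, mul_apply]
  exact Finset.sum_congr rfl fun i _ => by rw [transpose_apply, sq]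

theorem trace_mul_mul_pow_two_mul {A X : Matrix V V ℝ} (hA : Aᵀ = A) (hX : Xᵀ = X) (s : ℕ) :
    trace (A * A * X ^ (2 * s)) = ∑ j, ∑ i, (A *ᵥ (fun i => (X ^ s) i j)) i ^ 2 := by
  have hs : (X ^ s)ᵀ = X ^ s := by rw [transpose_pow, hX]
  have : trace (A * A * X ^ (2 * s)) = trace ((A * X ^ s)ᵀ * (A * X ^ s)) := by
    rw [transpose_mul, hs, hA, two_mul, pow_add, ← Matrix.mul_assoc, trace_mul_comm]
    simp only [Matrix.mul_assoc]
  rw [this, trace]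
  refine Finset.sum_congr rfl fun j _ => ?_
  rw [diag_apply, mul_apply]
  exact Finset.sum_congr rfl fun i _ => by rw [transpose_apply, sq]; rfl

theorem trace_pow_two_mul_nonneg {X : Matrix V V ℝ} (hX : Xᵀ = X) (s : ℕ) :
    0 ≤ trace (X ^ (2 * s)) := by
  rw [trace_pow_two_mul hX]
  positivity

theorem sum_trace_mul_mul_pow_le {ι : Type*} [Fintype ι] {A : ι → Matrix V V ℝ}
    {X : Matrix V V ℝ} (hA : ∀ c, (A c)ᵀ = A c) (hX : Xᵀ = X) {v : ℝ}
    (hv : ∀ x : V → ℝ, ∑ c, ∑ i, (A c *ᵥ x) i ^ 2 ≤ v * ∑ i, x i ^ 2) (s : ℕ) :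
    ∑ c, trace (A c * A c * X ^ (2 * s)) ≤ v * trace (X ^ (2 * s)) := by
  simp only [trace_mul_mul_pow_two_mul (hA _) hX, trace_pow_two_mul hX]
  rw [Finset.sum_comm, Finset.mul_sum]
  exact Finset.sum_le_sum fun j _ => hv _

/-- The quadratic form of `X` is controlled by even power traces. The parameter `a` is the expected
size of the largest eigenvalue; this linearised form avoids taking roots of the trace. -/
theorem dotProduct_mulVec_le_trace_pow {X : Matrix V V ℝ} (hX : Xᵀ = X) {a : ℝ} (ha : 0 < a)
    (n : ℕ) (x : V → ℝ) :
    x ⬝ᵥ (X *ᵥ x) ≤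
      (∑ i, x i ^ 2) * (a + trace (X ^ (2 * (n + 1))) / a ^ (2 * n + 1)) := by
  obtain ⟨U, l, h1, h2, hp⟩ := exists_orthogonal_diagonalization hX
  set y : V → ℝ := Uᵀ *ᵥ x with hy
  have hx2 : ∑ i, x i ^ 2 = ∑ i, y i ^ 2 := by
    have e1 : ∑ i, x i ^ 2 = x ⬝ᵥ x := Finset.sum_congr rfl fun i _ => sq _
    have e2 : ∑ i, y i ^ 2 = y ⬝ᵥ y := Finset.sum_congr rfl fun i _ => sq _
    rw [e1, e2, hy, dotProduct_mulVec, vecMul_transpose, mulVec_mulVec, h2, one_mulVec]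
  have hxX : x ⬝ᵥ (X *ᵥ x) = ∑ i, l i * y i ^ 2 := by
    have := hp 1
    simp only [pow_one] at this
    rw [this, ← mulVec_mulVec, ← mulVec_mulVec, dotProduct_mulVec, ← mulVec_transpose, ← hy]
    refine Finset.sum_congr rfl fun i _ => ?_
    rw [mulVec_diagonal]; ring
  have htr : trace (X ^ (2 * (n + 1))) = ∑ i, l i ^ (2 * (n + 1)) := by
    rw [hp, trace_mul_comm, ← Matrix.mul_assoc, h1, Matrix.one_mul, trace_diagonal]
  rw [hx2, hxX, Finset.sum_mul]
  refine Finset.sum_le_sum fun i _ => ?_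
  rw [mul_comm]
  refine mul_le_mul_of_nonneg_left ?_ (sq_nonneg _)
  have hle : l i ^ (2 * (n + 1)) ≤ trace (X ^ (2 * (n + 1))) := by
    rw [htr]
    exact Finset.single_le_sum (f := fun i => l i ^ (2 * (n + 1)))
      (fun j _ => by rw [pow_mul]; positivity) (Finset.mem_univ i)
  refine le_trans ?_ (add_le_add_right (div_le_div_of_nonneg_right hle (by positivity)) a)
  rcases le_or_gt (l i) a with h | h
  · have : 0 ≤ l i ^ (2 * (n + 1)) / a ^ (2 * n + 1) := by rw [pow_mul]; positivity
    linarith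
  · have : l i ≤ l i ^ (2 * (n + 1)) / a ^ (2 * n + 1) := by
      rw [le_div_iff₀ (by positivity), show 2 * (n + 1) = (2 * n + 1) + 1 by ring,
        pow_succ' (l i)]
      exact mul_le_mul_of_nonneg_left (pow_le_pow_left₀ ha.le h.le _) (by linarith)
    linarith

end Trace

/-! ### The noncommutative Khintchine inequality -/

section Khintchine

open Matrix

variable {ι V : Type*} [Fintype ι] [Fintype V] [DecidableEq V]

/-- The Gaussian matrix series `∑_c z_c A_c`. -/
def matrixSeries (A : ι → Matrix V V ℝ) (z : ι → ℝ) : Matrix V V ℝ := ∑ c, z c • A c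

omit [Fintype V] [DecidableEq V] in
theorem transpose_matrixSeries {A : ι → Matrix V V ℝ} (hA : ∀ c, (A c)ᵀ = A c) (z : ι → ℝ) :
    (matrixSeries A z)ᵀ = matrixSeries A z := by
  simp only [matrixSeries, transpose_sum, transpose_smul, hA]

/-- The series `∑_c X_c A_c` as a matrix of polynomials. -/
noncomputable def polyMatrixSeries (A : ι → Matrix V V ℝ) : Matrix V V (MvPolynomial ι ℝ) :=
  ∑ c, (MvPolynomial.X c : MvPolynomial ι ℝ) • (A c).map MvPolynomial.C

omit [DecidableEq V] [Fintype V] in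
theorem map_eval_polyMatrixSeries (A : ι → Matrix V V ℝ) (z : ι → ℝ) :
    (polyMatrixSeries A).map (MvPolynomial.eval z) = matrixSeries A z := by
  ext i j
  simp [polyMatrixSeries, matrixSeries, Matrix.sum_apply]

omit [DecidableEq V] [Fintype V] [Fintype ι] in
theorem map_eval_map_C (M : Matrix V V ℝ) (z : ι → ℝ) :
    (M.map MvPolynomial.C).map (MvPolynomial.eval z) = M := by
  ext i j
  simp

omit [Fintype ι] in
theorem map_eval_pow (M : Matrix V V (MvPolynomial ι ℝ)) (z : ι → ℝ) (n : ℕ) :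
    (M ^ n).map (MvPolynomial.eval z) = M.map (MvPolynomial.eval z) ^ n :=
  Matrix.map_pow M (MvPolynomial.eval z) n

omit [Fintype ι] [DecidableEq V] in
theorem eval_trace (M : Matrix V V (MvPolynomial ι ℝ)) (z : ι → ℝ) :
    MvPolynomial.eval z (trace M) = trace (M.map (MvPolynomial.eval z)) := by
  simp [trace, map_sum]

omit [Fintype ι] [DecidableEq V] in
theorem map_pderiv_mul (c : ι) (M N : Matrix V V (MvPolynomial ι ℝ)) :
    (M * N).map (MvPolynomial.pderiv c) =
      M.map (MvPolynomial.pderiv c) * N + M * N.map (MvPolynomial.pderiv c) := by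
  ext1 i j
  simp only [map_apply, Matrix.add_apply, Matrix.mul_apply, map_sum, ← Finset.sum_add_distrib]
  refine Finset.sum_congr rfl fun k _ => ?_
  rw [MvPolynomial.pderiv_mul]

omit [Fintype ι] in
theorem map_pderiv_pow (c : ι) (M : Matrix V V (MvPolynomial ι ℝ)) (n : ℕ) :
    (M ^ n).map (MvPolynomial.pderiv c) =
      ∑ q ∈ Finset.range n, M ^ q * M.map (MvPolynomial.pderiv c) * M ^ (n - 1 - q) := by
  induction n with
  | zero =>
    ext1 i j
    by_cases h : i = j <;> simp [h]
  | succ n ih =>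
    have h1 : ∀ q ∈ Finset.range n,
        M ^ q * M.map (MvPolynomial.pderiv c) * M ^ (n - 1 - q) * M =
          M ^ q * M.map (MvPolynomial.pderiv c) * M ^ (n + 1 - 1 - q) := by
      intro q hq
      have hq := Finset.mem_range.1 hq
      rw [Matrix.mul_assoc _ _ M, ← pow_succ, show n - 1 - q + 1 = n + 1 - 1 - q by omega]
    have h2 : M ^ (n + 1 - 1 - n) = 1 := by
      rw [show n + 1 - 1 - n = 0 by omega, pow_zero]
    rw [pow_succ, map_pderiv_mul, ih, Finset.sum_range_succ, Finset.sum_mul,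
      Finset.sum_congr rfl h1, h2, Matrix.mul_one]

omit [DecidableEq V] [Fintype V] in
theorem map_pderiv_polyMatrixSeries [DecidableEq ι] (A : ι → Matrix V V ℝ) (c : ι) :
    (polyMatrixSeries A).map (MvPolynomial.pderiv c) = (A c).map MvPolynomial.C := by
  ext1 i j
  simp [polyMatrixSeries, Matrix.sum_apply, MvPolynomial.pderiv_X, Pi.single_apply]

/-- One step of the moment recursion: Gaussian integration by parts together with the trace
inequality `trace_mul_pow_mul_pow_le`. -/
theorem gaussianExpect_trace_pow_succ_le {A : ι → Matrix V V ℝ} (hA : ∀ c, (A c)ᵀ = A c) {v : ℝ}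
    (hv : ∀ x : V → ℝ, ∑ c, ∑ i, (A c *ᵥ x) i ^ 2 ≤ v * ∑ i, x i ^ 2) (s : ℕ) :
    gaussianExpect ι (trace (polyMatrixSeries A ^ (2 * (s + 1)))) ≤
      ((2 * s + 1 : ℕ) : ℝ) * v * gaussianExpect ι (trace (polyMatrixSeries A ^ (2 * s))) := by
  classical
  set X := polyMatrixSeries A with hX
  have h1 : trace (X ^ (2 * (s + 1))) =
      ∑ c, MvPolynomial.X c * trace ((A c).map MvPolynomial.C * X ^ (2 * s + 1)) := by
    rw [show 2 * (s + 1) = (2 * s + 1) + 1 by ring, pow_succ']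
    conv_lhs => rw [hX]
    rw [polyMatrixSeries, Finset.sum_mul, trace_sum]
    refine Finset.sum_congr rfl fun c _ => ?_
    rw [Matrix.smul_mul, trace_smul, smul_eq_mul]
    rfl
  have h2 : ∀ c, MvPolynomial.pderiv c (trace ((A c).map MvPolynomial.C * X ^ (2 * s + 1))) =
      ∑ q ∈ Finset.range (2 * s + 1), trace ((A c).map MvPolynomial.C * X ^ q *
        (A c).map MvPolynomial.C * X ^ (2 * s - q)) := by
    intro c
    have e1 : ∀ M : Matrix V V (MvPolynomial ι ℝ),
        MvPolynomial.pderiv c (trace M) = trace (M.map (MvPolynomial.pderiv c)) := by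
      intro M; simp [trace, map_sum]
    have e2 : ((A c).map (MvPolynomial.C (σ := ι))).map (MvPolynomial.pderiv c) = 0 := by
      ext1 i j; simp
    rw [e1, map_pderiv_mul, e2, Matrix.zero_mul, zero_add, map_pderiv_pow,
      map_pderiv_polyMatrixSeries, Finset.mul_sum, trace_sum]
    refine Finset.sum_congr rfl fun q _ => ?_
    rw [Nat.add_sub_cancel]
    simp only [Matrix.mul_assoc]
  rw [h1, map_sum]
  simp only [gaussianExpect_X_mul, h2]
  have h3 : ((2 * s + 1 : ℕ) : ℝ) * v * gaussianExpect ι (trace (X ^ (2 * s))) =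
      gaussianExpect ι ((((2 * s + 1 : ℕ) : ℝ) * v) • trace (X ^ (2 * s))) := by
    rw [map_smul, smul_eq_mul]
  rw [← map_sum, h3, gaussianExpect_apply, gaussianExpect_apply]
  refine integral_mono (integrable_eval_stdGaussian _) (integrable_eval_stdGaussian _) fun z => ?_
  have hY := transpose_matrixSeries hA (fun i => z i)
  simp only [map_sum, MvPolynomial.smul_eval, eval_trace, Matrix.map_mul, map_eval_pow, map_eval_map_C,
    hX, map_eval_polyMatrixSeries]
  set Y := matrixSeries A (fun i => z i)
  calc ∑ c, ∑ q ∈ Finset.range (2 * s + 1), trace (A c * Y ^ q * A c * Y ^ (2 * s - q))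
      ≤ ∑ c, ∑ q ∈ Finset.range (2 * s + 1), trace (A c * A c * Y ^ (2 * s)) := by
        refine Finset.sum_le_sum fun c _ => Finset.sum_le_sum fun q hq => ?_
        have hq := Finset.mem_range.1 hq
        exact trace_mul_pow_mul_pow_le (hA c) hY (by omega)
    _ = ((2 * s + 1 : ℕ) : ℝ) * ∑ c, trace (A c * A c * Y ^ (2 * s)) := by
        simp [Finset.mul_sum]
    _ ≤ ((2 * s + 1 : ℕ) : ℝ) * (v * trace (Y ^ (2 * s))) :=
        mul_le_mul_of_nonneg_left (sum_trace_mul_mul_pow_le hA hY hv s) (by positivity)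
    _ = _ := by ring

/-- Moment bound by iterating `gaussianExpect_trace_pow_succ_le`; the odd factors `2 s + 1` are all
replaced by `2 m`, which keeps the bound a pure power. -/
theorem gaussianExpect_trace_pow_le {A : ι → Matrix V V ℝ} (hA : ∀ c, (A c)ᵀ = A c) {v : ℝ}
    (hv0 : 0 ≤ v) (hv : ∀ x : V → ℝ, ∑ c, ∑ i, (A c *ᵥ x) i ^ 2 ≤ v * ∑ i, x i ^ 2) {s m : ℕ}
    (hsm : s ≤ m) :
    gaussianExpect ι (trace (polyMatrixSeries A ^ (2 * s))) ≤
      (2 * m * v) ^ s * Fintype.card V := by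
  induction s with
  | zero =>
    have : trace (polyMatrixSeries A ^ (2 * 0)) = MvPolynomial.C (Fintype.card V : ℝ) := by simp
    rw [this, gaussianExpect_apply]
    simp
  | succ s ih =>
    refine (gaussianExpect_trace_pow_succ_le hA hv s).trans ?_
    have hm : ((2 * s + 1 : ℕ) : ℝ) ≤ 2 * m := by
      have : 2 * s + 1 ≤ 2 * m := by omega
      exact_mod_cast this
    calc ((2 * s + 1 : ℕ) : ℝ) * v * gaussianExpect ι (trace (polyMatrixSeries A ^ (2 * s)))
        ≤ ((2 * s + 1 : ℕ) : ℝ) * v * ((2 * m * v) ^ s * Fintype.card V) :=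
          mul_le_mul_of_nonneg_left (ih (by omega)) (by positivity)
      _ ≤ (2 * m * v) * ((2 * m * v) ^ s * Fintype.card V) := by gcongr
      _ = _ := by ring

/-- A pointwise majorant of the quadratic form of `∑_c z_c A_c` on the unit ball. -/
noncomputable def seriesMajorant (A : ι → Matrix V V ℝ) (a : ℝ) (n : ℕ) (z : ι → ℝ) : ℝ :=
  a + trace (matrixSeries A z ^ (2 * (n + 1))) / a ^ (2 * n + 1)

theorem seriesMajorant_eq (A : ι → Matrix V V ℝ) (a : ℝ) (n : ℕ) (z : ι → ℝ) :
    seriesMajorant A a n z =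
      a + MvPolynomial.eval z (trace (polyMatrixSeries A ^ (2 * (n + 1)))) / a ^ (2 * n + 1) := by
  rw [seriesMajorant, eval_trace, map_eval_pow, map_eval_polyMatrixSeries]

theorem integrable_seriesMajorant (A : ι → Matrix V V ℝ) (a : ℝ) (n : ℕ) :
    Integrable (fun z : EuclideanSpace ℝ ι => seriesMajorant A a n (fun i => z i))
      (stdGaussian (EuclideanSpace ℝ ι)) := by
  simp only [seriesMajorant_eq]
  exact (integrable_const a).add ((integrable_eval_stdGaussian _).div_const _)

theorem seriesMajorant_nonneg {A : ι → Matrix V V ℝ} (hA : ∀ c, (A c)ᵀ = A c) {a : ℝ}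
    (ha : 0 < a) (n : ℕ) (z : ι → ℝ) : 0 ≤ seriesMajorant A a n z :=
  add_nonneg ha.le (div_nonneg (trace_pow_two_mul_nonneg (transpose_matrixSeries hA z) _)
    (by positivity))

theorem dotProduct_matrixSeries_le {A : ι → Matrix V V ℝ} (hA : ∀ c, (A c)ᵀ = A c) {a : ℝ}
    (ha : 0 < a) (n : ℕ) (z : ι → ℝ) (x : V → ℝ) :
    x ⬝ᵥ (matrixSeries A z *ᵥ x) ≤ (∑ i, x i ^ 2) * seriesMajorant A a n z :=
  dotProduct_mulVec_le_trace_pow (transpose_matrixSeries hA z) ha n x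

/-- The noncommutative Khintchine inequality, for the majorant: the choice `a ^ 2 = 2 e p v` with
`p = n + 1 ≥ log (dim)` balances the two terms. -/
theorem integral_seriesMajorant_le {A : ι → Matrix V V ℝ} (hA : ∀ c, (A c)ᵀ = A c) {v a : ℝ}
    (hv0 : 0 ≤ v) (hv : ∀ x : V → ℝ, ∑ c, ∑ i, (A c *ᵥ x) i ^ 2 ≤ v * ∑ i, x i ^ 2) {n : ℕ}
    (hn : (Fintype.card V : ℝ) ≤ Real.exp ((n : ℝ) + 1)) (ha : 0 < a)
    (hav : 2 * (n + 1) * v * Real.exp 1 ≤ a ^ 2) :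
    ∫ z : EuclideanSpace ℝ ι, seriesMajorant A a n (fun i => z i)
      ∂(stdGaussian (EuclideanSpace ℝ ι)) ≤ 2 * a := by
  simp only [seriesMajorant_eq]
  rw [integral_add (integrable_const a) ((integrable_eval_stdGaussian _).div_const _),
    integral_const, integral_div, ← gaussianExpect_apply]
  have h := gaussianExpect_trace_pow_le hA hv0 hv (le_refl (n + 1))
  have h2 : gaussianExpect ι (trace (polyMatrixSeries A ^ (2 * (n + 1)))) ≤
      a * a ^ (2 * n + 1) := by
    refine h.trans ?_
    calc (2 * ((n + 1 : ℕ) : ℝ) * v) ^ (n + 1) * Fintype.card V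
        ≤ (2 * ((n + 1 : ℕ) : ℝ) * v) ^ (n + 1) * Real.exp ((n : ℝ) + 1) := by gcongr
      _ = (2 * (n + 1) * v * Real.exp 1) ^ (n + 1) := by
          rw [mul_pow _ (Real.exp 1), ← Real.exp_nat_mul]
          push_cast
          rw [mul_one]
      _ ≤ (a ^ 2) ^ (n + 1) := by gcongr
      _ = _ := by ring
  have h3 := (div_le_iff₀ (by positivity : 0 < a ^ (2 * n + 1))).2 h2
  simp only [probReal_univ, smul_eq_mul, one_mul]
  linarith

end Khintchine

/-! ### Gaussian quadratic forms with sparse coefficient structure -/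

section SparseForm

open Matrix

variable {ι V κ : Type*} [Fintype ι] [DecidableEq ι] [Fintype V] [DecidableEq V]

/-- The symmetric coefficient matrix of `z_e` in the form `∑_t z_{c t} w_t x_{u t} x_{v t}`. -/
noncomputable def sparseMatrix (T : Finset κ) (c : κ → ι) (u v : κ → V) (w : κ → ℝ) (e : ι) :
    Matrix V V ℝ :=
  Matrix.of fun i j => (1 / 2) * ∑ t ∈ T with c t = e,
    w t * ((if u t = i ∧ v t = j then 1 else 0) + (if v t = i ∧ u t = j then 1 else 0))

variable {T : Finset κ} {c : κ → ι} {u v : κ → V} {w : κ → ℝ}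

omit [Fintype ι] [Fintype V] in
theorem transpose_sparseMatrix (e : ι) :
    (sparseMatrix T c u v w e)ᵀ = sparseMatrix T c u v w e := by
  ext i j
  simp only [sparseMatrix, transpose_apply, of_apply]
  congr 1
  refine Finset.sum_congr rfl fun t _ => ?_
  rw [add_comm]
  simp only [and_comm]

omit [Fintype ι] in
theorem sparseMatrix_mulVec (e : ι) (x : V → ℝ) (i : V) :
    (sparseMatrix T c u v w e *ᵥ x) i =
      (1 / 2) * ((∑ t ∈ T with c t = e ∧ u t = i, w t * x (v t)) +
        ∑ t ∈ T with c t = e ∧ v t = i, w t * x (u t)) := by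
  have aux : ∀ f g : κ → V, ∑ j, (∑ t ∈ T with c t = e, w t * (if f t = i ∧ g t = j then 1 else 0)) *
      x j = ∑ t ∈ T with c t = e ∧ f t = i, w t * x (g t) := by
    intro f g
    simp only [Finset.sum_mul]
    rw [Finset.sum_comm, ← Finset.filter_filter, Finset.sum_filter (fun t => f t = i)]
    refine Finset.sum_congr rfl fun t _ => ?_
    by_cases h : f t = i <;> simp [h]
  simp only [mulVec, dotProduct, sparseMatrix, of_apply]
  rw [← aux u v, ← aux v u, ← Finset.sum_add_distrib, Finset.mul_sum]
  refine Finset.sum_congr rfl fun j _ => ?_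
  simp only [mul_add, Finset.sum_add_distrib]
  ring

omit [Fintype ι] in
theorem dotProduct_sparseMatrix_mulVec (e : ι) (x : V → ℝ) :
    x ⬝ᵥ (sparseMatrix T c u v w e *ᵥ x) =
      ∑ t ∈ T with c t = e, w t * x (u t) * x (v t) := by
  have aux : ∀ f g : κ → V, ∑ i, x i * ∑ t ∈ T with c t = e ∧ f t = i, w t * x (g t) =
      ∑ t ∈ T with c t = e, w t * x (f t) * x (g t) := by
    intro f g
    rw [← Finset.sum_fiberwise (Finset.filter (fun t => c t = e) T) f]
    refine Finset.sum_congr rfl fun i _ => ?_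
    rw [Finset.mul_sum, Finset.filter_filter]
    refine Finset.sum_congr rfl fun t ht => ?_
    rw [(Finset.mem_filter.1 ht).2.2]; ring
  simp only [dotProduct, sparseMatrix_mulVec]
  have : ∀ i, x i * (1 / 2 * ((∑ t ∈ T with c t = e ∧ u t = i, w t * x (v t)) +
        ∑ t ∈ T with c t = e ∧ v t = i, w t * x (u t))) =
      (1 / 2) * (x i * (∑ t ∈ T with c t = e ∧ u t = i, w t * x (v t))) +
        (1 / 2) * (x i * ∑ t ∈ T with c t = e ∧ v t = i, w t * x (u t)) := fun i => by ring
  simp only [this, Finset.sum_add_distrib, ← Finset.mul_sum]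
  rw [aux, aux, ← mul_add, ← Finset.sum_add_distrib, Finset.mul_sum]
  exact Finset.sum_congr rfl fun t _ => by ring

theorem dotProduct_matrixSeries_sparseMatrix (z : ι → ℝ) (x : V → ℝ) :
    x ⬝ᵥ (matrixSeries (sparseMatrix T c u v w) z *ᵥ x) =
      ∑ t ∈ T, z (c t) * w t * x (u t) * x (v t) := by
  rw [matrixSeries, sum_mulVec, dotProduct_sum, ← Finset.sum_fiberwise T c]
  refine Finset.sum_congr rfl fun e _ => ?_
  rw [smul_mulVec, dotProduct_smul, dotProduct_sparseMatrix_mulVec, smul_eq_mul, Finset.mul_sum]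
  refine Finset.sum_congr rfl fun t ht => ?_
  rw [(Finset.mem_filter.1 ht).2]; ring

theorem sum_sq_fiber_sum_le {D : ℕ} {B : ℝ} (f g : κ → V)
    (hD : ∀ e i, (T.filter fun t => c t = e ∧ f t = i).card ≤ D)
    (hB : ∀ j, ∑ t ∈ T with g t = j, w t ^ 2 ≤ B) (x : V → ℝ) :
    ∑ e, ∑ i, (∑ t ∈ T with c t = e ∧ f t = i, w t * x (g t)) ^ 2 ≤
      D * B * ∑ j, x j ^ 2 := by
  calc ∑ e, ∑ i, (∑ t ∈ T with c t = e ∧ f t = i, w t * x (g t)) ^ 2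
      ≤ ∑ e, ∑ i, D * ∑ t ∈ T with c t = e ∧ f t = i, (w t * x (g t)) ^ 2 := by
        refine Finset.sum_le_sum fun e _ => Finset.sum_le_sum fun i _ => ?_
        refine sq_sum_le_card_mul_sum_sq.trans ?_
        have := hD e i
        gcongr
    _ = D * ∑ t ∈ T, (w t * x (g t)) ^ 2 := by
        simp only [← Finset.mul_sum, ← Finset.filter_filter]
        congr 1
        rw [← Finset.sum_fiberwise T c]
        exact Finset.sum_congr rfl fun e _ => Finset.sum_fiberwise _ f _
    _ = D * ∑ j, (∑ t ∈ T with g t = j, w t ^ 2) * x j ^ 2 := by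
        rw [← Finset.sum_fiberwise T g]
        congr 1
        refine Finset.sum_congr rfl fun j _ => ?_
        rw [Finset.sum_mul]
        refine Finset.sum_congr rfl fun t ht => ?_
        rw [(Finset.mem_filter.1 ht).2]; ring
    _ ≤ D * ∑ j, B * x j ^ 2 := by
        gcongr with j
        exact hB j
    _ = _ := by rw [← Finset.mul_sum]; ring

/-- The variance parameter `‖∑_e A_e ^ 2‖` of the sparse series is at most `D B` if each row of each
`A_e` comes from at most `D` terms and each variable has total squared weight at most `B`. -/
theorem sum_sparseMatrix_mulVec_sq_le {D : ℕ} {B : ℝ}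
    (hDu : ∀ e i, (T.filter fun t => c t = e ∧ u t = i).card ≤ D)
    (hDv : ∀ e i, (T.filter fun t => c t = e ∧ v t = i).card ≤ D)
    (hBu : ∀ j, ∑ t ∈ T with u t = j, w t ^ 2 ≤ B)
    (hBv : ∀ j, ∑ t ∈ T with v t = j, w t ^ 2 ≤ B) (x : V → ℝ) :
    ∑ e, ∑ i, (sparseMatrix T c u v w e *ᵥ x) i ^ 2 ≤ D * B * ∑ j, x j ^ 2 := by
  have h1 := sum_sq_fiber_sum_le u v hDu hBv x
  have h2 := sum_sq_fiber_sum_le v u hDv hBu x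
  have h3 : ∑ e, ∑ i, (sparseMatrix T c u v w e *ᵥ x) i ^ 2 ≤
      ∑ e, ∑ i, ((1 / 2) * (∑ t ∈ T with c t = e ∧ u t = i, w t * x (v t)) ^ 2 +
        (1 / 2) * (∑ t ∈ T with c t = e ∧ v t = i, w t * x (u t)) ^ 2) := by
    refine Finset.sum_le_sum fun e _ => Finset.sum_le_sum fun i _ => ?_
    rw [sparseMatrix_mulVec]
    nlinarith [sq_nonneg ((∑ t ∈ T with c t = e ∧ u t = i, w t * x (v t)) -
      ∑ t ∈ T with c t = e ∧ v t = i, w t * x (u t))]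
  simp only [Finset.sum_add_distrib, ← Finset.mul_sum] at h3
  linarith

end SparseForm

/-! ### Expected suprema of families of random variables -/

section ExpSup

variable {Z Y : Type*} [MeasurableSpace Z] {μ : Measure Z} {S : Set Y}

/-- `ExpSupLE μ S f B` says that the supremum over `y ∈ S` of the random variables `f y` has
outer expectation at most `B`: it has an integrable majorant of integral at most `B`. Working with
a majorant avoids all measurability questions for the supremum. -/
def ExpSupLE (μ : Measure Z) (S : Set Y) (f : Y → Z → ℝ) (B : ℝ) : Prop :=
  ∃ H : Z → ℝ, Integrable H μ ∧ (∀ᵐ z ∂μ, ∀ y ∈ S, f y z ≤ H z) ∧ ∫ z, H z ∂μ ≤ B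

theorem ExpSupLE.mono {f g : Y → Z → ℝ} {B C : ℝ} (h : ExpSupLE μ S f B)
    (hgf : ∀ᵐ z ∂μ, ∀ y ∈ S, g y z ≤ f y z) (hBC : B ≤ C) : ExpSupLE μ S g C := by
  obtain ⟨H, hH, hfH, hB⟩ := h
  refine ⟨H, hH, ?_, hB.trans hBC⟩
  filter_upwards [hfH, hgf] with z h1 h2 y hy using (h2 y hy).trans (h1 y hy)

theorem ExpSupLE.sum {J : Type*} {s : Finset J} {f : J → Y → Z → ℝ} {B : J → ℝ}
    (h : ∀ j ∈ s, ExpSupLE μ S (f j) (B j)) :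
    ExpSupLE μ S (fun y z => ∑ j ∈ s, f j y z) (∑ j ∈ s, B j) := by
  choose! H hH hfH hB using h
  refine ⟨fun z => ∑ j ∈ s, H j z, integrable_finsetSum _ hH, ?_, ?_⟩
  · have : ∀ᵐ z ∂μ, ∀ j ∈ s, ∀ y ∈ S, f j y z ≤ H j z := (ae_ball_iff s.countable_toSet).2 hfH
    filter_upwards [this] with z hz y hy using Finset.sum_le_sum fun j hj => hz j hj y hy
  · rw [integral_finsetSum _ hH]
    exact Finset.sum_le_sum hB

theorem ExpSupLE.const_mul {f : Y → Z → ℝ} {B a : ℝ} (h : ExpSupLE μ S f B) (ha : 0 ≤ a) :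
    ExpSupLE μ S (fun y z => a * f y z) (a * B) := by
  obtain ⟨H, hH, hfH, hB⟩ := h
  refine ⟨fun z => a * H z, hH.const_mul a, ?_, ?_⟩
  · filter_upwards [hfH] with z hz y hy using mul_le_mul_of_nonneg_left (hz y hy) ha
  · rw [integral_const_mul]; exact mul_le_mul_of_nonneg_left hB ha

/-- Jensen's inequality for the square root. -/
theorem ExpSupLE.sqrt [IsProbabilityMeasure μ] {f : Y → Z → ℝ} {b : ℝ} (hb : 0 < b)
    (hf : ∀ y z, 0 ≤ f y z) (h : ExpSupLE μ S f (b ^ 2)) :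
    ExpSupLE μ S (fun y z => Real.sqrt (f y z)) b := by
  obtain ⟨H, hH, hfH, hB⟩ := h
  refine ⟨fun z => (b + H z / b) / 2, ((integrable_const b).add (hH.div_const b)).div_const 2,
    ?_, ?_⟩
  · filter_upwards [hfH] with z hz y hy
    have h1 : f y z / b ≤ H z / b := div_le_div_of_nonneg_right (hz y hy) hb.le
    have h2 : Real.sqrt (f y z) * (2 * b) ≤ b ^ 2 + f y z := by
      nlinarith [sq_nonneg (b - Real.sqrt (f y z)), Real.sq_sqrt (hf y z)]
    have h3 : Real.sqrt (f y z) ≤ (b + f y z / b) / 2 := by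
      have : (b + f y z / b) / 2 = (b ^ 2 + f y z) / (2 * b) := by field_simp
      rw [this, le_div_iff₀ (by positivity)]; exact h2
    linarith
  · rw [integral_div, integral_add (integrable_const b) (hH.div_const b), integral_const,
      integral_div]
    simp only [probReal_univ, smul_eq_mul, one_mul]
    have : (∫ z, H z ∂μ) / b ≤ b := by rw [div_le_iff₀ hb]; linarith [sq b]
    linarith

/-- The maximal inequality for finitely many variables with Gaussian exponential moments. -/
theorem expSupLE_of_mgf_le {X : Type*} (A : Finset X) (hA : A.Nonempty) (S : Set X)
    (hS : ∀ x ∈ S, x ∈ A) {f : X → Z → ℝ} [IsProbabilityMeasure μ] {l M : ℝ} (hl : 0 < l)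
    (hf : ∀ x ∈ A, Integrable (fun z => Real.exp (l * f x z)) μ)
    (hM : ∀ x ∈ A, ∫ z, Real.exp (l * f x z) ∂μ ≤ Real.exp M) :
    ExpSupLE μ S f ((Real.log A.card + M) / l) := by
  set s : ℝ := A.card * Real.exp M with hs
  have hcard : 0 < (A.card : ℝ) := by exact_mod_cast hA.card_pos
  have hs0 : 0 < s := by positivity
  have hlog : Real.log s = Real.log A.card + M := by
    rw [hs, Real.log_mul hcard.ne' (Real.exp_pos _).ne', Real.log_exp]
  -- the tangent line bound `log t ≤ log s + t / s - 1` replaces Jensen's inequality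
  refine ⟨fun z => (Real.log s - 1 + (∑ x ∈ A, Real.exp (l * f x z)) / s) / l, ?_, ?_, ?_⟩
  · exact (((integrable_const _).add ((integrable_finsetSum A hf).div_const s)).div_const l)
  · refine ae_of_all _ fun z x hx => ?_
    rw [le_div_iff₀ hl]
    have h1 : Real.exp (l * f x z) ≤ ∑ x ∈ A, Real.exp (l * f x z) :=
      Finset.single_le_sum (f := fun x => Real.exp (l * f x z)) (fun _ _ => (Real.exp_pos _).le)
        (hS x hx)
    have h2 := Real.add_one_le_exp (l * f x z - Real.log s)
    rw [Real.exp_sub, Real.exp_log hs0] at h2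
    have h3 := div_le_div_of_nonneg_right h1 hs0.le
    linarith
  · rw [integral_div]
    refine div_le_div_of_nonneg_right ?_ hl.le
    rw [integral_add (integrable_const _)
      ((integrable_finsetSum A hf).div_const s), integral_div, integral_finsetSum A hf,
      integral_const]
    have h1 : (∑ x ∈ A, ∫ z, Real.exp (l * f x z) ∂μ) / s ≤ 1 := by
      rw [div_le_one hs0]
      calc ∑ x ∈ A, ∫ z, Real.exp (l * f x z) ∂μ ≤ ∑ x ∈ A, Real.exp M := Finset.sum_le_sum hM
        _ = s := by rw [Finset.sum_const, nsmul_eq_mul]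
    simp only [probReal_univ, smul_eq_mul, one_mul]
    linarith

end ExpSup

/-! ### Quadratic and cubic forms over linear systems of tuples -/

section Forms

open Matrix

variable {ι κ : Type*}

/-- At most `D` elements of `P` share given values of both `f` and `g`. For arithmetic
progressions, this is the fact that two terms determine the progression up to bounded ambiguity. -/
def PairBounded [DecidableEq ι] (P : Finset κ) (f g : κ → ι) (D : ℕ) : Prop :=
  ∀ a b, (P.filter fun p => f p = a ∧ g p = b).card ≤ D

variable [Fintype ι] [DecidableEq ι] {P : Finset κ} {c r s t : κ → ι} {D : ℕ}

omit [Fintype ι] in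
theorem PairBounded.symm {f g : κ → ι} (h : PairBounded P f g D) : PairBounded P g f D :=
  fun a b => by simpa only [and_comm] using h b a

theorem PairBounded.card_fiber_le {f g : κ → ι} (h : PairBounded P f g D) (a : ι) :
    (P.filter fun p => f p = a).card ≤ D * Fintype.card ι := by
  rw [Finset.card_eq_sum_card_fiberwise (f := g) (t := Finset.univ) (fun _ _ => by simp)]
  calc ∑ b, ((P.filter fun p => f p = a).filter fun p => g p = b).card
      ≤ ∑ _b : ι, D := Finset.sum_le_sum fun b _ => by
        rw [Finset.filter_filter]; exact h a b
    _ = D * Fintype.card ι := by simp [mul_comm]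

theorem PairBounded.card_le {f g : κ → ι} (h : PairBounded P f g D) :
    P.card ≤ D * Fintype.card ι * Fintype.card ι := by
  rw [Finset.card_eq_sum_card_fiberwise (f := f) (t := Finset.univ) (fun _ _ => by simp)]
  calc ∑ a, (P.filter fun p => f p = a).card
      ≤ ∑ _a : ι, D * Fintype.card ι := Finset.sum_le_sum fun a _ => h.card_fiber_le a
    _ = D * Fintype.card ι * Fintype.card ι := by simp [mul_comm]

/-- Quadratic forms over a system of triples: noncommutative Khintchine in dimension `N`, together
with `∑ y_i ^ 2 ≤ N`. -/
theorem expSupLE_quadratic [Nonempty ι] (hD : 0 < D) (hcr : PairBounded P c r D)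
    (hcs : PairBounded P c s D) {n : ℕ} (hn : (Fintype.card ι : ℝ) ≤ Real.exp ((n : ℝ) + 1)) :
    ExpSupLE (stdGaussian (EuclideanSpace ℝ ι)) {y : ι → ℝ | ∀ i, |y i| ≤ 1}
      (fun y z => ∑ p ∈ P, z (c p) * (y (r p) * y (s p)))
      (Fintype.card ι * (2 * Real.sqrt (2 * (n + 1) * (D * (D * Fintype.card ι)) * Real.exp 1))) := by
  have hN : 0 < (Fintype.card ι : ℝ) := by exact_mod_cast Fintype.card_pos
  set A := sparseMatrix P c r s (fun _ => 1) with hA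
  have hAt : ∀ e, (A e)ᵀ = A e := transpose_sparseMatrix
  have hB : ∀ f : κ → ι, PairBounded P c f D → ∀ j, ∑ t ∈ P with f t = j, (1 : ℝ) ^ 2 ≤
      D * Fintype.card ι := by
    intro f hf j
    have := hf.symm.card_fiber_le j
    simp only [one_pow, Finset.sum_const, nsmul_eq_mul, mul_one]
    exact_mod_cast this
  have hv := sum_sparseMatrix_mulVec_sq_le hcr hcs (hB r hcr) (hB s hcs)
  set a := Real.sqrt (2 * (n + 1) * (D * (D * Fintype.card ι)) * Real.exp 1) with ha
  have hD' : (0 : ℝ) < D := by exact_mod_cast hD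
  have ha0 : 0 < a := by positivity
  have hint := integral_seriesMajorant_le hAt (by positivity) hv hn ha0
    (by rw [ha, Real.sq_sqrt (by positivity)])
  refine ⟨fun z => Fintype.card ι * seriesMajorant A a n (fun i => z i),
    (integrable_seriesMajorant A a n).const_mul _, ae_of_all _ fun z y hy => ?_, ?_⟩
  · have h1 := dotProduct_matrixSeries_le hAt ha0 n (fun i => z i) y
    rw [hA, dotProduct_matrixSeries_sparseMatrix] at h1
    have h2 : ∑ i, y i ^ 2 ≤ Fintype.card ι := by
      calc ∑ i, y i ^ 2 ≤ ∑ _i : ι, (1 : ℝ) := Finset.sum_le_sum fun i _ => by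
            rw [← sq_abs]; exact pow_le_one₀ (abs_nonneg _) (hy i)
        _ = Fintype.card ι := by simp
    refine le_trans (le_of_eq ?_)
      (h1.trans (mul_le_mul_of_nonneg_right h2 (seriesMajorant_nonneg hAt ha0 n _)))
    exact Finset.sum_congr rfl fun p _ => by ring
  · rw [integral_const_mul]
    exact mul_le_mul_of_nonneg_left hint hN.le

theorem gaussianExpect_X_mul_X (a b : ι) :
    gaussianExpect ι (MvPolynomial.X a * MvPolynomial.X b) = if a = b then 1 else 0 := by
  rw [gaussianExpect_X_mul, MvPolynomial.pderiv_X, gaussianExpect_apply, Pi.single_apply]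
  by_cases h : a = b
  · simp [h]
  · simp [h, Ne.symm h]

theorem gaussianExpect_linear_sq (Q : Finset κ) (c : κ → ι) (w : κ → ℝ) :
    gaussianExpect ι ((∑ p ∈ Q, MvPolynomial.C (w p) * MvPolynomial.X (c p)) ^ 2) =
      ∑ p ∈ Q, ∑ p' ∈ Q with c p = c p', w p * w p' := by
  rw [sq, Finset.sum_mul_sum, map_sum]
  refine Finset.sum_congr rfl fun p _ => ?_
  rw [map_sum, Finset.sum_filter]
  refine Finset.sum_congr rfl fun p' _ => ?_
  have : (MvPolynomial.C (w p) * MvPolynomial.X (c p) *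
      (MvPolynomial.C (w p') * MvPolynomial.X (c p')) : MvPolynomial ι ℝ) =
      (w p * w p') • (MvPolynomial.X (c p) * MvPolynomial.X (c p')) := by
    rw [MvPolynomial.smul_eq_C_mul, map_mul]; ring
  rw [this, map_smul, gaussianExpect_X_mul_X]
  simp

omit [DecidableEq ι] in
theorem integrable_sqrt_one_add_sum_sq : Integrable
    (fun z : EuclideanSpace ℝ ι => Real.sqrt (1 + ∑ i, z i ^ 2))
      (stdGaussian (EuclideanSpace ℝ ι)) := by
  have h := integrable_eval_stdGaussian (1 + ∑ i, MvPolynomial.X i ^ 2 : MvPolynomial ι ℝ)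
  refine Integrable.mono' h (by fun_prop) (ae_of_all _ fun z => ?_)
  have hs : 0 ≤ ∑ i, z i ^ 2 := Finset.sum_nonneg fun i _ => sq_nonneg _
  simp only [map_add, map_one, map_sum, map_pow, MvPolynomial.eval_X]
  rw [Real.norm_of_nonneg (Real.sqrt_nonneg _), Real.sqrt_le_left (by linarith)]
  nlinarith

theorem integral_sqrt_one_add_sum_sq_le :
    ∫ z : EuclideanSpace ℝ ι, Real.sqrt (1 + ∑ i, z i ^ 2) ∂(stdGaussian (EuclideanSpace ℝ ι)) ≤
      Real.sqrt (Fintype.card ι + 1) := by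
  set b := Real.sqrt (Fintype.card ι + 1) with hb
  have hb0 : 0 < b := Real.sqrt_pos.2 (by positivity)
  have hb2 : b ^ 2 = Fintype.card ι + 1 := Real.sq_sqrt (by positivity)
  set Q : MvPolynomial ι ℝ := 1 + ∑ i, MvPolynomial.X i ^ 2 with hQ
  have hev : ∀ z : EuclideanSpace ℝ ι,
      MvPolynomial.eval (fun i => z i) Q = 1 + ∑ i, z i ^ 2 := by
    intro z; simp [hQ]
  have h := integrable_eval_stdGaussian Q
  have hE : ∫ z : EuclideanSpace ℝ ι, MvPolynomial.eval (fun i => z i) Q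
      ∂(stdGaussian (EuclideanSpace ℝ ι)) = b ^ 2 := by
    have h1 : gaussianExpect ι 1 = 1 := by rw [gaussianExpect_apply]; simp
    rw [← gaussianExpect_apply, hQ, map_add, map_sum, h1, hb2]
    simp [sq, gaussianExpect_X_mul_X, add_comm]
  calc ∫ z : EuclideanSpace ℝ ι, Real.sqrt (1 + ∑ i, z i ^ 2) ∂(stdGaussian (EuclideanSpace ℝ ι))
      ≤ ∫ z : EuclideanSpace ℝ ι, (b + MvPolynomial.eval (fun i => z i) Q / b) / 2
          ∂(stdGaussian (EuclideanSpace ℝ ι)) := by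
        refine integral_mono integrable_sqrt_one_add_sum_sq
          (((integrable_const b).add (h.div_const b)).div_const 2) fun z => ?_
        have hs : 0 ≤ ∑ i, z i ^ 2 := Finset.sum_nonneg fun i _ => sq_nonneg _
        simp only [hev]
        have e : (b + (1 + ∑ i, z i ^ 2) / b) / 2 = (b ^ 2 + (1 + ∑ i, z i ^ 2)) / (2 * b) := by
          field_simp
        rw [e, le_div_iff₀ (by positivity)]
        nlinarith [sq_nonneg (b - Real.sqrt (1 + ∑ i, z i ^ 2)),
          Real.sq_sqrt (show 0 ≤ 1 + ∑ i, z i ^ 2 by linarith)]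
    _ = b := by
        rw [integral_div, integral_add (integrable_const b) (h.div_const b), integral_const,
          integral_div, hE]
        simp only [probReal_univ, smul_eq_mul, one_mul]
        field_simp
        ring

omit [DecidableEq ι] in
/-- Decoupling of a sum of squares of linear forms: `q(x) - q(x') = 2 B(u, v)` where
`u = (x - x') / √2` and `v = (x + x') / √2` are again independent standard Gaussian vectors. -/
theorem ExpSupLE.of_decoupled {Y I : Type*} [Fintype I] {S : Set Y}
    (W : Y → I → EuclideanSpace ℝ ι →ₗ[ℝ] ℝ) {B₁ B₂ : ℝ}
    (hint : ∀ y ∈ S, Integrable (fun z => ∑ i, W y i z ^ 2) (stdGaussian (EuclideanSpace ℝ ι)))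
    (h₁ : ∀ y ∈ S, ∫ z, ∑ i, W y i z ^ 2 ∂(stdGaussian (EuclideanSpace ℝ ι)) ≤ B₁)
    (h₂ : ExpSupLE ((stdGaussian (EuclideanSpace ℝ ι)).prod (stdGaussian (EuclideanSpace ℝ ι))) S
      (fun y z => ∑ i, W y i z.1 * W y i z.2) B₂) :
    ExpSupLE (stdGaussian (EuclideanSpace ℝ ι)) S (fun y z => ∑ i, W y i z ^ 2) (B₁ + 2 * B₂) := by
  obtain ⟨H, hH, hfH, hB⟩ := h₂
  set μ := stdGaussian (EuclideanSpace ℝ ι) with hμ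
  set R : EuclideanSpace ℝ ι × EuclideanSpace ℝ ι →L[ℝ] EuclideanSpace ℝ ι × EuclideanSpace ℝ ι :=
    ContinuousLinearMap.rotation (-(Real.pi / 4)) with hR
  have hmap : (μ.prod μ).map R = μ.prod μ :=
    IsGaussian.map_rotation_eq_self (by simp [hμ]) _
  have hmp : MeasurePreserving R (μ.prod μ) (μ.prod μ) := ⟨R.continuous.measurable, hmap⟩
  have hHR : Integrable (fun x => H (R x)) (μ.prod μ) := hmp.integrable_comp_of_integrable hH
  have hae : ∀ᵐ x ∂μ, ∀ᵐ x' ∂μ, ∀ y ∈ S,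
      ∑ i, W y i (R (x, x')).1 * W y i (R (x, x')).2 ≤ H (R (x, x')) :=
    Measure.ae_ae_of_ae_prod (hmp.quasiMeasurePreserving.ae hfH)
  have hid : ∀ y x x', ∑ i, W y i x ^ 2 - ∑ i, W y i x' ^ 2 =
      2 * ∑ i, W y i (R (x, x')).1 * W y i (R (x, x')).2 := by
    intro y x x'
    rw [← Finset.sum_sub_distrib, Finset.mul_sum]
    refine Finset.sum_congr rfl fun i _ => ?_
    have h2 : (Real.sqrt 2 / 2) * (Real.sqrt 2 / 2) = 1 / 2 := by
      nlinarith [Real.mul_self_sqrt (show (0 : ℝ) ≤ 2 by norm_num)]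
    simp only [hR, ContinuousLinearMap.rotation_apply, Real.cos_neg, Real.sin_neg,
      Real.cos_pi_div_four, Real.sin_pi_div_four, map_add, map_smul, smul_eq_mul, neg_smul, map_neg,
      neg_neg]
    linear_combination (-2 * (W y i x ^ 2 - W y i x' ^ 2)) * h2
  refine ⟨fun x => B₁ + 2 * ∫ x', H (R (x, x')) ∂μ,
    (integrable_const _).add (hHR.integral_prod_left.const_mul 2), ?_, ?_⟩
  · filter_upwards [hae, hHR.prod_right_ae] with x hx hxi y hy
    have e1 : ∑ i, W y i x ^ 2 = ∫ x', (∑ i, W y i x ^ 2 - ∑ i, W y i x' ^ 2) ∂μ +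
        ∫ x', ∑ i, W y i x' ^ 2 ∂μ := by
      rw [integral_sub (integrable_const _) (hint y hy)]
      simp
    have e2 : ∫ x', (∑ i, W y i x ^ 2 - ∑ i, W y i x' ^ 2) ∂μ ≤
        ∫ x', 2 * H (R (x, x')) ∂μ := by
      refine integral_mono_ae ((integrable_const _).sub (hint y hy)) (hxi.const_mul 2) ?_
      filter_upwards [hx] with x' hx'
      have := hx' y hy
      simp only [hid]
      linarith
    rw [integral_const_mul] at e2
    rw [e1]
    linarith [h₁ y hy]
  · rw [integral_add (integrable_const _) (hHR.integral_prod_left.const_mul 2), integral_const,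
      integral_const_mul, ← integral_prod _ hHR]
    have e3 : ∫ z, H (R z) ∂(μ.prod μ) = ∫ z, H z ∂(μ.prod μ) := by
      conv_rhs => rw [← hmap]
      rw [integral_map R.continuous.measurable.aemeasurable]
      rw [hmap]; exact hH.aestronglyMeasurable
    simp only [probReal_univ, smul_eq_mul, one_mul]
    rw [e3]
    linarith

end Forms

section Cubic

open Matrix

variable {ι κ : Type*} [DecidableEq ι]

/-- Pairs of elements of `P` with the same value of `r`. -/
def samePairs (P : Finset κ) (r : κ → ι) : Finset (κ × κ) :=
  (P ×ˢ P).filter fun q => r q.1 = r q.2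

variable {P : Finset κ} {c r s t : κ → ι} {D : ℕ}

/-- Given `c` and `s` of the first element there are at most `D` choices for it, and then `r` and
`t` leave at most `D` choices for the second. -/
theorem card_samePairs_fst_le (hcs : PairBounded P c s D) (hrt : PairBounded P r t D) (e : ι)
    (i : ι × ι) :
    ((samePairs P r).filter fun q => c q.1 = e ∧ (s q.1, t q.2) = i).card ≤ D * D := by
  classical
  have hsub : ((samePairs P r).filter fun q => c q.1 = e ∧ (s q.1, t q.2) = i) ⊆
      (P.filter fun p => c p = e ∧ s p = i.1).biUnion fun p =>
        (P.filter fun p' => r p' = r p ∧ t p' = i.2).image fun p' => (p, p') := by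
    rintro ⟨p, p'⟩ h
    simp only [samePairs, Finset.mem_filter, Finset.mem_product] at h
    obtain ⟨⟨⟨hp, hp'⟩, hr⟩, hc, rfl⟩ := h
    simp only [Finset.mem_biUnion, Finset.mem_filter, Finset.mem_image]
    exact ⟨p, ⟨hp, hc, rfl⟩, p', ⟨hp', hr.symm, rfl⟩, rfl⟩
  refine (Finset.card_le_card hsub).trans ((Finset.card_biUnion_le_card_mul _ _ D
    fun p _ => Finset.card_image_le.trans (hrt _ _)).trans ?_)
  exact Nat.mul_le_mul_right _ (hcs _ _)

theorem card_samePairs_snd_le (hct : PairBounded P c t D) (hrs : PairBounded P r s D) (e : ι)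
    (i : ι × ι) :
    ((samePairs P r).filter fun q => c q.2 = e ∧ (s q.1, t q.2) = i).card ≤ D * D := by
  classical
  have hsub : ((samePairs P r).filter fun q => c q.2 = e ∧ (s q.1, t q.2) = i) ⊆
      (P.filter fun p => c p = e ∧ t p = i.2).biUnion fun p' =>
        (P.filter fun p => r p = r p' ∧ s p = i.1).image fun p => (p, p') := by
    rintro ⟨p, p'⟩ h
    simp only [samePairs, Finset.mem_filter, Finset.mem_product] at h
    obtain ⟨⟨⟨hp, hp'⟩, hr⟩, hc, rfl⟩ := h
    simp only [Finset.mem_biUnion, Finset.mem_filter, Finset.mem_image]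
    exact ⟨p', ⟨hp', hc, rfl⟩, p, ⟨hp, hr, rfl⟩, rfl⟩
  refine (Finset.card_le_card hsub).trans ((Finset.card_biUnion_le_card_mul _ _ D
    fun p _ => Finset.card_image_le.trans (hrs _ _)).trans ?_)
  exact Nat.mul_le_mul_right _ (hct _ _)

variable [Fintype ι]

theorem sum_samePairs_sq_le (hct : PairBounded P c t D) (hrs : PairBounded P r s D)
    (g : ι → ℝ) (i : ι × ι) :
    ∑ q ∈ samePairs P r with (s q.1, t q.2) = i, g (c q.2) ^ 2 ≤ (D * D : ℕ) * ∑ e, g e ^ 2 := by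
  rw [← Finset.sum_fiberwise _ (fun q : κ × κ => c q.2), Finset.mul_sum]
  refine Finset.sum_le_sum fun e _ => ?_
  rw [Finset.filter_filter]
  calc ∑ q ∈ samePairs P r with (s q.1, t q.2) = i ∧ c q.2 = e, g (c q.2) ^ 2
      = ∑ q ∈ samePairs P r with c q.2 = e ∧ (s q.1, t q.2) = i, g e ^ 2 := by
        simp only [and_comm]
        refine Finset.sum_congr rfl fun q hq => ?_
        rw [(Finset.mem_filter.1 hq).2.1]
    _ ≤ _ := by
        rw [Finset.sum_const, nsmul_eq_mul]
        refine mul_le_mul_of_nonneg_right ?_ (sq_nonneg _)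
        exact_mod_cast card_samePairs_snd_le hct hrs e i

/-- The coefficient of `y i` in a cubic form, as a linear form in the Gaussian variable. -/
noncomputable def cubicSlice (P : Finset κ) (c r s t : κ → ι) (y : ι → ℝ) (i : ι) :
    EuclideanSpace ℝ ι →ₗ[ℝ] ℝ :=
  ∑ p ∈ P with r p = i, (y (s p) * y (t p)) • (EuclideanSpace.proj (𝕜 := ℝ) (c p)).toLinearMap

omit [Fintype ι] in
theorem cubicSlice_apply (y : ι → ℝ) (i : ι) (z : EuclideanSpace ℝ ι) :
    cubicSlice P c r s t y i z = ∑ p ∈ P with r p = i, y (s p) * y (t p) * z (c p) := by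
  simp [cubicSlice, LinearMap.sum_apply]

theorem sum_cubicSlice_mul (y : ι → ℝ) (z z' : EuclideanSpace ℝ ι) :
    ∑ i, cubicSlice P c r s t y i z * cubicSlice P c r s t y i z' =
      ∑ q ∈ samePairs P r, z (c q.1) * z' (c q.2) * (y (s q.1) * y (t q.2)) *
        (y (t q.1) * y (s q.2)) := by
  simp only [cubicSlice_apply, Finset.sum_mul_sum]
  rw [samePairs, Finset.sum_filter, Finset.sum_product, ← Finset.sum_fiberwise P r]
  refine Finset.sum_congr rfl fun i _ => Finset.sum_congr rfl fun p hp => ?_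
  rw [Finset.sum_filter]
  refine Finset.sum_congr rfl fun p' _ => ?_
  have hp := (Finset.mem_filter.1 hp).2
  simp only [hp]
  by_cases h : r p' = i
  · rw [if_pos h, if_pos h.symm]; ring
  · rw [if_neg h, if_neg (Ne.symm h)]

theorem sum_cubicSlice_sq_eq_eval (y : ι → ℝ) (z : EuclideanSpace ℝ ι) :
    ∑ i, cubicSlice P c r s t y i z ^ 2 = MvPolynomial.eval (fun i => z i)
      (∑ i, (∑ p ∈ P with r p = i, MvPolynomial.C (y (s p) * y (t p)) *
        MvPolynomial.X (c p)) ^ 2) := by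
  simp [cubicSlice_apply]

theorem integral_sum_cubicSlice_sq_le (hrc : PairBounded P r c D) {y : ι → ℝ}
    (hy : ∀ i, |y i| ≤ 1) :
    ∫ z, ∑ i, cubicSlice P c r s t y i z ^ 2 ∂(stdGaussian (EuclideanSpace ℝ ι)) ≤
      D * (D * Fintype.card ι * Fintype.card ι) := by
  simp only [sum_cubicSlice_sq_eq_eval]
  rw [← gaussianExpect_apply, map_sum]
  simp only [gaussianExpect_linear_sq]
  have h1 : ∀ p p', y (s p) * y (t p) * (y (s p') * y (t p')) ≤ 1 := by
    intro p p'
    refine (le_abs_self _).trans ?_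
    rw [abs_mul, abs_mul, abs_mul]
    exact mul_le_one₀ (mul_le_one₀ (hy _) (abs_nonneg _) (hy _))
      (by positivity) (mul_le_one₀ (hy _) (abs_nonneg _) (hy _))
  calc ∑ i, ∑ p ∈ P with r p = i, ∑ p' ∈ (P.filter fun p => r p = i) with c p = c p',
        y (s p) * y (t p) * (y (s p') * y (t p'))
      ≤ ∑ i, ∑ p ∈ P with r p = i, (D : ℝ) := by
        refine Finset.sum_le_sum fun i _ => Finset.sum_le_sum fun p _ => ?_
        calc ∑ p' ∈ (P.filter fun p => r p = i) with c p = c p',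
              y (s p) * y (t p) * (y (s p') * y (t p'))
            ≤ ∑ p' ∈ (P.filter fun p => r p = i) with c p = c p', (1 : ℝ) :=
              Finset.sum_le_sum fun p' _ => h1 p p'
          _ ≤ D := by
              rw [Finset.sum_const, nsmul_eq_mul, mul_one, Finset.filter_filter]
              have := hrc i (c p)
              simp only [eq_comm (a := c p)]
              exact_mod_cast this
    _ = P.card * D := by rw [Finset.sum_fiberwise]; simp
    _ ≤ _ := by
        rw [mul_comm]
        refine mul_le_mul_of_nonneg_left ?_ (by positivity)
        exact_mod_cast hrc.card_le

omit [Fintype ι] in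
theorem continuous_sparseMatrix {V τ : Type*} [DecidableEq V] (T : Finset τ)
    (c : τ → ι) (u v : τ → V) (e : ι) :
    Continuous fun w : τ → ℝ => sparseMatrix T c u v w e := by
  refine continuous_matrix fun i j => ?_
  simp only [sparseMatrix, of_apply]
  fun_prop

/-- The decoupled form is a Gaussian quadratic form in the `N²` variables `y_a y_b`: pair
`y (s p)` with `y (t p')` and `y (t p)` with `y (s p')`. -/
theorem expSupLE_decoupled_cubic [Nonempty ι] (hD : 0 < D) (hcs : PairBounded P c s D)
    (hct : PairBounded P c t D) (hrs : PairBounded P r s D) (hrt : PairBounded P r t D)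
    {n : ℕ} (hn : ((Fintype.card ι * Fintype.card ι : ℕ) : ℝ) ≤ Real.exp ((n : ℝ) + 1)) :
    ExpSupLE ((stdGaussian (EuclideanSpace ℝ ι)).prod (stdGaussian (EuclideanSpace ℝ ι)))
      {y : ι → ℝ | ∀ i, |y i| ≤ 1}
      (fun y z => ∑ i, cubicSlice P c r s t y i z.1 * cubicSlice P c r s t y i z.2)
      ((Fintype.card ι) ^ 2 * (2 * (Real.sqrt (2 * (n + 1) * (D * D * (D * D)) * Real.exp 1) *
        Real.sqrt (Fintype.card ι + 1)))) := by
  have hN : 0 < (Fintype.card ι : ℝ) := by exact_mod_cast Fintype.card_pos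
  have hD' : (0 : ℝ) < D := by exact_mod_cast hD
  set μ := stdGaussian (EuclideanSpace ℝ ι) with hμ
  set A : EuclideanSpace ℝ ι → ι → Matrix (ι × ι) (ι × ι) ℝ := fun g =>
    sparseMatrix (samePairs P r) (fun q => c q.1) (fun q => (s q.1, t q.2))
      (fun q => (t q.1, s q.2)) (fun q => g (c q.2)) with hA
  have hAt : ∀ g e, (A g e)ᵀ = A g e := fun g => transpose_sparseMatrix
  set C := Real.sqrt (2 * (n + 1) * (D * D * (D * D)) * Real.exp 1) with hC
  have hC0 : 0 < C := by positivity
  set a : EuclideanSpace ℝ ι → ℝ := fun g => C * Real.sqrt (1 + ∑ i, g i ^ 2) with ha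
  have hg0 : ∀ g : EuclideanSpace ℝ ι, 0 ≤ ∑ i, g i ^ 2 :=
    fun g => Finset.sum_nonneg fun i _ => sq_nonneg _
  have ha0 : ∀ g, 0 < a g := fun g =>
    mul_pos hC0 (Real.sqrt_pos.2 (by linarith [hg0 g]))
  have haint : Integrable a μ := integrable_sqrt_one_add_sum_sq.const_mul C
  have hv : ∀ g : EuclideanSpace ℝ ι, ∀ x : ι × ι → ℝ,
      ∑ e, ∑ i, (A g e *ᵥ x) i ^ 2 ≤
        ((D * D : ℕ) * ((D * D : ℕ) * ∑ e, g e ^ 2)) * ∑ j, x j ^ 2 := by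
    intro g x
    refine sum_sparseMatrix_mulVec_sq_le (card_samePairs_fst_le hcs hrt)
      (card_samePairs_fst_le hct hrs) ?_ ?_ x
    · exact sum_samePairs_sq_le hct hrs g
    · exact sum_samePairs_sq_le hcs hrt g
  have hint : ∀ g, ∫ z : EuclideanSpace ℝ ι, seriesMajorant (A g) (a g) n (fun i => z i) ∂μ ≤
      2 * a g := by
    intro g
    have := hg0 g
    refine integral_seriesMajorant_le (hAt g) (by positivity) (hv g) ?_ (ha0 g) ?_
    · rw [Fintype.card_prod]; exact hn
    · rw [ha, mul_pow, hC, Real.sq_sqrt (by positivity), Real.sq_sqrt (by positivity)]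
      push_cast
      have e1 : 0 ≤ 2 * ((n : ℝ) + 1) * (D * D * (D * D)) * Real.exp 1 := by positivity
      nlinarith
  set H : EuclideanSpace ℝ ι × EuclideanSpace ℝ ι → ℝ := fun z =>
    seriesMajorant (A z.2) (a z.2) n (fun i => z.1 i) with hH
  have hHcont : Continuous H := by
    have hacont : Continuous a := by rw [ha]; fun_prop
    have hAcont : ∀ e, Continuous fun g => A g e := fun e =>
      (continuous_sparseMatrix (samePairs P r) (fun q => c q.1) (fun q => (s q.1, t q.2))
        (fun q => (t q.1, s q.2)) e).comp
        (by fun_prop : Continuous fun g : EuclideanSpace ℝ ι => fun q : κ × κ => g (c q.2))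
    have hX : Continuous fun z : EuclideanSpace ℝ ι × EuclideanSpace ℝ ι =>
        matrixSeries (A z.2) (fun i => z.1 i) := by
      simp only [matrixSeries]
      refine continuous_finsetSum _ fun e _ => ?_
      exact (by fun_prop : Continuous fun z : EuclideanSpace ℝ ι × EuclideanSpace ℝ ι =>
        z.1 e).smul ((hAcont e).comp continuous_snd)
    have hatr := (hX.pow (2 * (n + 1))).matrix_trace
    have ha2 := hacont.comp (continuous_snd (X := EuclideanSpace ℝ ι) (Y := EuclideanSpace ℝ ι))
    exact ha2.add (hatr.div (ha2.pow (2 * n + 1)) fun z => (pow_pos (ha0 z.2) _).ne')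
  have hHint : Integrable H (μ.prod μ) := by
    rw [integrable_prod_iff' hHcont.aestronglyMeasurable]
    refine ⟨ae_of_all _ fun g => integrable_seriesMajorant (A g) (a g) n, ?_⟩
    refine Integrable.mono' (haint.const_mul 2)
      hHcont.norm.aestronglyMeasurable.prod_swap.integral_prod_right' (ae_of_all _ fun g => ?_)
    rw [Real.norm_of_nonneg (integral_nonneg fun _ => norm_nonneg _)]
    refine le_trans (le_of_eq (integral_congr_ae (ae_of_all _ fun z => ?_))) (hint g)
    exact Real.norm_of_nonneg (seriesMajorant_nonneg (hAt g) (ha0 g) n _)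
  refine ⟨fun z => (Fintype.card ι) ^ 2 * H z, hHint.const_mul _, ae_of_all _ fun z y hy => ?_, ?_⟩
  · have h1 := dotProduct_matrixSeries_le (hAt z.2) (ha0 z.2) n (fun i => z.1 i)
      (fun j : ι × ι => y j.1 * y j.2)
    rw [hA, dotProduct_matrixSeries_sparseMatrix] at h1
    have h2 : ∑ j : ι × ι, (y j.1 * y j.2) ^ 2 ≤ (Fintype.card ι : ℝ) ^ 2 := by
      calc ∑ j : ι × ι, (y j.1 * y j.2) ^ 2 ≤ ∑ _j : ι × ι, (1 : ℝ) := by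
            refine Finset.sum_le_sum fun j _ => ?_
            rw [← sq_abs, abs_mul]
            exact pow_le_one₀ (by positivity) (mul_le_one₀ (hy _) (abs_nonneg _) (hy _))
        _ = _ := by simp [sq]
    beta_reduce
    rw [sum_cubicSlice_mul]
    exact h1.trans
      (mul_le_mul_of_nonneg_right h2 (seriesMajorant_nonneg (hAt z.2) (ha0 z.2) n _))
  · rw [integral_const_mul]
    refine mul_le_mul_of_nonneg_left ?_ (by positivity)
    rw [integral_prod_symm _ hHint]
    calc ∫ g, ∫ z, H (z, g) ∂μ ∂μ ≤ ∫ g, 2 * a g ∂μ :=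
          integral_mono hHint.integral_prod_right (haint.const_mul 2) hint
      _ = 2 * (C * ∫ g, Real.sqrt (1 + ∑ i, g i ^ 2) ∂μ) := by
          rw [integral_const_mul, ha, integral_const_mul]
      _ ≤ _ := by
          have := integral_sqrt_one_add_sum_sq_le (ι := ι)
          gcongr

/-- Cauchy–Schwarz in one variable, followed by decoupling. -/
theorem expSupLE_cubic [Nonempty ι] (hD : 0 < D) (hrc : PairBounded P r c D)
    (hcs : PairBounded P c s D) (hct : PairBounded P c t D) (hrs : PairBounded P r s D)
    (hrt : PairBounded P r t D) {n : ℕ}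
    (hn : ((Fintype.card ι * Fintype.card ι : ℕ) : ℝ) ≤ Real.exp ((n : ℝ) + 1)) :
    ExpSupLE (stdGaussian (EuclideanSpace ℝ ι)) {y : ι → ℝ | ∀ i, |y i| ≤ 1}
      (fun y z => ∑ p ∈ P, z (c p) * (y (r p) * (y (s p) * y (t p))))
      (Real.sqrt (Fintype.card ι) * Real.sqrt (D * (D * Fintype.card ι * Fintype.card ι) +
        2 * ((Fintype.card ι) ^ 2 * (2 * (Real.sqrt (2 * (n + 1) * (D * D * (D * D)) *
          Real.exp 1) * Real.sqrt (Fintype.card ι + 1)))))) := by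
  have hN : 0 < (Fintype.card ι : ℝ) := by exact_mod_cast Fintype.card_pos
  have hD' : (0 : ℝ) < D := by exact_mod_cast hD
  have h1 := ExpSupLE.of_decoupled (S := {y : ι → ℝ | ∀ i, |y i| ≤ 1})
    (fun y i => cubicSlice P c r s t y i)
    (fun y _ => by
      simp only [sum_cubicSlice_sq_eq_eval]; exact integrable_eval_stdGaussian _)
    (fun y hy => integral_sum_cubicSlice_sq_le hrc hy)
    (expSupLE_decoupled_cubic hD hcs hct hrs hrt hn)
  set b2 : ℝ := D * (D * Fintype.card ι * Fintype.card ι) +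
        2 * ((Fintype.card ι) ^ 2 * (2 * (Real.sqrt (2 * (n + 1) * (D * D * (D * D)) *
          Real.exp 1) * Real.sqrt (Fintype.card ι + 1)))) with hb2
  have hb0 : 0 < b2 := by positivity
  rw [← Real.sq_sqrt hb0.le] at h1
  have h2 := (h1.sqrt (Real.sqrt_pos.2 hb0)
    (fun y z => Finset.sum_nonneg fun i _ => sq_nonneg _)).const_mul
      (Real.sqrt_nonneg (Fintype.card ι))
  refine h2.mono (ae_of_all _ fun z y hy => ?_) le_rfl
  have h3 : ∑ p ∈ P, z (c p) * (y (r p) * (y (s p) * y (t p))) =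
      ∑ i, y i * cubicSlice P c r s t y i z := by
    rw [← Finset.sum_fiberwise P r]
    refine Finset.sum_congr rfl fun i _ => ?_
    rw [cubicSlice_apply, Finset.mul_sum]
    refine Finset.sum_congr rfl fun p hp => ?_
    rw [(Finset.mem_filter.1 hp).2]; ring
  have h4 : ∑ i, y i ^ 2 ≤ Fintype.card ι := by
    calc ∑ i, y i ^ 2 ≤ ∑ _i : ι, (1 : ℝ) := Finset.sum_le_sum fun i _ => by
          rw [← sq_abs]; exact pow_le_one₀ (abs_nonneg _) (hy i)
      _ = Fintype.card ι := by simp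
  rw [h3]
  refine (Real.sum_mul_le_sqrt_mul_sqrt _ _ _).trans ?_
  gcongr

end Cubic

/-! ### Multilinear forms: reduction to few variables by random colouring -/

section Coloring

variable {ι J κ : Type*} [Fintype ι] [DecidableEq ι] [Fintype J] [DecidableEq J]

omit [DecidableEq ι] in
theorem integral_exp_inner_stdGaussian (x : EuclideanSpace ℝ ι) :
    Integrable (fun z => Real.exp (inner ℝ x z)) (stdGaussian (EuclideanSpace ℝ ι)) ∧
      ∫ z, Real.exp (inner ℝ x z) ∂(stdGaussian (EuclideanSpace ℝ ι)) =
        Real.exp (‖x‖ ^ 2 / 2) := by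
  have hc : Continuous fun z : EuclideanSpace ℝ ι => Real.exp (inner ℝ x z) := by fun_prop
  have he : ∀ z : ι → ℝ, Real.exp (inner ℝ x (WithLp.toLp 2 z)) = ∏ i, Real.exp (x i * z i) := by
    intro z
    rw [← Real.exp_sum, PiLp.inner_apply]
    simp [mul_comm]
  rw [integrable_stdGaussian_iff hc.aestronglyMeasurable,
    integral_stdGaussian hc.aestronglyMeasurable]
  simp only [he]
  refine ⟨Integrable.fintype_prod (f := fun i t => Real.exp (x i * t))
    fun i => integrable_exp_mul_gaussianReal _, ?_⟩
  rw [integral_fintype_prod_eq_prod (fun i t => Real.exp (x i * t))]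
  have : ∀ i, ∫ t, Real.exp (x i * t) ∂(gaussianReal 0 1) = Real.exp (x i ^ 2 / 2) := by
    intro i
    have := congrFun (mgf_fun_id_gaussianReal (μ := 0) (v := 1)) (x i)
    simpa [mgf] using this
  simp only [this]
  rw [← Real.exp_sum, EuclideanSpace.real_norm_sq_eq, Finset.sum_div]

/-- A random colouring with `m` colours gives two distinct points the same colour with probability
at most `1 / m`. -/
theorem mul_card_coloring_eq_le (m : ℕ) {a b : ι} (hab : a ≠ b) :
    m * (Finset.univ.filter fun g : ι → Fin m => g a = g b).card ≤ m ^ Fintype.card ι := by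
  have h : ((Finset.univ : Finset (Fin m)) ×ˢ
      (Finset.univ.filter fun g : ι → Fin m => g a = g b)).card ≤
      (Finset.univ : Finset (ι → Fin m)).card := by
    refine Finset.card_le_card_of_injOn (fun q => Function.update q.2 a q.1) (fun _ _ => by simp) ?_
    rintro ⟨x, g⟩ hg ⟨x', g'⟩ hg' h
    simp only [Finset.coe_product, Set.mem_prod, Finset.mem_coe, Finset.mem_filter,
      Finset.mem_univ, true_and] at hg hg' h
    have hx : x = x' := by simpa using congrFun h a
    have hne : ∀ i, i ≠ a → g i = g' i := fun i hi => by
      simpa [Function.update_of_ne hi] using congrFun h i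
    refine Prod.ext hx (funext fun i => ?_)
    by_cases hi : i = a
    · subst hi
      exact hg.trans ((hne b hab.symm).trans hg'.symm)
    · exact hne i hi
  simpa [Finset.card_product] using h

theorem pow_mul_card_coloring_eq_le (m : ℕ) {a b : J → ι} (hab : ∀ i, a i ≠ b i) :
    m ^ Fintype.card J *
      (Finset.univ.filter fun f : J → ι → Fin m => ∀ i, f i (a i) = f i (b i)).card ≤
      (m ^ Fintype.card ι) ^ Fintype.card J := by
  have h1 : (Finset.univ.filter fun f : J → ι → Fin m => ∀ i, f i (a i) = f i (b i)) =
      Fintype.piFinset fun i => Finset.univ.filter fun g : ι → Fin m => g (a i) = g (b i) := by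
    ext f; simp
  rw [h1, Fintype.card_piFinset]
  have h2 : m ^ Fintype.card J = ∏ _i : J, m := by simp
  have h3 : (m ^ Fintype.card ι) ^ Fintype.card J = ∏ _i : J, m ^ Fintype.card ι := by simp
  rw [h2, h3, ← Finset.prod_mul_distrib]
  exact Finset.prod_le_prod' fun i _ => mul_card_coloring_eq_le m (hab i)

variable (P : Finset κ) (c : κ → ι) (π : J → κ → ι) {D m : ℕ}

/-- Pairs with the same value of `c` that a colouring `f` of the variables (one colouring for each
slot) does not separate. -/
def collisions (f : J → ι → Fin m) : Finset (κ × κ) :=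
  (samePairs P c).filter fun q => ∀ i, f i (π i q.1) = f i (π i q.2)

variable {P c π}

omit [Fintype J] [DecidableEq J] in
theorem card_samePairs_le [Nonempty J] (h : ∀ i, PairBounded P c (π i) D) :
    (samePairs P c).card ≤ Fintype.card ι * (D * Fintype.card ι) ^ 2 := by
  obtain ⟨i⟩ := ‹Nonempty J›
  rw [Finset.card_eq_sum_card_fiberwise (f := fun q => c q.1) (t := Finset.univ)
    (fun _ _ => by simp)]
  calc ∑ a, ((samePairs P c).filter fun q => c q.1 = a).card
      ≤ ∑ _a : ι, (D * Fintype.card ι) ^ 2 := by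
        refine Finset.sum_le_sum fun a _ => ?_
        have hsub : ((samePairs P c).filter fun q => c q.1 = a) ⊆
            (P.filter fun p => c p = a) ×ˢ (P.filter fun p => c p = a) := by
          rintro ⟨p, p'⟩ hq
          simp only [samePairs, Finset.mem_filter, Finset.mem_product] at hq ⊢
          exact ⟨⟨hq.1.1.1, hq.2⟩, hq.1.1.2, hq.1.2 ▸ hq.2⟩
        refine (Finset.card_le_card hsub).trans ?_
        rw [Finset.card_product, sq]
        exact Nat.mul_le_mul ((h i).card_fiber_le a) ((h i).card_fiber_le a)
    _ = _ := by simp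

omit [DecidableEq J] in
theorem card_intersecting_le [Nonempty J] (h : ∀ i, PairBounded P c (π i) D) :
    ((samePairs P c).filter fun q => ∃ i, π i q.1 = π i q.2).card ≤
      Fintype.card J * (D * (D * Fintype.card ι * Fintype.card ι)) := by
  classical
  have hsub : ((samePairs P c).filter fun q => ∃ i, π i q.1 = π i q.2) ⊆
      (Finset.univ : Finset J).biUnion fun i => P.biUnion fun p =>
        (P.filter fun p' => c p' = c p ∧ π i p' = π i p).image fun p' => (p, p') := by
    rintro ⟨p, p'⟩ hq
    simp only [samePairs, Finset.mem_filter, Finset.mem_product] at hq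
    obtain ⟨⟨⟨hp, hp'⟩, hc⟩, i, hi⟩ := hq
    simp only [Finset.mem_biUnion, Finset.mem_filter, Finset.mem_image, Finset.mem_univ, true_and]
    exact ⟨i, p, hp, p', ⟨hp', hc.symm, hi.symm⟩, rfl⟩
  refine (Finset.card_le_card hsub).trans ((Finset.card_biUnion_le_card_mul _ _ _ fun i _ =>
    (Finset.card_biUnion_le_card_mul _ _ _ fun p _ =>
      Finset.card_image_le.trans (h i _ _)).trans
        (Nat.mul_le_mul_right D (h i).card_le)).trans (le_of_eq ?_))
  rw [Finset.card_univ]; ring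

/-- Some colouring has few collisions: a random colouring separates pairs with disjoint slots with
probability `1 - m ^ (-|J|)`, and there are few other pairs. -/
theorem exists_coloring_collisions_le [Nonempty J] (h : ∀ i, PairBounded P c (π i) D)
    (hm : 0 < m) (hmN : Fintype.card ι ≤ m ^ Fintype.card J) :
    ∃ f : J → ι → Fin m, (collisions P c π f).card ≤
      (Fintype.card J + 1) * (D * (D * Fintype.card ι * Fintype.card ι)) := by
  classical
  set N := Fintype.card ι
  set K := Fintype.card J
  set Q := (samePairs P c).filter fun q => ¬ ∃ i, π i q.1 = π i q.2 with hQ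
  set tot := (m ^ N) ^ K with htot
  have hcard : (Finset.univ : Finset (J → ι → Fin m)).card = tot := by
    simp [htot, N, K]
  have hsplit : ∀ f : J → ι → Fin m, (collisions P c π f).card ≤
      K * (D * (D * N * N)) + (Q.filter fun q => ∀ i, f i (π i q.1) = f i (π i q.2)).card := by
    intro f
    refine le_trans ?_ (Nat.add_le_add_right (card_intersecting_le h) _)
    refine le_trans (Finset.card_le_card ?_) (Finset.card_union_le _ _)
    intro q hq
    simp only [collisions, Finset.mem_filter] at hq
    simp only [hQ, Finset.mem_union, Finset.mem_filter]
    by_cases hx : ∃ i, π i q.1 = π i q.2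
    · exact Or.inl ⟨hq.1, hx⟩
    · exact Or.inr ⟨⟨hq.1, hx⟩, hq.2⟩
  have hsum : m ^ K * ∑ f : J → ι → Fin m,
      (Q.filter fun q => ∀ i, f i (π i q.1) = f i (π i q.2)).card ≤ Q.card * tot := by
    simp only [Finset.card_filter (fun q : κ × κ => ∀ i, _ = _)]
    rw [Finset.sum_comm, Finset.mul_sum, ← smul_eq_mul Q.card, ← Finset.sum_const]
    refine Finset.sum_le_sum fun q hq => ?_
    rw [← Finset.card_filter]
    have hq := (Finset.mem_filter.1 hq).2
    push Not at hq
    exact pow_mul_card_coloring_eq_le m hq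
  have hQc : Q.card ≤ m ^ K * (D * (D * N * N)) := by
    refine ((Finset.card_filter_le _ _).trans (card_samePairs_le h)).trans ?_
    calc N * (D * N) ^ 2 = N * (D * (D * N * N)) := by ring
      _ ≤ _ := Nat.mul_le_mul_right _ hmN
  have hsum2 : ∑ f : J → ι → Fin m,
      (Q.filter fun q => ∀ i, f i (π i q.1) = f i (π i q.2)).card ≤ D * (D * N * N) * tot := by
    refine Nat.le_of_mul_le_mul_left (hsum.trans ?_) (pow_pos hm K)
    rw [← mul_assoc]
    exact Nat.mul_le_mul_right _ hQc
  have : Nonempty (J → ι → Fin m) := ⟨fun _ _ => ⟨0, hm⟩⟩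
  obtain ⟨f, -, hf⟩ : ∃ f ∈ (Finset.univ : Finset (J → ι → Fin m)),
      (Q.filter fun q => ∀ i, f i (π i q.1) = f i (π i q.2)).card ≤ D * (D * N * N) :=
    Finset.exists_le_of_sum_le Finset.univ_nonempty
      (by rw [Finset.sum_const, hcard, smul_eq_mul, mul_comm]; exact hsum2)
  refine ⟨f, (hsplit f).trans ?_⟩
  calc _ ≤ K * (D * (D * N * N)) + D * (D * N * N) := Nat.add_le_add_left hf _
    _ = _ := by ring

omit [DecidableEq J] in
/-- The part of a multilinear form with colour pattern `e` only involves the variables in the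
corresponding colour classes, so that few sign patterns of `y` have to be considered. -/
theorem expSupLE_color_class (f : J → ι → Fin m) (e : J → Fin m) {l : ℝ} (hl : 0 < l) :
    ExpSupLE (stdGaussian (EuclideanSpace ℝ ι)) {y : ι → ℝ | ∀ i, y i = 0 ∨ y i = 1}
      (fun y z => ∑ p ∈ P with (fun i => f i (π i p)) = e, z (c p) * ∏ i, y (π i p))
      ((Real.log 2 * ∑ i, ((Finset.univ.filter fun a => f i a = e i).card : ℝ) +
        l ^ 2 / 2 * ((collisions P c π f).filter
          fun q => (fun i => f i (π i q.1)) = e).card) / l) := by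
  classical
  set μ := stdGaussian (EuclideanSpace ℝ ι)
  set Pe := P.filter fun p => (fun i => f i (π i p)) = e with hPe
  set U : Finset ι := Finset.univ.biUnion fun i => Finset.univ.filter fun a => f i a = e i with hU
  set coef : (ι → ℝ) → EuclideanSpace ℝ ι := fun y =>
    WithLp.toLp 2 fun a => ∑ p ∈ Pe with c p = a, ∏ i, y (π i p) with hcoef
  have hinner : ∀ y (z : EuclideanSpace ℝ ι),
      inner ℝ (coef y) z = ∑ p ∈ Pe, z (c p) * ∏ i, y (π i p) := by
    intro y z
    rw [PiLp.inner_apply, ← Finset.sum_fiberwise Pe c]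
    refine Finset.sum_congr rfl fun a _ => ?_
    simp only [hcoef, RCLike.inner_apply, conj_trivial]
    rw [Finset.mul_sum]
    refine Finset.sum_congr rfl fun p hp => ?_
    rw [(Finset.mem_filter.1 hp).2]
  set σ2 : ℝ :=
    (((collisions P c π f).filter fun q => (fun i => f i (π i q.1)) = e).card : ℝ) with hσ
  -- only the `2 ^ |U|` indicator vectors of subsets of `U` matter
  set χ : Finset ι → ι → ℝ := fun B a => if a ∈ B then 1 else 0 with hχ
  have hnorm : ∀ B, ‖coef (χ B)‖ ^ 2 ≤ σ2 := by
    intro B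
    have hprod0 : ∀ p, 0 ≤ ∏ i, χ B (π i p) := fun p =>
      Finset.prod_nonneg fun i _ => by simp only [hχ]; split_ifs <;> norm_num
    have hprod1 : ∀ p, ∏ i, χ B (π i p) ≤ 1 := fun p =>
      Finset.prod_le_one (fun i _ => by simp only [hχ]; split_ifs <;> norm_num)
        (fun i _ => by simp only [hχ]; split_ifs <;> norm_num)
    rw [EuclideanSpace.real_norm_sq_eq]
    calc ∑ a, (coef (χ B) a) ^ 2
        ≤ ∑ a, ((Pe.filter fun p => c p = a).card : ℝ) ^ 2 := by
          refine Finset.sum_le_sum fun a _ => ?_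
          refine pow_le_pow_left₀ (Finset.sum_nonneg fun p _ => hprod0 p) ?_ 2
          calc ∑ p ∈ Pe with c p = a, ∏ i, χ B (π i p)
              ≤ ∑ p ∈ Pe with c p = a, (1 : ℝ) := Finset.sum_le_sum fun p _ => hprod1 p
            _ = _ := by simp
      _ = ((Finset.univ : Finset ι).biUnion fun a => (Pe.filter fun p => c p = a) ×ˢ
            (Pe.filter fun p => c p = a)).card := by
          rw [Finset.card_biUnion]
          · push_cast [Finset.card_product, sq]; rfl
          · intro a _ b _ hab
            rw [Function.onFun, Finset.disjoint_left]
            rintro ⟨p, p'⟩ h1 h2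
            simp only [Finset.mem_product, Finset.mem_filter] at h1 h2
            exact hab (h1.1.2.symm.trans h2.1.2)
      _ ≤ σ2 := by
          rw [hσ]
          refine Nat.cast_le.2 (Finset.card_le_card ?_)
          rintro ⟨p, p'⟩ hq
          simp only [Finset.mem_biUnion, Finset.mem_product, Finset.mem_filter, Finset.mem_univ,
            true_and, hPe] at hq
          obtain ⟨a, ⟨⟨hp, hpe⟩, hpa⟩, ⟨hp', hpe'⟩, hpa'⟩ := hq
          simp only [collisions, samePairs, Finset.mem_filter, Finset.mem_product]
          exact ⟨⟨⟨⟨hp, hp'⟩, hpa.trans hpa'.symm⟩, fun i =>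
            (congrFun hpe i).trans (congrFun hpe' i).symm⟩, hpe⟩
  have hmax := expSupLE_of_mgf_le (μ := μ) U.powerset ⟨∅, by simp⟩ (S := {B | B ⊆ U})
    (fun B hB => Finset.mem_powerset.2 hB)
    (f := fun B z => ∑ p ∈ Pe, z (c p) * ∏ i, χ B (π i p)) (M := l ^ 2 / 2 * σ2) hl
    (fun B _ => by
      simp only [← hinner, ← real_inner_smul_left]
      exact (integral_exp_inner_stdGaussian _).1)
    (fun B _ => by
      simp only [← hinner, ← real_inner_smul_left]
      rw [(integral_exp_inner_stdGaussian _).2, norm_smul, mul_pow, Real.norm_eq_abs, sq_abs]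
      refine Real.exp_le_exp.2 ?_
      have := hnorm B
      nlinarith [sq_nonneg l])
  obtain ⟨H, hH, hfH, hB⟩ := hmax
  refine ⟨H, hH, ?_, hB.trans ?_⟩
  · filter_upwards [hfH] with z hz y hy
    have h1 := hz (U.filter fun a => y a = 1) (Finset.filter_subset _ _)
    refine le_trans (le_of_eq (Finset.sum_congr rfl fun p hp => ?_)) h1
    congr 1
    refine Finset.prod_congr rfl fun i _ => ?_
    have hpU : π i p ∈ U := by
      simp only [hU, Finset.mem_biUnion, Finset.mem_filter, Finset.mem_univ, true_and]
      exact ⟨i, congrFun (Finset.mem_filter.1 hp).2 i⟩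
    rcases hy (π i p) with h0 | h0 <;> simp [hχ, hpU, h0]
  · refine div_le_div_of_nonneg_right (add_le_add_left ?_ _) hl.le
    rw [Finset.card_powerset]
    push_cast
    rw [Real.log_pow, mul_comm]
    refine mul_le_mul_of_nonneg_left ?_ (Real.log_nonneg (by norm_num))
    exact_mod_cast Finset.card_biUnion_le

/-- Multilinear forms in `|J|` variables. The parameter `l` balances the entropy of the colour
classes against the variances. -/
theorem expSupLE_multilinear [Nonempty J] (h : ∀ i, PairBounded P c (π i) D)
    (hm : 0 < m) (hmN : Fintype.card ι ≤ m ^ Fintype.card J) {l : ℝ} (hl : 0 < l) :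
    ExpSupLE (stdGaussian (EuclideanSpace ℝ ι)) {y : ι → ℝ | ∀ i, y i = 0 ∨ y i = 1}
      (fun y z => ∑ p ∈ P, z (c p) * ∏ i, y (π i p))
      ((Real.log 2 * (Fintype.card J * m ^ (Fintype.card J - 1) * Fintype.card ι) +
        l ^ 2 / 2 * ((Fintype.card J + 1) * (D * (D * Fintype.card ι * Fintype.card ι)))) / l) := by
  classical
  obtain ⟨f, hf⟩ := exists_coloring_collisions_le h hm hmN
  have hs := ExpSupLE.sum (s := (Finset.univ : Finset (J → Fin m)))
    (fun e _ => expSupLE_color_class (P := P) (c := c) (π := π) f e hl)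
  refine hs.mono (ae_of_all _ fun z y _ => le_of_eq ?_) ?_
  · exact (Finset.sum_fiberwise P (fun p i => f i (π i p)) _).symm
  · rw [← Finset.sum_div]
    refine div_le_div_of_nonneg_right ?_ hl.le
    rw [Finset.sum_add_distrib, ← Finset.mul_sum, ← Finset.mul_sum]
    refine add_le_add (le_of_eq ?_) (mul_le_mul_of_nonneg_left ?_ (by positivity))
    · congr 1
      rw [Finset.sum_comm]
      have h1 : ∀ i : J, ∑ e : J → Fin m,
          ((Finset.univ.filter fun a => f i a = e i).card : ℝ) =
          m ^ (Fintype.card J - 1) * Fintype.card ι := by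
        intro i
        have h2 : ∀ x : Fin m, (Finset.univ.filter fun e : J → Fin m => e i = x).card =
            m ^ (Fintype.card J - 1) := by
          intro x
          have : (Finset.univ.filter fun e : J → Fin m => e i = x) =
              Fintype.piFinset fun j => if j = i then {x} else Finset.univ := by
            ext e
            simp only [Finset.mem_filter, Finset.mem_univ, true_and, Fintype.mem_piFinset]
            constructor
            · intro hx j
              by_cases hj : j = i
              · subst hj; simp [hx]
              · simp [hj]
            · intro hx; simpa using hx i
          rw [this, Fintype.card_piFinset, ← Finset.mul_prod_erase _ _ (Finset.mem_univ i)]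
          rw [Finset.prod_congr rfl (g := fun _ => m) (fun j hj => by
            simp [Finset.ne_of_mem_erase hj])]
          simp [Finset.card_erase_of_mem]
        have h3 : ∑ e : J → Fin m, ((Finset.univ.filter fun a => f i a = e i).card : ℝ) =
            ∑ a : ι, ((Finset.univ.filter fun e : J → Fin m => e i = f i a).card : ℝ) := by
          simp only [Finset.card_filter, Nat.cast_sum]
          rw [Finset.sum_comm]
          simp only [eq_comm]
        rw [h3]
        simp [h2, mul_comm]
      simp only [h1]
      simp [mul_assoc]
    · have h4 : ∑ e : J → Fin m, (((collisions P c π f).filter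
          fun q => (fun i => f i (π i q.1)) = e).card : ℝ) = (collisions P c π f).card := by
        rw [← Nat.cast_sum]
        congr 1
        exact (Finset.card_eq_sum_card_fiberwise (fun _ _ => by simp)).symm
      rw [h4]
      exact_mod_cast hf

end Coloring

/-! ### The gradient of the progression count -/

section Progressions

variable {G : Type*} [AddCommGroup G] [DecidableEq G]

/-- The pairs `(a, b)` such that all terms `a, a + b, …, a + (k - 1) b` lie in `Ω`. For `k ≥ 2` this
is a finite set, since `a` and `a + b` determine `b`. -/
def apSet (k : ℕ) (Ω : Finset G) : Finset (G × G) :=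
  ((Ω ×ˢ Ω).image fun q => (q.1, q.2 - q.1)).filter fun p => ∀ i < k, p.1 + i • p.2 ∈ Ω

variable {k : ℕ} {Ω : Finset G}

theorem mem_apSet (hk : 2 ≤ k) {p : G × G} : p ∈ apSet k Ω ↔ ∀ i < k, p.1 + i • p.2 ∈ Ω := by
  refine ⟨fun h => (Finset.mem_filter.1 h).2, fun h => Finset.mem_filter.2 ⟨?_, h⟩⟩
  refine Finset.mem_image.2 ⟨(p.1, p.1 + p.2), Finset.mem_product.2 ⟨?_, ?_⟩, ?_⟩
  · simpa using h 0 (by omega)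
  · simpa using h 1 (by omega)
  · simp

/-- The `i`-th term of a progression, as an element of `Ω`. -/
def apPos (k : ℕ) (Ω : Finset G) (i : Fin k) (p : apSet k Ω) : Ω :=
  ⟨p.1.1 + (i : ℕ) • p.1.2, (Finset.mem_filter.1 p.2).2 i i.2⟩

theorem apCount_eq_sum (hk : 2 ≤ k) (y : EuclideanSpace ℝ Ω) :
    apCount k Ω y = ∑ p, ∏ i, y (apPos k Ω i p) := by
  rw [apCount, finsum_eq_sum_of_support_subset (s := apSet k Ω), ← Finset.sum_coe_sort]
  · refine Finset.sum_congr rfl fun p _ => ?_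
    rw [Finset.prod_range]
    refine Finset.prod_congr rfl fun i _ => ?_
    rw [zeroExtend, dif_pos ((Finset.mem_filter.1 p.2).2 i i.2)]
    rfl
  · intro p hp
    rw [Finset.mem_coe, mem_apSet hk]
    intro i hi
    by_contra h
    refine hp (Finset.prod_eq_zero (Finset.mem_range.2 hi) ?_)
    rw [zeroExtend, dif_neg h]

theorem inner_gradient_apCount (hk : 2 ≤ k) (y z : EuclideanSpace ℝ Ω) :
    inner ℝ (gradient (apCount k Ω) y) z =
      ∑ j, ∑ p, z (apPos k Ω j p) * ∏ i ∈ Finset.univ.erase j, y (apPos k Ω i p) := by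
  have h1 : apCount k Ω = fun y => ∑ p, ∏ i, EuclideanSpace.proj (𝕜 := ℝ) (apPos k Ω i p) y := by
    ext y; rw [apCount_eq_sum hk]; rfl
  have h2 : HasFDerivAt (apCount k Ω) (∑ p, ∑ j, (∏ i ∈ Finset.univ.erase j,
      EuclideanSpace.proj (𝕜 := ℝ) (apPos k Ω i p) y) •
        (EuclideanSpace.proj (𝕜 := ℝ) (apPos k Ω j p) : EuclideanSpace ℝ Ω →L[ℝ] ℝ)) y := by
    rw [h1]
    exact HasFDerivAt.fun_sum fun p _ => HasFDerivAt.finsetProd fun i _ =>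
      ContinuousLinearMap.hasFDerivAt _
  rw [gradient, InnerProductSpace.toDual_symm_apply, h2.fderiv, Finset.sum_comm]
  simp [mul_comm]

/-- `G` has at most `D` solutions `b` of each equation `d b = w` with `0 < d < k`. -/
def FewDivisions (G : Type*) [AddCommGroup G] (k D : ℕ) : Prop :=
  ∀ d : ℕ, 0 < d → d < k → ∀ (w : G) (s : Finset G), (∀ b ∈ s, d • b = w) → s.card ≤ D

theorem fewDivisions_int (k : ℕ) : FewDivisions ℤ k 1 := by
  intro d hd _ w s hs
  refine Finset.card_le_one.2 fun a ha b hb => ?_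
  have := (hs a ha).trans (hs b hb).symm
  simpa [hd.ne'] using this

theorem fewDivisions_zmod (k N : ℕ) [NeZero N] : FewDivisions (ZMod N) k k := by
  intro d hd hdk w s hs
  rcases s.eq_empty_or_nonempty with rfl | ⟨b₀, hb₀⟩
  · simp
  have h1 := IsAddCyclic.card_nsmul_eq_zero_le (α := ZMod N) hd
  have h2 : s.card ≤ (Finset.univ.filter fun a : ZMod N => d • a = 0).card := by
    refine Finset.card_le_card_of_injOn (fun b => b - b₀) (fun b hb => ?_)
      (fun a _ b _ h => sub_left_injective h)
    simp only [Finset.coe_filter, Finset.mem_univ, true_and, Set.mem_ofPred_eq]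
    rw [nsmul_sub, hs b hb, hs b₀ hb₀, sub_self]
  omega

/-- Two terms of a progression determine a multiple `(j - i) b` of its difference. -/
theorem pairBounded_apPos {D : ℕ} (hG : FewDivisions G k D) {i j : Fin k} (hij : i ≠ j) :
    PairBounded Finset.univ (apPos k Ω i) (apPos k Ω j) D := by
  wlog h : i < j generalizing i j
  · exact (this hij.symm (lt_of_le_of_ne (not_lt.1 h) hij.symm)).symm
  intro a b
  have hinj : Set.InjOn (fun p : apSet k Ω => p.1.2)
      ↑(Finset.univ.filter fun p => apPos k Ω i p = a ∧ apPos k Ω j p = b) := by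
    intro p hp q hq hpq
    have h1 := (Finset.mem_filter.1 hp).2.1.trans (Finset.mem_filter.1 hq).2.1.symm
    have h1 := congrArg Subtype.val h1
    simp only [apPos] at h1 hpq
    rw [hpq] at h1
    exact Subtype.ext (Prod.ext (add_right_cancel h1) hpq)
  rw [← Finset.card_image_of_injOn hinj]
  refine hG (j - i) (by have := Fin.lt_def.1 h; omega) (by omega) (b.1 - a.1) _ fun x hx => ?_
  obtain ⟨p, hp, rfl⟩ := Finset.mem_image.1 hx
  obtain ⟨-, rfl, rfl⟩ := Finset.mem_filter.1 hp
  have hle : (i : ℕ) ≤ j := (Fin.lt_def.1 h).le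
  simp only [apPos]
  rw [add_sub_add_left_eq_sub, sub_nsmul _ hle, sub_eq_add_neg]

theorem sSup_inner_apGradients_nonneg (hk : 2 ≤ k) (z : EuclideanSpace ℝ Ω) :
    0 ≤ sSup ((fun x => inner ℝ x z) '' apGradients k Ω) := by
  -- the gradient at `y = 0` vanishes
  refine Real.sSup_nonneg' ⟨0, ?_, le_rfl⟩
  refine ⟨_, ⟨0, fun a => Or.inl rfl, rfl⟩, ?_⟩
  simp only [real_inner_smul_left, inner_gradient_apCount hk]
  refine mul_eq_zero_of_right _ (Finset.sum_eq_zero fun j _ => Finset.sum_eq_zero fun p _ => ?_)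
  have : Nontrivial (Fin k) := Fin.nontrivial_iff_two_le.2 hk
  obtain ⟨i, hi⟩ := exists_ne j
  exact mul_eq_zero_of_right _
    (Finset.prod_eq_zero (Finset.mem_erase.2 ⟨hi, Finset.mem_univ i⟩) rfl)

theorem gaussianWidth_apGradients_nonneg (hk : 2 ≤ k) : 0 ≤ gaussianWidth (apGradients k Ω) :=
  integral_nonneg fun z => sSup_inner_apGradients_nonneg hk z

/-- It suffices to bound the form obtained by differentiating in each slot separately. -/
theorem gaussianWidth_apGradients_le (hk : 2 ≤ k) {B : Fin k → ℝ}
    (h : ∀ j, ExpSupLE (stdGaussian (EuclideanSpace ℝ Ω)) {y : Ω → ℝ | ∀ a, y a = 0 ∨ y a = 1}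
      (fun y z => ∑ p, z (apPos k Ω j p) * ∏ i ∈ Finset.univ.erase j, y (apPos k Ω i p)) (B j)) :
    gaussianWidth (apGradients k Ω) ≤ (Ω.card : ℝ)⁻¹ * ∑ j, B j := by
  obtain ⟨H, hH, hfH, hB⟩ := (ExpSupLE.sum fun j (_ : j ∈ Finset.univ) => h j).const_mul
    (show 0 ≤ (Ω.card : ℝ)⁻¹ by positivity)
  refine le_trans (integral_mono_of_nonneg (ae_of_all _ fun z => ?_) hH ?_) hB
  · exact sSup_inner_apGradients_nonneg hk z
  · filter_upwards [hfH] with z hz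
    refine csSup_le ?_ ?_
    · exact ⟨_, _, ⟨0, fun a => Or.inl rfl, rfl⟩, rfl⟩
    · rintro _ ⟨_, ⟨y, hy, rfl⟩, rfl⟩
      simp only [real_inner_smul_left, inner_gradient_apCount hk]
      exact hz y hy

/-! ### Upper bounds -/

theorem two_mul_log_two_ge {N : ℝ} (hN : 2 ≤ N) : 1 ≤ 2 * Real.log N := by
  have h1 := Real.log_two_gt_d9
  have h2 := Real.log_le_log (by norm_num) hN
  linarith

theorem gaussianWidth_apGradients_le_rpow (hk : 3 ≤ k) (D : ℕ) (hG : FewDivisions G k D)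
    (hΩ : Ω.Nonempty) :
    gaussianWidth (apGradients k Ω) ≤ (k * (Real.log 2 * (((k - 1 : ℕ) : ℝ) * 2 ^ (k - 2)) +
      (1 / 2) * ((((k - 1 : ℕ) : ℝ) + 1) * (D * D)))) *
        (Ω.card : ℝ) ^ (1 - 1 / (2 * ((k : ℝ) - 1))) := by
  set K := k - 1 with hK
  have hkK : ((k : ℝ) - 1) = (K : ℝ) := by rw [hK, Nat.cast_sub (by omega)]; simp
  have hK0 : (0 : ℝ) < K := by exact_mod_cast (by omega : 0 < K)
  set N : ℝ := (Ω.card : ℝ) with hN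
  have hN1 : 1 ≤ N := by rw [hN]; exact_mod_cast hΩ.card_pos
  have hN0 : 0 < N := by linarith
  obtain ⟨t, ht1, htN, hexp⟩ : ∃ t : ℝ, 1 ≤ t ∧ N = t ^ (2 * K) ∧
      N ^ (1 - 1 / (2 * ((k : ℝ) - 1))) = N / t := by
    refine ⟨N ^ (1 / (2 * (K : ℝ))), Real.one_le_rpow hN1 (by positivity), ?_, ?_⟩
    · rw [← Real.rpow_natCast, ← Real.rpow_mul hN0.le]
      push_cast
      rw [one_div_mul_cancel (by positivity), Real.rpow_one]
    · rw [hkK, Real.rpow_sub hN0, Real.rpow_one]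
  have ht0 : 0 < t := by linarith
  -- the number of colours; `t ^ 2 = N ^ (1 / K)`, and the entropy parameter below is `1 / t`
  set m := ⌈t ^ 2⌉₊ with hm
  have hm0 : 0 < m := Nat.ceil_pos.2 (by positivity)
  have hmt : t ^ 2 ≤ m := Nat.le_ceil _
  have hm2 : (m : ℝ) ≤ 2 * t ^ 2 := by
    have h1 := (Nat.ceil_lt_add_one (by positivity : 0 ≤ t ^ 2)).le
    have h2 : 1 ≤ t ^ 2 := one_le_pow₀ ht1
    linarith
  have hmN : Ω.card ≤ m ^ K := by
    have : N ≤ (m : ℝ) ^ K := by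
      rw [htN, pow_mul]; exact pow_le_pow_left₀ (by positivity) hmt _
    rw [hN] at this
    exact_mod_cast this
  have hl : 0 < t⁻¹ := by positivity
  have hj : ∀ j : Fin k, ExpSupLE (stdGaussian (EuclideanSpace ℝ Ω))
      {y : Ω → ℝ | ∀ a, y a = 0 ∨ y a = 1}
      (fun y z => ∑ p, z (apPos k Ω j p) * ∏ i ∈ Finset.univ.erase j, y (apPos k Ω i p))
      ((Real.log 2 * (K * m ^ (K - 1) * N) +
        t⁻¹ ^ 2 / 2 * ((K + 1) * (D * (D * N * N)))) / t⁻¹) := by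
    intro j
    have hcard : Fintype.card {i : Fin k // i ≠ j} = K := by
      rw [Fintype.card_subtype_compl]; simp [hK]
    have : Nonempty {i : Fin k // i ≠ j} := by
      rw [← Fintype.card_pos_iff, hcard]; omega
    have h := expSupLE_multilinear (P := (Finset.univ : Finset (apSet k Ω)))
      (c := apPos k Ω j) (π := fun i : {i : Fin k // i ≠ j} => apPos k Ω i.1)
      (fun i => pairBounded_apPos hG i.2.symm) hm0 (by rw [hcard, Fintype.card_coe]; exact hmN) hl
    rw [hcard, Fintype.card_coe] at h
    refine h.mono (ae_of_all _ fun z y _ => le_of_eq (Finset.sum_congr rfl fun p _ => ?_)) le_rfl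
    congr 1
    exact (Finset.prod_subtype _ (fun i => by simp) _)
  refine (gaussianWidth_apGradients_le (by omega) hj).trans ?_
  rw [Finset.sum_const, Finset.card_univ, Fintype.card_fin, nsmul_eq_mul, hexp]
  have hmK : (m : ℝ) ^ (K - 1) ≤ 2 ^ (K - 1) * (t ^ 2) ^ (K - 1) := by
    rw [← mul_pow]; exact pow_le_pow_left₀ (by positivity) hm2 _
  have htK : (t ^ 2) ^ (K - 1) * t = N / t := by
    rw [eq_div_iff ht0.ne', htN, mul_assoc, ← sq, ← pow_succ, Nat.sub_add_cancel (by omega),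
      ← pow_mul]
  have hk2 : k - 2 = K - 1 := by omega
  rw [hk2]
  have hlog : 0 < Real.log 2 := Real.log_pos (by norm_num)
  calc N⁻¹ * (k * ((Real.log 2 * (K * m ^ (K - 1) * N) +
        t⁻¹ ^ 2 / 2 * ((K + 1) * (D * (D * N * N)))) / t⁻¹))
      = k * (Real.log 2 * K * (m ^ (K - 1) * t) + (1 / 2) * ((K + 1) * (D * D)) * (N / t)) := by
        field_simp
    _ ≤ k * (Real.log 2 * K * (2 ^ (K - 1) * (t ^ 2) ^ (K - 1) * t) +
          (1 / 2) * ((K + 1) * (D * D)) * (N / t)) := by gcongr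
    _ = k * (Real.log 2 * K * (2 ^ (K - 1) * (N / t)) +
          (1 / 2) * ((K + 1) * (D * D)) * (N / t)) := by rw [mul_assoc (2 ^ (K - 1)), htK]
    _ = _ := by ring

theorem abs_le_one_of_zero_or_one {x : ℝ} (h : x = 0 ∨ x = 1) : |x| ≤ 1 := by
  rcases h with rfl | rfl <;> simp

theorem gaussianWidth_apGradients_three_le {D : ℕ} (hD : 0 < D) (hG : FewDivisions G 3 D)
    (hΩ : 2 ≤ Ω.card) :
    gaussianWidth (apGradients 3 Ω) ≤
      6 * Real.sqrt (6 * D * D * Real.exp 1) * Real.sqrt (Ω.card * Real.log Ω.card) := by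
  set N : ℝ := (Ω.card : ℝ) with hN
  have hN2 : 2 ≤ N := by rw [hN]; exact_mod_cast hΩ
  have hlog := two_mul_log_two_ge hN2
  set n := ⌊Real.log N⌋₊ with hn
  have hn1 : N ≤ Real.exp ((n : ℝ) + 1) := by
    rw [← Real.log_le_iff_le_exp (by linarith)]
    exact (Nat.lt_floor_add_one _).le
  have hn2 : (n : ℝ) + 1 ≤ 3 * Real.log N := by
    have := Nat.floor_le (show 0 ≤ Real.log N by linarith)
    linarith
  have : Nonempty Ω := (Finset.card_pos.1 (by omega)).to_subtype
  have h3 : ∀ j : Fin 3, ∃ r s, j ≠ r ∧ j ≠ s ∧ r ≠ s ∧ Finset.univ.erase j = {r, s} := by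
    decide
  have hj : ∀ j : Fin 3, ExpSupLE (stdGaussian (EuclideanSpace ℝ Ω))
      {y : Ω → ℝ | ∀ a, y a = 0 ∨ y a = 1}
      (fun y z => ∑ p, z (apPos 3 Ω j p) * ∏ i ∈ Finset.univ.erase j, y (apPos 3 Ω i p))
      (N * (2 * Real.sqrt (2 * (n + 1) * (D * (D * N)) * Real.exp 1))) := by
    intro j
    obtain ⟨r, s, hjr, hjs, hrs, he⟩ := h3 j
    have h := expSupLE_quadratic (P := (Finset.univ : Finset (apSet 3 Ω))) hD
      (pairBounded_apPos hG hjr) (pairBounded_apPos hG hjs) (n := n)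
      (by rw [Fintype.card_coe]; exact hn1)
    rw [Fintype.card_coe] at h
    obtain ⟨H, hH, hfH, hB⟩ := h
    refine ⟨H, hH, ?_, hB⟩
    filter_upwards [hfH] with z hz y hy
    have := hz y fun a => abs_le_one_of_zero_or_one (hy a)
    simpa only [he, Finset.prod_pair hrs] using this
  refine (gaussianWidth_apGradients_le (by norm_num) hj).trans ?_
  rw [Finset.sum_const, Finset.card_univ, Fintype.card_fin, nsmul_eq_mul]
  have hN0 : N ≠ 0 := by linarith
  calc N⁻¹ * ((3 : ℕ) * (N * (2 * Real.sqrt (2 * (n + 1) * (D * (D * N)) * Real.exp 1))))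
      = 6 * Real.sqrt (2 * (n + 1) * (D * (D * N)) * Real.exp 1) := by
        field_simp; push_cast; ring
    _ ≤ 6 * Real.sqrt ((6 * D * D * Real.exp 1) * (N * Real.log N)) := by
        refine mul_le_mul_of_nonneg_left (Real.sqrt_le_sqrt ?_) (by norm_num)
        have : 0 ≤ 2 * (D * (D * N)) * Real.exp 1 := by positivity
        nlinarith
    _ = _ := by rw [Real.sqrt_mul (by positivity)]; ring

theorem gaussianWidth_apGradients_four_le {D : ℕ} (hD : 0 < D) (hG : FewDivisions G 4 D)
    (hΩ : 2 ≤ Ω.card) :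
    gaussianWidth (apGradients 4 Ω) ≤
      24 * D * ((Ω.card : ℝ) ^ (3 / 4 : ℝ) * Real.log Ω.card ^ (1 / 4 : ℝ)) := by
  set N : ℝ := (Ω.card : ℝ) with hN
  have hN2 : 2 ≤ N := by rw [hN]; exact_mod_cast hΩ
  have hN0 : 0 < N := by linarith
  have hlog := two_mul_log_two_ge hN2
  set L := Real.log N with hL
  have hL0 : 0 < L := by linarith
  set n := ⌊2 * L⌋₊ with hn
  have hn1 : N * N ≤ Real.exp ((n : ℝ) + 1) := by
    rw [← Real.log_le_iff_le_exp (by positivity), Real.log_mul hN0.ne' hN0.ne', ← two_mul]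
    exact (Nat.lt_floor_add_one _).le
  have hn2 : (n : ℝ) + 1 ≤ 4 * L := by
    have := Nat.floor_le (show 0 ≤ 2 * L by linarith)
    linarith
  have : Nonempty Ω := (Finset.card_pos.1 (by omega)).to_subtype
  have h4 : ∀ j : Fin 4, ∃ r s t, j ≠ r ∧ j ≠ s ∧ j ≠ t ∧ r ≠ s ∧ r ≠ t ∧ s ≠ t ∧
      Finset.univ.erase j = {r, s, t} := by
    decide
  set b2 : ℝ := D * (D * N * N) + 2 * (N ^ 2 * (2 * (Real.sqrt (2 * (n + 1) * (D * D * (D * D)) *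
    Real.exp 1) * Real.sqrt (N + 1)))) with hb2
  have hj : ∀ j : Fin 4, ExpSupLE (stdGaussian (EuclideanSpace ℝ Ω))
      {y : Ω → ℝ | ∀ a, y a = 0 ∨ y a = 1}
      (fun y z => ∑ p, z (apPos 4 Ω j p) * ∏ i ∈ Finset.univ.erase j, y (apPos 4 Ω i p))
      (Real.sqrt N * Real.sqrt b2) := by
    intro j
    obtain ⟨r, s, t, hjr, hjs, hjt, hrs, hrt, hst, he⟩ := h4 j
    have h := expSupLE_cubic (P := (Finset.univ : Finset (apSet 4 Ω))) hD
      (pairBounded_apPos hG hjr.symm) (pairBounded_apPos hG hjs) (pairBounded_apPos hG hjt)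
      (pairBounded_apPos hG hrs) (pairBounded_apPos hG hrt) (n := n)
      (by rw [Fintype.card_coe]; push_cast; exact hn1)
    rw [Fintype.card_coe] at h
    obtain ⟨H, hH, hfH, hB⟩ := h
    refine ⟨H, hH, ?_, hB⟩
    filter_upwards [hfH] with z hz y hy
    have := hz y fun a => abs_le_one_of_zero_or_one (hy a)
    have hr : r ∉ ({s, t} : Finset (Fin 4)) := by simp [hrs, hrt]
    simpa only [he, Finset.prod_insert hr, Finset.prod_pair hst] using this
  refine (gaussianWidth_apGradients_le (by norm_num) hj).trans ?_
  rw [Finset.sum_const, Finset.card_univ, Fintype.card_fin, nsmul_eq_mul]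
  -- express everything through the fourth roots of `N` and `log N`
  obtain ⟨q, hq0, hqN, hq3⟩ : ∃ q : ℝ, 0 < q ∧ N = q ^ 4 ∧ N ^ (3 / 4 : ℝ) = q ^ 3 := by
    refine ⟨N ^ (1 / 4 : ℝ), Real.rpow_pos_of_pos hN0 _, ?_, ?_⟩ <;>
    · rw [← Real.rpow_natCast, ← Real.rpow_mul hN0.le]; norm_num
  obtain ⟨u, hu0, huL, hu⟩ : ∃ u : ℝ, 0 < u ∧ L = u ^ 4 ∧ L ^ (1 / 4 : ℝ) = u := by
    refine ⟨L ^ (1 / 4 : ℝ), Real.rpow_pos_of_pos hL0 _, ?_, rfl⟩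
    rw [← Real.rpow_natCast, ← Real.rpow_mul hL0.le]; norm_num
  rw [hq3, hu]
  clear hq3 hu
  have hD' : (0 : ℝ) < D := by exact_mod_cast hD
  -- the diagonal term `D ^ 2 N ^ 2` is absorbed since `N log N ≥ 1`
  have hqu : 1 ≤ q ^ 2 * u ^ 2 := by
    have : 1 ≤ (q ^ 2 * u ^ 2) ^ 2 := by
      calc (1 : ℝ) ≤ N * L := by nlinarith
        _ = _ := by rw [hqN, huL]; ring
    exact (one_le_sq_iff₀ (by positivity)).1 this
  have hs1 : Real.sqrt (2 * (n + 1) * (D * D * (D * D)) * Real.exp 1) * Real.sqrt (N + 1) ≤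
      8 * D ^ 2 * (q ^ 2 * u ^ 2) := by
    rw [← Real.sqrt_mul (by positivity)]
    refine Real.sqrt_le_iff.2 ⟨by positivity, ?_⟩
    have he := Real.exp_one_lt_d9.le
    calc 2 * ((n : ℝ) + 1) * (D * D * (D * D)) * Real.exp 1 * (N + 1)
        ≤ 2 * (4 * L) * (D * D * (D * D)) * 4 * (2 * N) := by
          gcongr
          · linarith
          · linarith
      _ = (8 * D ^ 2 * (q ^ 2 * u ^ 2)) ^ 2 := by rw [hqN, huL]; ring
  have hb : Real.sqrt b2 ≤ 6 * D * q ^ 5 * u := by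
    refine Real.sqrt_le_iff.2 ⟨by positivity, ?_⟩
    calc b2 ≤ D * (D * N * N) * (q ^ 2 * u ^ 2) +
          2 * (N ^ 2 * (2 * (8 * D ^ 2 * (q ^ 2 * u ^ 2)))) := by
          refine add_le_add (le_mul_of_one_le_right (by positivity) hqu) ?_
          gcongr
      _ = 33 * (D ^ 2 * q ^ 10 * u ^ 2) := by rw [hqN]; ring
      _ ≤ 36 * (D ^ 2 * q ^ 10 * u ^ 2) := by gcongr; norm_num
      _ = _ := by ring
  have hsN : Real.sqrt N = q ^ 2 := by
    rw [hqN, show q ^ 4 = (q ^ 2) ^ 2 by ring, Real.sqrt_sq (by positivity)]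
  rw [hsN]
  calc N⁻¹ * ((4 : ℕ) * (q ^ 2 * Real.sqrt b2))
      ≤ N⁻¹ * ((4 : ℕ) * (q ^ 2 * (6 * D * q ^ 5 * u))) := by gcongr
    _ = _ := by rw [hqN]; field_simp; push_cast; ring

end Progressions

/-! ### The expected maximum of independent Gaussian variables -/

section GaussianMax

theorem gaussianReal_Ici_ge {t : ℝ} (ht : 0 ≤ t) :
    (Real.sqrt (2 * Real.pi))⁻¹ * Real.exp (-(t + 1) ^ 2 / 2) ≤
      (gaussianReal 0 1).real (Set.Ici t) := by
  have h1 : (gaussianReal 0 1).real (Set.Icc t (t + 1)) =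
      ∫ x in Set.Icc t (t + 1), gaussianPDFReal 0 1 x := by
    rw [Measure.real, gaussianReal_apply_eq_integral _ one_ne_zero,
      ENNReal.toReal_ofReal (integral_nonneg fun x => gaussianPDFReal_nonneg _ _ _)]
  have h2 : (Real.sqrt (2 * Real.pi))⁻¹ * Real.exp (-(t + 1) ^ 2 / 2) =
      ∫ _x in Set.Icc t (t + 1), (Real.sqrt (2 * Real.pi))⁻¹ * Real.exp (-(t + 1) ^ 2 / 2) := by
    simp
  refine le_trans ?_ (measureReal_mono (Set.Icc_subset_Ici_self : Set.Icc t (t + 1) ⊆ Set.Ici t))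
  rw [h1, h2]
  refine setIntegral_mono_on (integrableOn_const (by simp))
    (integrable_gaussianPDFReal 0 1).integrableOn measurableSet_Icc fun x hx => ?_
  rw [gaussianPDFReal_def]
  simp only [NNReal.coe_one, mul_one, sub_zero]
  refine mul_le_mul_of_nonneg_left (Real.exp_le_exp.2 ?_) (by positivity)
  have : x ^ 2 ≤ (t + 1) ^ 2 := pow_le_pow_left₀ (ht.trans hx.1) hx.2 2
  linarith

theorem integral_abs_gaussianReal_le : ∫ x, |x| ∂(gaussianReal 0 1) ≤ 1 := by
  have hi : Integrable (fun x : ℝ => |x|) (gaussianReal 0 1) := by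
    simpa using (integrable_pow_gaussianReal 1).abs
  have h2 := integral_pow_succ_gaussianReal 1
  simp only [Nat.cast_one, one_mul, Nat.sub_self, pow_zero, integral_const, probReal_univ,
    smul_eq_mul] at h2
  calc ∫ x, |x| ∂(gaussianReal 0 1) ≤ ∫ x, (1 + x ^ (1 + 1)) / 2 ∂(gaussianReal 0 1) := by
        refine integral_mono hi
          (((integrable_const 1).add (integrable_pow_gaussianReal 2)).div_const 2) fun x => ?_
        have : x ^ (1 + 1) = |x| ^ 2 := by rw [sq_abs]
        simp only [this]
        nlinarith [sq_nonneg (|x| - 1)]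
    _ = 1 := by
        rw [integral_div, integral_add (integrable_const 1) (integrable_pow_gaussianReal 2), h2]
        simp

/-- If `H` dominates all coordinates of `n` independent standard Gaussian variables then its mean is
at least of order `√(log n)`: each coordinate exceeds `t = √(log n) - 1` with probability at
least `1 / n`, hence some coordinate does with probability at least `1 / 2`. -/
theorem sqrt_log_le_integral_pi {n : ℕ} (hn : 8 ≤ n) {H : (Fin n → ℝ) → ℝ}
    (hH : Integrable H (Measure.pi fun _ => gaussianReal 0 1)) (hmax : ∀ x r, x r ≤ H x) :
    Real.sqrt (Real.log n) / 2 - 3 / 2 ≤ ∫ x, H x ∂(Measure.pi fun _ => gaussianReal 0 1) := by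
  set μ : Measure (Fin n → ℝ) := Measure.pi fun _ => gaussianReal 0 1 with hμ
  set t := Real.sqrt (Real.log n) - 1 with ht
  have hn' : (8 : ℝ) ≤ n := by exact_mod_cast hn
  have hn0 : (0 : ℝ) < n := by linarith
  have hlog1 : 1 ≤ Real.log n := by
    rw [Real.le_log_iff_exp_le hn0]
    have := Real.exp_one_lt_d9
    linarith
  have ht0 : 0 ≤ t := by
    have := Real.one_le_sqrt.2 hlog1
    linarith
  set r0 : Fin n := ⟨0, by omega⟩
  set p := (gaussianReal 0 1).real (Set.Ici t) with hp
  have hpn : 1 / (n : ℝ) ≤ p := by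
    refine le_trans ?_ (gaussianReal_Ici_ge ht0)
    have h1 : -(t + 1) ^ 2 / 2 = -(Real.log n / 2) := by
      rw [ht, sub_add_cancel, Real.sq_sqrt (by linarith)]; ring
    have h2 : Real.exp (-(Real.log n / 2)) = (Real.sqrt n)⁻¹ := by
      rw [Real.exp_neg, Real.exp_half, Real.exp_log hn0]
    rw [h1, h2, ← mul_inv, one_div]
    refine inv_anti₀ (by positivity) ?_
    have h3 : Real.sqrt (2 * Real.pi) ≤ Real.sqrt n := by
      refine Real.sqrt_le_sqrt ?_
      have := Real.pi_lt_d2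
      linarith
    calc Real.sqrt (2 * Real.pi) * Real.sqrt n ≤ Real.sqrt n * Real.sqrt n := by gcongr
      _ = n := Real.mul_self_sqrt hn0.le
  set S : Set (Fin n → ℝ) := Set.pi Set.univ fun _ => Set.Iio t with hS
  have hSm : MeasurableSet S := MeasurableSet.univ_pi fun _ => measurableSet_Iio
  have hSle : μ.real S ≤ 1 / 2 := by
    have h1 : μ.real S = (1 - p) ^ n := by
      rw [Measure.real, hμ, hS, Measure.pi_pi, Finset.prod_const, Finset.card_univ,
        Fintype.card_fin, ENNReal.toReal_pow]
      congr 1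
      have := probReal_compl_eq_one_sub (μ := gaussianReal 0 1) (measurableSet_Ici (a := t))
      rw [Set.compl_Ici] at this
      exact this
    have hp1 : p ≤ 1 := measureReal_le_one
    rw [h1]
    calc (1 - p) ^ n ≤ (Real.exp (-(1 / (n : ℝ)))) ^ n := by
          refine pow_le_pow_left₀ (by linarith) ?_ n
          have := Real.add_one_le_exp (-(1 / (n : ℝ)))
          linarith
      _ = Real.exp (-1) := by
          rw [← Real.exp_nat_mul]
          congr 1
          field_simp
      _ ≤ 1 / 2 := by
          rw [Real.exp_neg, ← one_div]
          refine one_div_le_one_div_of_le (by norm_num) ?_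
          have := Real.add_one_le_exp (1 : ℝ)
          linarith
  have habs : Integrable (fun x : Fin n → ℝ => |x r0|) μ := by
    have hi : Integrable (fun x : ℝ => |x|) (gaussianReal 0 1) := by
      simpa using (integrable_pow_gaussianReal 1).abs
    exact integrable_comp_eval (i := r0) hi
  have habs1 : ∫ x, |x r0| ∂μ ≤ 1 := by
    refine le_trans (le_of_eq ?_) integral_abs_gaussianReal_le
    exact integral_comp_eval (μ := fun _ : Fin n => gaussianReal 0 1) (i := r0)
      (f := fun x : ℝ => |x|) (by fun_prop)
  have hind : Integrable (Sᶜ.indicator fun _ => t) μ :=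
    (integrable_const t).indicator hSm.compl
  have hlow : ∫ x, (Sᶜ.indicator (fun _ => t) x - |x r0|) ∂μ ≤ ∫ x, H x ∂μ := by
    refine integral_mono (hind.sub habs) hH fun x => ?_
    have h0 := abs_nonneg (x r0)
    by_cases hx : x ∈ S
    · have h1 : x ∉ Sᶜ := fun h => h hx
      simp only [Set.indicator_of_notMem h1]
      have := neg_abs_le (x r0)
      have := hmax x r0
      linarith
    · simp only [Set.indicator_of_mem (Set.mem_compl hx)]
      simp only [hS, Set.mem_univ_pi, Set.mem_Iio, not_forall, not_lt] at hx
      obtain ⟨r, hr⟩ := hx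
      have := hmax x r
      linarith
  rw [integral_sub hind habs, integral_indicator_const t hSm.compl,
    probReal_compl_eq_one_sub hSm, smul_eq_mul] at hlow
  nlinarith

/-- The coordinates of a standard Gaussian vector along an orthonormal family are independent. -/
theorem map_inner_stdGaussian {E : Type*} [NormedAddCommGroup E] [InnerProductSpace ℝ E]
    [FiniteDimensional ℝ E] [MeasurableSpace E] [BorelSpace E] {n : ℕ} {e : Fin n → E}
    (he : Orthonormal ℝ e) :
    (stdGaussian E).map (fun z => WithLp.toLp 2 fun r => inner ℝ (e r) z) =
      stdGaussian (EuclideanSpace ℝ (Fin n)) := by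
  have hmeas : Measurable fun z : E =>
      (WithLp.toLp 2 fun r => inner ℝ (e r) z : EuclideanSpace ℝ (Fin n)) := by
    have : Continuous fun z : E =>
      (WithLp.toLp 2 fun r => inner ℝ (e r) z : EuclideanSpace ℝ (Fin n)) := by fun_prop
    exact this.measurable
  have : IsProbabilityMeasure ((stdGaussian E).map fun z =>
      (WithLp.toLp 2 fun r => inner ℝ (e r) z : EuclideanSpace ℝ (Fin n))) :=
    Measure.isProbabilityMeasure_map hmeas.aemeasurable
  apply Measure.ext_of_charFun
  ext t
  rw [charFun_stdGaussian, charFun_apply, integral_map hmeas.aemeasurable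
    (Continuous.aestronglyMeasurable (by fun_prop))]
  have h1 : ∀ z : E, inner ℝ (WithLp.toLp 2 fun r => inner ℝ (e r) z : EuclideanSpace ℝ (Fin n)) t =
      inner ℝ z (∑ r, t r • e r) := by
    intro z
    rw [inner_sum, PiLp.inner_apply]
    refine Finset.sum_congr rfl fun r _ => ?_
    rw [real_inner_smul_right, ← real_inner_comm z]
    simp
  simp only [h1]
  rw [← charFun_apply, charFun_stdGaussian]
  congr 3
  rw [← Complex.ofReal_pow, ← Complex.ofReal_pow, ← real_inner_self_eq_norm_sq, he.inner_sum,
    EuclideanSpace.real_norm_sq_eq]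
  simp [sq]

theorem sqrt_log_le_integral_orthonormal {E : Type*} [NormedAddCommGroup E]
    [InnerProductSpace ℝ E] [FiniteDimensional ℝ E] [MeasurableSpace E] [BorelSpace E] {n : ℕ}
    (hn : 8 ≤ n) {e : Fin n → E} (he : Orthonormal ℝ e) :
    ∃ H : E → ℝ, Integrable H (stdGaussian E) ∧ (∀ z, ∃ r, H z = inner ℝ (e r) z) ∧
      Real.sqrt (Real.log n) / 2 - 3 / 2 ≤ ∫ z, H z ∂(stdGaussian E) := by
  have hne : (Finset.univ : Finset (Fin n)).Nonempty := ⟨⟨0, by omega⟩, Finset.mem_univ _⟩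
  set M : (Fin n → ℝ) → ℝ := fun x => Finset.univ.sup' hne fun r => x r with hM
  have hMc : Continuous M := Continuous.finset_sup'_apply hne fun r _ => continuous_apply r
  have hMmax : ∀ x r, x r ≤ M x := fun x r => Finset.le_sup' (fun r => x r) (Finset.mem_univ r)
  have hMex : ∀ x, ∃ r, M x = x r := fun x => by
    obtain ⟨r, -, hr⟩ := Finset.exists_mem_eq_sup' hne fun r => x r
    exact ⟨r, hr⟩
  have hMint : Integrable M (Measure.pi fun _ => gaussianReal 0 1) := by
    have hi : Integrable (fun x : ℝ => |x|) (gaussianReal 0 1) := by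
      simpa using (integrable_pow_gaussianReal 1).abs
    refine Integrable.mono' (integrable_finsetSum Finset.univ fun r _ =>
      integrable_comp_eval (μ := fun _ : Fin n => gaussianReal 0 1) (i := r) hi)
      hMc.aestronglyMeasurable (ae_of_all _ fun x => ?_)
    obtain ⟨r, hr⟩ := hMex x
    rw [hr, Real.norm_eq_abs]
    exact Finset.single_le_sum (f := fun r => |x r|) (fun _ _ => abs_nonneg _) (Finset.mem_univ r)
  have h1 := sqrt_log_le_integral_pi hn hMint hMmax
  have hMc' : Continuous fun z : EuclideanSpace ℝ (Fin n) => M fun r => z r :=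
    hMc.comp (by fun_prop)
  have hLc : Continuous fun z : E =>
      (WithLp.toLp 2 fun r => inner ℝ (e r) z : EuclideanSpace ℝ (Fin n)) := by fun_prop
  have h2 : Integrable (fun z : EuclideanSpace ℝ (Fin n) => M fun r => z r)
      (stdGaussian (EuclideanSpace ℝ (Fin n))) :=
    (integrable_stdGaussian_iff hMc'.aestronglyMeasurable).2 hMint
  refine ⟨fun z => M fun r => inner ℝ (e r) z, ?_, fun z => hMex _, ?_⟩
  · rw [← map_inner_stdGaussian he] at h2
    exact (integrable_map_measure hMc'.aestronglyMeasurable hLc.measurable.aemeasurable).1 h2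
  · refine h1.trans (le_of_eq ?_)
    have h3 := integral_stdGaussian (ι := Fin n) hMc'.aestronglyMeasurable
    rw [← map_inner_stdGaussian he, integral_map hLc.measurable.aemeasurable
      hMc'.aestronglyMeasurable] at h3
    exact h3.symm

/-! ### Lower bounds for Gaussian widths by projection -/

/-- The Gaussian width does not increase under orthogonal projection; if the projection of `K` to
the span of an orthonormal family reaches height `α` in each of its directions, the width is
at least `α` times the expected maximum of independent Gaussian variables. -/
theorem le_gaussianWidth_of_orthonormal {ι : Type*} [Fintype ι] {K : Set (EuclideanSpace ℝ ι)}
    (hK : K.Finite) (hK0 : K.Nonempty) {n : ℕ} (hn : 8 ≤ n) {e : Fin n → EuclideanSpace ℝ ι}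
    (he : Orthonormal ℝ e) {α : ℝ} (hα : 0 ≤ α)
    (h : ∀ z ∈ Submodule.span ℝ (Set.range e), ∀ r, ∃ x ∈ K, α * inner ℝ (e r) z ≤ inner ℝ x z) :
    α * (Real.sqrt (Real.log n) / 2 - 3 / 2) ≤ gaussianWidth K := by
  set μ := stdGaussian (EuclideanSpace ℝ ι) with hμ
  set V := Submodule.span ℝ (Set.range e) with hV
  obtain ⟨H, hH, hHr, hHint⟩ := sqrt_log_le_integral_orthonormal hn he
  set g : EuclideanSpace ℝ ι → ℝ := fun z => sSup ((fun x => inner ℝ x z) '' K) with hg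
  have hbdd : ∀ z, BddAbove ((fun x => inner ℝ x z) '' K) := fun z => (hK.image _).bddAbove
  have hle : ∀ x ∈ K, ∀ z, inner ℝ x z ≤ g z := fun x hx z =>
    le_csSup (hbdd z) ⟨x, hx, rfl⟩
  have hex : ∀ z, ∃ x ∈ K, g z = inner ℝ x z := fun z => by
    obtain ⟨x, hx, hxz⟩ := (hK0.image fun x => inner ℝ x z).csSup_mem (hK.image _)
    exact ⟨x, hx, hxz.symm⟩
  have hgc : Continuous g := by
    have hKf : hK.toFinset.Nonempty := by simpa using hK0
    have : g = fun z => hK.toFinset.sup' hKf fun x => inner ℝ x z := by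
      ext z
      rw [Finset.sup'_eq_csSup_image, hg]
      simp
    rw [this]
    exact Continuous.finset_sup'_apply hKf fun x _ => by fun_prop
  have hgint : Integrable g μ := by
    refine Integrable.mono' (integrable_finsetSum hK.toFinset (f := fun x z => |inner ℝ x z|)
      fun x _ => ?_) hgc.aestronglyMeasurable (ae_of_all _ fun z => ?_)
    · exact (IsGaussian.integrable_dual μ (innerSL ℝ x)).abs
    · obtain ⟨x, hx, hxz⟩ := hex z
      rw [hxz, Real.norm_eq_abs]
      exact Finset.single_le_sum (f := fun x => |inner ℝ x z|) (fun _ _ => abs_nonneg _)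
        (by simpa using hx)
  -- averaging over the reflection in `V`, which preserves `μ`, replaces `z` by its projection
  set R := V.reflection with hR
  have hmp : MeasurePreserving R μ μ := ⟨R.continuous.measurable, stdGaussian_map R⟩
  have hgR : Integrable (fun z => g (R z)) μ := hmp.integrable_comp_of_integrable hgint
  have hRint : ∫ z, g (R z) ∂μ = ∫ z, g z ∂μ := by
    conv_rhs => rw [← hmp.map_eq]
    rw [integral_map R.continuous.measurable.aemeasurable hgc.aestronglyMeasurable]
  have hpt : ∀ z, α * H z ≤ (g z + g (R z)) / 2 := by
    intro z
    obtain ⟨r, hr⟩ := hHr z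
    obtain ⟨x, hx, hxz⟩ := h (V.starProjection z) (Submodule.starProjection_apply_mem V z) r
    have h1 := hle x hx z
    have h2 := hle x hx (R z)
    have h3 : R z = (2 : ℝ) • V.starProjection z - z := by
      rw [hR, Submodule.reflection_apply, two_smul ℝ, two_smul]
    rw [h3, inner_sub_right, real_inner_smul_right, ← h3] at h2
    have h4 : inner ℝ (e r) (V.starProjection z) = inner ℝ (e r) z := by
      have her : e r ∈ V := Submodule.subset_span ⟨r, rfl⟩
      rw [← Submodule.inner_starProjection_left_eq_right, Submodule.starProjection_eq_self_iff.2 her]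
    rw [hr, ← h4]
    linarith
  calc α * (Real.sqrt (Real.log n) / 2 - 3 / 2) ≤ α * ∫ z, H z ∂μ :=
        mul_le_mul_of_nonneg_left hHint hα
    _ = ∫ z, α * H z ∂μ := (integral_const_mul _ _).symm
    _ ≤ ∫ z, (g z + g (R z)) / 2 ∂μ :=
        integral_mono (hH.const_mul α) ((hgint.add hgR).div_const 2) hpt
    _ = ∫ z, g z ∂μ := by
        rw [integral_div, integral_add hgint hgR, hRint]; ring

end GaussianMax

/-! ### Trigonometric sums over full periods -/

section Trigonometric

theorem sum_range_cos_eq_zero {m : ℕ} {a : ℤ} (hm : 0 < m) (ha : ¬ (m : ℤ) ∣ a) (φ : ℝ) :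
    ∑ i ∈ Finset.range m, Real.cos (2 * Real.pi * a / m * i + φ) = 0 := by
  set β := 2 * Real.pi * a / m with hβ
  have hm' : (m : ℝ) ≠ 0 := by positivity
  have hsin : Real.sin (β / 2) ≠ 0 := by
    intro h
    obtain ⟨n, hn⟩ := Real.sin_eq_zero_iff.1 h
    refine ha ⟨n, ?_⟩
    have h2 : (n : ℝ) * m = a := by
      have hpi := Real.pi_ne_zero
      rw [hβ] at hn
      field_simp at hn
      linarith
    rw [mul_comm]
    exact_mod_cast h2.symm
  have htel : ∀ i : ℕ, 2 * Real.sin (β / 2) * Real.cos (β * i + φ) =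
      Real.sin (β * ((i + 1 : ℕ) : ℝ) + φ - β / 2) - Real.sin (β * (i : ℝ) + φ - β / 2) := by
    intro i
    rw [Real.sin_sub_sin]
    push_cast
    ring_nf
  have hsum : 2 * Real.sin (β / 2) * ∑ i ∈ Finset.range m, Real.cos (β * i + φ) = 0 := by
    rw [Finset.mul_sum, Finset.sum_congr rfl fun i _ => htel i,
      Finset.sum_range_sub (fun i : ℕ => Real.sin (β * (i : ℝ) + φ - β / 2))]
    have h3 : β * (m : ℝ) + φ - β / 2 = (φ - β / 2) + a * (2 * Real.pi) := by
      rw [hβ]; field_simp; ring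
    rw [h3, Real.sin_add_int_mul_two_pi]
    simp
  exact (mul_eq_zero.1 hsum).resolve_left (mul_ne_zero two_ne_zero hsin)

theorem not_dvd_of_abs_lt {m : ℕ} {a : ℤ} (h0 : a ≠ 0) (h : |a| < m) : ¬ (m : ℤ) ∣ a :=
  fun hd => h0 (Int.eq_zero_of_abs_lt_dvd hd h)

/-- Orthogonality of the functions `i ↦ cos (4π r (d + i) / m)` for `0 < r < m / 4`. -/
theorem sum_range_cos_mul_cos {m r s : ℕ} (hr : 0 < r) (hs : 0 < s) (hrm : 4 * r < m)
    (hsm : 4 * s < m) (d : ℝ) :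
    ∑ i ∈ Finset.range m, Real.cos (4 * Real.pi * r / m * (d + i)) *
      Real.cos (4 * Real.pi * s / m * (d + i)) = if r = s then (m : ℝ) / 2 else 0 := by
  have hm : 0 < m := by omega
  have hm' : (m : ℝ) ≠ 0 := by positivity
  have hplus := sum_range_cos_eq_zero (m := m) (a := 2 * (r + s)) hm
    (not_dvd_of_abs_lt (by omega) (by rw [abs_of_nonneg (by positivity)]; omega))
    (4 * Real.pi * (r + s) / m * d)
  have h1 : ∀ i : ℕ, Real.cos (4 * Real.pi * r / m * (d + i)) *
      Real.cos (4 * Real.pi * s / m * (d + i)) =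
      (1 / 2) * Real.cos (4 * Real.pi * (r - s) / m * (d + i)) +
      (1 / 2) * Real.cos (2 * Real.pi * ((2 * (r + s) : ℤ) : ℝ) / m * i +
        4 * Real.pi * (r + s) / m * d) := by
    intro i
    have e1 : 4 * Real.pi * (r - s) / m * (d + i) =
        4 * Real.pi * r / m * (d + i) - 4 * Real.pi * s / m * (d + i) := by ring
    have e2 : 2 * Real.pi * ((2 * (r + s) : ℤ) : ℝ) / m * i + 4 * Real.pi * (r + s) / m * d =
        4 * Real.pi * r / m * (d + i) + 4 * Real.pi * s / m * (d + i) := by push_cast; ring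
    rw [e1, e2, Real.cos_sub, Real.cos_add]
    ring
  rw [Finset.sum_congr rfl fun i _ => h1 i, Finset.sum_add_distrib, ← Finset.mul_sum,
    ← Finset.mul_sum, hplus]
  by_cases hrs : r = s
  · subst hrs
    simp
    ring
  · rw [if_neg hrs]
    have hminus := sum_range_cos_eq_zero (m := m) (a := 2 * (r - s)) hm
      (not_dvd_of_abs_lt (by omega) (by rw [abs_lt]; constructor <;> omega))
      (4 * Real.pi * (r - s) / m * d)
    have h2 : ∀ i : ℕ, Real.cos (4 * Real.pi * (r - s) / m * (d + i)) =
        Real.cos (2 * Real.pi * ((2 * (r - s) : ℤ) : ℝ) / m * i +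
          4 * Real.pi * (r - s) / m * d) := by
      intro i; congr 1; push_cast; ring
    rw [Finset.sum_congr rfl fun i _ => h2 i, hminus]
    simp

theorem sum_range_cos_shift {m r : ℕ} (hr : 0 < r) (hrm : 4 * r < m) (d : ℝ) :
    ∑ i ∈ Finset.range m, Real.cos (4 * Real.pi * r / m * (d + i)) = 0 := by
  have h := sum_range_cos_eq_zero (m := m) (a := 2 * r) (by omega)
    (not_dvd_of_abs_lt (by omega) (by rw [abs_of_nonneg (by positivity)]; omega))
    (4 * Real.pi * r / m * d)
  rw [← h]
  refine Finset.sum_congr rfl fun i _ => ?_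
  congr 1; push_cast; ring

/-- The weight `(1 + cos (2π r x / m)) / 2` with values in `[0, 1]`. -/
noncomputable def cosWeight (m r : ℕ) (x : ℤ) : ℝ := (1 + Real.cos (2 * Real.pi * r / m * x)) / 2

theorem cosWeight_mem (m r : ℕ) (x : ℤ) : 0 ≤ cosWeight m r x ∧ cosWeight m r x ≤ 1 := by
  have h1 := Real.neg_one_le_cos (2 * Real.pi * r / m * x)
  have h2 := Real.cos_le_one (2 * Real.pi * r / m * x)
  constructor <;> rw [cosWeight] <;> linarith

/-- The self-convolution of `cosWeight` over a full period. -/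
theorem sum_cosWeight_mul {m r : ℕ} (hr : 0 < r) (hrm : 4 * r < m) (c : ℤ) :
    ∑ j ∈ Finset.range m, cosWeight m r (1 + j) * cosWeight m r (2 * c - (1 + j)) =
      m / 4 + m / 8 * Real.cos (4 * Real.pi * r / m * c) := by
  have hm : 0 < m := by omega
  have hnd : ∀ b : ℤ, b ≠ 0 → |b| ≤ 2 * r → ¬ (m : ℤ) ∣ b := fun b hb0 hb =>
    not_dvd_of_abs_lt hb0 (by omega)
  have h1 := sum_range_cos_eq_zero hm (hnd r (by omega) (by rw [Nat.abs_cast]; omega))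
    (2 * Real.pi * r / m)
  have h2 := sum_range_cos_eq_zero hm (hnd (-r) (by omega) (by rw [abs_neg, Nat.abs_cast]; omega))
    (2 * Real.pi * r / m * (2 * c - 1))
  have h3 := sum_range_cos_eq_zero hm
    (hnd (2 * r) (by omega) (by rw [abs_of_nonneg (by omega)]))
    (4 * Real.pi * r / m * (1 - c))
  have hterm : ∀ j : ℕ, cosWeight m r (1 + j) * cosWeight m r (2 * c - (1 + j)) =
      (1 / 4 + 1 / 8 * Real.cos (4 * Real.pi * r / m * c)) +
      ((1 / 4) * Real.cos (2 * Real.pi * ((r : ℤ) : ℝ) / m * j + 2 * Real.pi * r / m) +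
      (1 / 4) * Real.cos (2 * Real.pi * ((-r : ℤ) : ℝ) / m * j +
        2 * Real.pi * r / m * (2 * c - 1)) +
      (1 / 8) * Real.cos (2 * Real.pi * ((2 * r : ℤ) : ℝ) / m * j +
        4 * Real.pi * r / m * (1 - c))) := by
    intro j
    have e1 : 2 * Real.pi * ((r : ℤ) : ℝ) / m * j + 2 * Real.pi * r / m =
        2 * Real.pi * r / m * (1 + j) := by push_cast; ring
    have e2 : 2 * Real.pi * ((-r : ℤ) : ℝ) / m * j + 2 * Real.pi * r / m * (2 * c - 1) =
        2 * Real.pi * r / m * (2 * c - (1 + j)) := by push_cast; ring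
    have e3 : 2 * Real.pi * ((2 * r : ℤ) : ℝ) / m * j + 4 * Real.pi * r / m * (1 - c) =
        2 * Real.pi * r / m * (1 + j) - 2 * Real.pi * r / m * (2 * c - (1 + j)) := by
      push_cast; ring
    have e4 : 4 * Real.pi * r / m * c =
        2 * Real.pi * r / m * (1 + j) + 2 * Real.pi * r / m * (2 * c - (1 + j)) := by ring
    rw [e1, e2, e3, e4, Real.cos_add, Real.cos_sub, cosWeight, cosWeight]
    push_cast
    ring
  rw [Finset.sum_congr rfl fun j _ => hterm j]
  simp only [Finset.sum_add_distrib, ← Finset.mul_sum, h1, h2, h3]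
  simp
  ring

end Trigonometric

/-! ### Rounding bilinear forms -/

section Rounding

variable {τ X : Type*} [DecidableEq X]

/-- A linear form on a cube is maximised at a vertex, chosen by the signs of its coefficients. -/
theorem exists_rounding_linear (T : Finset τ) (w : τ → ℝ) (u : τ → X) (f : X → ℝ)
    (hf : ∀ x, 0 ≤ f x ∧ f x ≤ 1) :
    ∃ f' : X → ℝ, (∀ x, f' x = 0 ∨ f' x = 1) ∧
      ∑ t ∈ T, w t * f (u t) ≤ ∑ t ∈ T, w t * f' (u t) := by
  set S : X → ℝ := fun x => ∑ t ∈ T with u t = x, w t with hS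
  have hfib : ∀ g : X → ℝ, ∑ t ∈ T, w t * g (u t) = ∑ x ∈ T.image u, S x * g x := by
    intro g
    rw [← Finset.sum_fiberwise_of_maps_to (fun t ht => Finset.mem_image_of_mem u ht)]
    refine Finset.sum_congr rfl fun x _ => ?_
    rw [hS, Finset.sum_mul]
    exact Finset.sum_congr rfl fun t ht => by rw [(Finset.mem_filter.1 ht).2]
  refine ⟨fun x => if 0 ≤ S x then 1 else 0, fun x => ?_, ?_⟩
  · by_cases h : 0 ≤ S x <;> simp [h]
  · rw [hfib f, hfib fun x => if 0 ≤ S x then 1 else 0]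
    refine Finset.sum_le_sum fun x _ => ?_
    by_cases h : 0 ≤ S x
    · rw [if_pos h]; exact mul_le_mul_of_nonneg_left (hf x).2 h
    · rw [if_neg h, mul_zero]
      exact mul_nonpos_of_nonpos_of_nonneg (le_of_not_ge h) (hf x).1

/-- A bilinear form on two independent cubes is maximised at vertices. -/
theorem exists_rounding_bilinear (T : Finset τ) (w : τ → ℝ) (u v : τ → X) (f g : X → ℝ)
    (hf : ∀ x, 0 ≤ f x ∧ f x ≤ 1) (hg : ∀ x, 0 ≤ g x ∧ g x ≤ 1) :
    ∃ f' g' : X → ℝ, (∀ x, f' x = 0 ∨ f' x = 1) ∧ (∀ x, g' x = 0 ∨ g' x = 1) ∧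
      ∑ t ∈ T, w t * (f (u t) * g (v t)) ≤ ∑ t ∈ T, w t * (f' (u t) * g' (v t)) := by
  obtain ⟨f', hf', h1⟩ := exists_rounding_linear T (fun t => w t * g (v t)) u f hf
  obtain ⟨g', hg', h2⟩ := exists_rounding_linear T (fun t => w t * f' (u t)) v g hg
  refine ⟨f', g', hf', hg', ?_⟩
  calc ∑ t ∈ T, w t * (f (u t) * g (v t)) = ∑ t ∈ T, w t * g (v t) * f (u t) :=
        Finset.sum_congr rfl fun t _ => by ring
    _ ≤ ∑ t ∈ T, w t * g (v t) * f' (u t) := h1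
    _ = ∑ t ∈ T, w t * f' (u t) * g (v t) := Finset.sum_congr rfl fun t _ => by ring
    _ ≤ ∑ t ∈ T, w t * f' (u t) * g' (v t) := h2
    _ = _ := Finset.sum_congr rfl fun t _ => by ring

end Rounding

/-! ### Three-term progressions between separated blocks -/

section Blocks

variable {G : Type*} [AddCommGroup G] [DecidableEq G] {Ω : Finset G}

theorem zeroExtend_apPos {k : ℕ} (z : EuclideanSpace ℝ Ω) (i : Fin k) (p : apSet k Ω) :
    z (apPos k Ω i p) = zeroExtend z (p.1.1 + (i : ℕ) • p.1.2) := by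
  rw [zeroExtend, dif_pos ((Finset.mem_filter.1 p.2).2 i i.2)]
  rfl

theorem inner_gradient_apCount_three (y z : EuclideanSpace ℝ Ω) :
    inner ℝ (gradient (apCount 3 Ω) y) z =
      ∑ p ∈ apSet 3 Ω, (zeroExtend z p.1 * (zeroExtend y (p.1 + p.2) * zeroExtend y (p.1 + 2 • p.2)) +
        zeroExtend z (p.1 + p.2) * (zeroExtend y p.1 * zeroExtend y (p.1 + 2 • p.2)) +
        zeroExtend z (p.1 + 2 • p.2) * (zeroExtend y p.1 * zeroExtend y (p.1 + p.2))) := by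
  have e0 : (Finset.univ : Finset (Fin 3)).erase 0 = {1, 2} := by decide
  have e1 : (Finset.univ : Finset (Fin 3)).erase 1 = {0, 2} := by decide
  have e2 : (Finset.univ : Finset (Fin 3)).erase 2 = {0, 1} := by decide
  rw [inner_gradient_apCount (by norm_num), Fin.sum_univ_three, e0, e1, e2,
    ← Finset.sum_add_distrib, ← Finset.sum_add_distrib, ← Finset.sum_coe_sort (apSet 3 Ω)]
  refine Finset.sum_congr rfl fun p _ => ?_
  rw [Finset.prod_pair (by decide), Finset.prod_pair (by decide), Finset.prod_pair (by decide)]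
  simp [zeroExtend_apPos]

/-- If `ζ` lives on the block `(5m, 6m]` and `η` on the blocks `[1, m]` and `(9m, 12m]`, then the
only progressions contributing to the derivative of the count have their middle term in the first
block and one endpoint in each of the other two. -/
theorem sum_apSet_blocks {m : ℕ} (ψ : ℤ →+ G)
    (hΩ : ∀ n : ℤ, 1 ≤ n → n ≤ 12 * m → ψ n ∈ Ω) (hψ : ∀ x : ℤ, |x| < 24 * m → ψ x = 0 → x = 0)
    {ζ η : G → ℝ} (hζ : ∀ a, ζ a ≠ 0 → ∃ n : ℤ, 5 * m + 1 ≤ n ∧ n ≤ 6 * m ∧ ψ n = a)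
    (hη : ∀ a, η a ≠ 0 → ∃ n : ℤ, (1 ≤ n ∧ n ≤ m ∨ 9 * m + 1 ≤ n ∧ n ≤ 12 * m) ∧ ψ n = a) :
    ∑ p ∈ apSet 3 Ω, (ζ p.1 * (η (p.1 + p.2) * η (p.1 + 2 • p.2)) +
        ζ (p.1 + p.2) * (η p.1 * η (p.1 + 2 • p.2)) +
        ζ (p.1 + 2 • p.2) * (η p.1 * η (p.1 + p.2))) =
      2 * ∑ t ∈ Finset.range m ×ˢ Finset.range m, ζ (ψ (5 * m + 1 + t.1)) *
        (η (ψ (1 + t.2)) * η (ψ (2 * (5 * m + 1 + t.1) - (1 + t.2)))) := by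
  -- a relation between images of small integers lifts to the integers
  have hlift : ∀ x y z : ℤ, 1 ≤ x → x ≤ 12 * m → 1 ≤ y → y ≤ 12 * m → 1 ≤ z → z ≤ 12 * m →
      ψ x + ψ z = ψ y + ψ y → x + z = 2 * y := by
    intro x y z hx hx' hy hy' hz hz' h
    have h1 : ψ (x + z - 2 * y) = 0 := by
      rw [two_mul, map_sub, map_add, map_add, h, sub_self]
    have := hψ _ (by rw [abs_lt]; constructor <;> omega) h1
    omega
  have hinj : ∀ x y : ℤ, 1 ≤ x → x ≤ 12 * m → 1 ≤ y → y ≤ 12 * m → ψ x = ψ y → x = y := by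
    intro x y hx hx' hy hy' h
    have := hlift x y x hx hx' hy hy' hx hx' (by rw [h])
    omega
  have hap : ∀ p : G × G, p.1 + (p.1 + 2 • p.2) = (p.1 + p.2) + (p.1 + p.2) := by
    intro p; rw [two_nsmul]; abel
  have h0 : ∀ p : G × G, ζ p.1 * (η (p.1 + p.2) * η (p.1 + 2 • p.2)) = 0 := by
    intro p
    by_contra h
    obtain ⟨hz, h⟩ := mul_ne_zero_iff.1 h
    obtain ⟨hy, hy'⟩ := mul_ne_zero_iff.1 h
    obtain ⟨x, hx, hx', hxp⟩ := hζ _ hz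
    obtain ⟨y, hy, hyp⟩ := hη _ hy
    obtain ⟨z, hz, hzp⟩ := hη _ hy'
    have := hlift x y z (by omega) (by omega) (by omega) (by omega) (by omega) (by omega)
      (by rw [hxp, hyp, hzp, hap])
    omega
  have h2 : ∀ p : G × G, ζ (p.1 + 2 • p.2) * (η p.1 * η (p.1 + p.2)) = 0 := by
    intro p
    by_contra h
    obtain ⟨hz, h⟩ := mul_ne_zero_iff.1 h
    obtain ⟨hy, hy'⟩ := mul_ne_zero_iff.1 h
    obtain ⟨x, hx, hx', hxp⟩ := hζ _ hz
    obtain ⟨y, hy, hyp⟩ := hη _ hy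
    obtain ⟨z, hz, hzp⟩ := hη _ hy'
    have := hlift y z x (by omega) (by omega) (by omega) (by omega) (by omega) (by omega)
      (by rw [hxp, hyp, hzp, hap])
    omega
  simp only [h0, h2, zero_add, add_zero]
  have hpow : ∀ a b : ℤ, ψ a + 2 • ψ (b - a) = ψ (2 * b - a) := by
    intro a b
    rw [← map_nsmul, ← map_add]
    congr 1
    rw [nsmul_eq_mul]; push_cast; ring
  have hadd : ∀ a b : ℤ, ψ a + ψ (b - a) = ψ b := by
    intro a b
    rw [← map_add]; congr 1; ring
  -- the two orientations of each progression
  set e : (ℕ × ℕ) × Bool → G × G := fun t =>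
    if t.2 then (ψ (1 + t.1.2), ψ ((5 * m + 1 + t.1.1) - (1 + t.1.2)))
    else (ψ (2 * (5 * m + 1 + t.1.1) - (1 + t.1.2)),
      ψ ((5 * m + 1 + t.1.1) - (2 * (5 * m + 1 + t.1.1) - (1 + t.1.2)))) with he
  have hsum : ∑ t ∈ (Finset.range m ×ˢ Finset.range m) ×ˢ (Finset.univ : Finset Bool),
      ζ (ψ (5 * m + 1 + t.1.1)) *
        (η (ψ (1 + t.1.2)) * η (ψ (2 * (5 * m + 1 + t.1.1) - (1 + t.1.2)))) =
      ∑ p ∈ apSet 3 Ω, ζ (p.1 + p.2) * (η p.1 * η (p.1 + 2 • p.2)) := by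
    refine Finset.sum_of_injOn e ?_ ?_ ?_ ?_
    · rintro ⟨⟨i, j⟩, b⟩ ht ⟨⟨i', j'⟩, b'⟩ ht' h
      simp only [Finset.coe_product, Set.mem_prod, Finset.mem_coe, Finset.mem_range,
        Finset.mem_univ, and_true] at ht ht'
      obtain ⟨hi, hj⟩ := ht
      obtain ⟨hi', hj'⟩ := ht'
      have hsnd : (e ((i, j), b)).1 + (e ((i, j), b)).2 =
          (e ((i', j'), b')).1 + (e ((i', j'), b')).2 := by rw [h]
      have hfst : (e ((i, j), b)).1 = (e ((i', j'), b')).1 := by rw [h]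
      have hc : ∀ (i j : ℕ) (b : Bool), (e ((i, j), b)).1 + (e ((i, j), b)).2 =
          ψ (5 * m + 1 + i) := by
        intro i j b
        cases b <;> simp only [he, if_true, Bool.false_eq_true, if_false] <;> exact hadd _ _
      rw [hc, hc] at hsnd
      have hii := hinj _ _ (by omega) (by omega) (by omega) (by omega) hsnd
      have hii : i = i' := by omega
      subst hii
      cases b <;> cases b' <;>
        simp only [he, if_true, Bool.false_eq_true, if_false] at hfst <;>
        have hjj := hinj _ _ (by omega) (by omega) (by omega) (by omega) hfst
      · have : j = j' := by omega
        rw [this]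
      · omega
      · omega
      · have : j = j' := by omega
        rw [this]
    · rintro ⟨⟨i, j⟩, b⟩ ht
      simp only [Finset.coe_product, Set.mem_prod, Finset.mem_coe, Finset.mem_range,
        Finset.mem_univ, and_true] at ht
      obtain ⟨hi, hj⟩ := ht
      rw [Finset.mem_coe, mem_apSet (by norm_num)]
      intro q hq
      have hq3 : q = 0 ∨ q = 1 ∨ q = 2 := by omega
      cases b <;> simp only [he, if_true, Bool.false_eq_true, if_false] <;>
        rcases hq3 with rfl | rfl | rfl <;>
        simp only [zero_smul, add_zero, one_smul, hadd, hpow] <;>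
        exact hΩ _ (by omega) (by omega)
    · intro p _ hp
      by_contra h
      obtain ⟨hz, h⟩ := mul_ne_zero_iff.1 h
      obtain ⟨hy, hy'⟩ := mul_ne_zero_iff.1 h
      obtain ⟨c, hc, hc', hcp⟩ := hζ _ hz
      obtain ⟨x, hx, hxp⟩ := hη _ hy
      obtain ⟨y, hy, hyp⟩ := hη _ hy'
      have hxy := hlift x c y (by omega) (by omega) (by omega) (by omega) (by omega) (by omega)
        (by rw [hxp, hcp, hyp, hap])
      have hp2 : ψ (c - x) = p.2 := by rw [map_sub, hcp, hxp, add_sub_cancel_left]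
      rcases hx with hx | hx
      · refine hp ⟨(((c - (5 * m + 1)).toNat, (x - 1).toNat), true), ?_, ?_⟩
        · simp only [Finset.coe_product, Set.mem_prod, Finset.mem_coe, Finset.mem_range,
            Finset.mem_univ, and_true]
          omega
        · have a1 : (1 + ((x - 1).toNat : ℤ)) = x := by omega
          have a2 : (5 * m + 1 + ((c - (5 * m + 1)).toNat : ℤ)) = c := by omega
          simp only [he, if_true, a1, a2, hxp, hp2]
      · refine hp ⟨(((c - (5 * m + 1)).toNat, (y - 1).toNat), false), ?_, ?_⟩
        · simp only [Finset.coe_product, Set.mem_prod, Finset.mem_coe, Finset.mem_range,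
            Finset.mem_univ, and_true]
          omega
        · have a1 : (1 + ((y - 1).toNat : ℤ)) = y := by omega
          have a2 : (5 * m + 1 + ((c - (5 * m + 1)).toNat : ℤ)) = c := by omega
          have a3 : 2 * c - y = x := by omega
          simp only [he, Bool.false_eq_true, if_false, a1, a2, a3, hxp, hp2]
    · rintro ⟨⟨i, j⟩, b⟩ _
      cases b <;> simp only [he, if_true, Bool.false_eq_true, if_false, hadd, hpow]
      rw [show ∀ a b : ℤ, 2 * a - (2 * a - b) = b by intros; ring]
      ring
  rw [← hsum, Finset.sum_product]
  simp only [Finset.sum_const, Finset.card_univ, Fintype.card_bool, nsmul_eq_mul]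
  rw [Finset.mul_sum]
  simp

/-- The indicator of the points `ψ n` with `n` in `[1, m]` and `f n = 1`, or in `(9m, 12m]` and
`g n = 1`. -/
noncomputable def blockIndicator (m : ℕ) (ψ : ℤ →+ G) (f g : ℤ → ℝ) (a : G) : ℝ :=
  open Classical in
  if ∃ n : ℤ, (1 ≤ n ∧ n ≤ m ∧ f n = 1 ∨ 9 * m + 1 ≤ n ∧ n ≤ 12 * m ∧ g n = 1) ∧ ψ n = a
  then 1 else 0

omit [DecidableEq G] in
theorem blockIndicator_apply {m : ℕ} {ψ : ℤ →+ G} {f g : ℤ → ℝ}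
    (hinj : ∀ x y : ℤ, 1 ≤ x → x ≤ 12 * m → 1 ≤ y → y ≤ 12 * m → ψ x = ψ y → x = y)
    (hf : ∀ n, f n = 0 ∨ f n = 1) (hg : ∀ n, g n = 0 ∨ g n = 1) :
    (∀ n : ℤ, 1 ≤ n → n ≤ m → blockIndicator m ψ f g (ψ n) = f n) ∧
    (∀ n : ℤ, 9 * m + 1 ≤ n → n ≤ 12 * m → blockIndicator m ψ f g (ψ n) = g n) := by
  classical
  constructor
  · intro n hn hn'
    rcases hf n with h | h
    · rw [blockIndicator, if_neg, h]
      rintro ⟨x, hx, hxn⟩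
      have hxn := hinj x n (by omega) (by omega) (by omega) (by omega) hxn
      subst hxn
      rcases hx with hx | hx
      · rw [h] at hx; norm_num at hx
      · omega
    · rw [blockIndicator, if_pos ⟨n, Or.inl ⟨hn, hn', h⟩, rfl⟩, h]
  · intro n hn hn'
    rcases hg n with h | h
    · rw [blockIndicator, if_neg, h]
      rintro ⟨x, hx, hxn⟩
      have hxn := hinj x n (by omega) (by omega) (by omega) (by omega) hxn
      subst hxn
      rcases hx with hx | hx
      · omega
      · rw [h] at hx; norm_num at hx
    · rw [blockIndicator, if_pos ⟨n, Or.inr ⟨hn, hn', h⟩, rfl⟩, h]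

theorem finite_apGradients (k : ℕ) (Ω : Finset G) : (apGradients k Ω).Finite := by
  refine Set.Finite.image _ ?_
  have h : (Set.pi Set.univ fun _ : Ω => ({0, 1} : Set ℝ)).Finite :=
    Set.Finite.pi fun _ => by simp
  refine (h.image (WithLp.toLp 2)).subset fun y hy => ⟨fun a => y a, fun a _ => ?_, rfl⟩
  simpa using hy a

/-- Lower bound for the Gaussian width of three-term progressions in a set containing a copy of
an interval. The choice of `m` ensures `4 r < m` for all frequencies `r ≤ n`, so that the doubled
frequencies `2 r` of the cosines are orthogonal and non-constant over a full period. -/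
theorem le_gaussianWidth_apGradients_three {n m : ℕ} (hn : 8 ≤ n) (hm : m = 4 * n + 1)
    (ψ : ℤ →+ G) (hΩ : ∀ n : ℤ, 1 ≤ n → n ≤ 12 * m → ψ n ∈ Ω)
    (hψ : ∀ x : ℤ, |x| < 24 * m → ψ x = 0 → x = 0) :
    (Ω.card : ℝ)⁻¹ * (m / 4 * Real.sqrt (m / 2)) * (Real.sqrt (Real.log n) / 2 - 3 / 2) ≤
      gaussianWidth (apGradients 3 Ω) := by
  have hm0 : 0 < m := by omega
  have hm' : (0 : ℝ) < m := by exact_mod_cast hm0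
  have hinj : ∀ x y : ℤ, 1 ≤ x → x ≤ 12 * m → 1 ≤ y → y ≤ 12 * m → ψ x = ψ y → x = y := by
    intro x y hx hx' hy hy' h
    have := hψ (x - y) (by rw [abs_lt]; constructor <;> omega) (by rw [map_sub, h, sub_self])
    omega
  set pos : Fin m → Ω := fun i =>
    ⟨ψ (5 * m + 1 + (i : ℕ)), hΩ _ (by omega) (by have := i.2; omega)⟩ with hpos
  have hposinj : Function.Injective pos := by
    intro i j hij
    have := hinj _ _ (by omega) (by have := i.2; omega) (by omega) (by have := j.2; omega)
      (congrArg Subtype.val hij)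
    exact Fin.ext (by omega)
  set w : Fin n → Fin m → ℝ := fun r i =>
    Real.cos (4 * Real.pi * ((r + 1 : ℕ) : ℝ) / m * ((5 * m + 1 : ℝ) + (i : ℕ))) with hw
  set b : Fin m → EuclideanSpace ℝ Ω := fun i => EuclideanSpace.single (pos i) 1 with hb
  have hbo : Orthonormal ℝ b := by
    have := (EuclideanSpace.basisFun Ω ℝ).orthonormal.comp pos hposinj
    simpa [Function.comp_def, hb] using this
  set e : Fin n → EuclideanSpace ℝ Ω := fun r => ∑ i, (Real.sqrt (2 / m) * w r i) • b i with he
  have hesum : ∀ r s, ∑ i, w r i * w s i = if r = s then (m : ℝ) / 2 else 0 := by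
    intro r s
    have h1 := sum_range_cos_mul_cos (m := m) (r := r + 1) (s := s + 1) (by omega) (by omega)
      (by have := r.2; omega) (by have := s.2; omega) (5 * m + 1)
    rw [← Fin.sum_univ_eq_sum_range (fun i : ℕ =>
      Real.cos (4 * Real.pi * ((r + 1 : ℕ) : ℝ) / m * ((5 * m + 1 : ℝ) + i)) *
      Real.cos (4 * Real.pi * ((s + 1 : ℕ) : ℝ) / m * ((5 * m + 1 : ℝ) + i)))] at h1
    simpa only [hw, add_left_inj, Fin.ext_iff] using h1
  have heo : Orthonormal ℝ e := by
    rw [orthonormal_iff_ite]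
    intro r s
    simp only [he]
    rw [hbo.inner_sum]
    simp only [conj_trivial]
    have h1 : ∀ i, Real.sqrt (2 / m) * w r i * (Real.sqrt (2 / m) * w s i) =
        2 / m * (w r i * w s i) := by
      intro i
      have := Real.mul_self_sqrt (show (0 : ℝ) ≤ 2 / m by positivity)
      linear_combination (w r i * w s i) * this
    rw [Finset.sum_congr rfl fun i _ => h1 i, ← Finset.mul_sum, hesum]
    split_ifs
    · field_simp
    · simp
  have hinner : ∀ r z, inner ℝ (e r) z = Real.sqrt (2 / m) * ∑ i, w r i * z (pos i) := by
    intro r z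
    simp only [he, hb, sum_inner, real_inner_smul_left, EuclideanSpace.inner_single_left,
      Finset.mul_sum]
    refine Finset.sum_congr rfl fun i _ => ?_
    simp; ring
  have hwsum : ∀ r, ∑ i, w r i = 0 := by
    intro r
    have h1 := sum_range_cos_shift (m := m) (r := r + 1) (by omega) (by have := r.2; omega)
      (5 * m + 1)
    rw [← Fin.sum_univ_eq_sum_range (fun i : ℕ =>
      Real.cos (4 * Real.pi * ((r + 1 : ℕ) : ℝ) / m * ((5 * m + 1 : ℝ) + i)))] at h1
    exact h1
  have happly : ∀ r (a : Ω), e r a = ∑ i, Real.sqrt (2 / m) * w r i * (if a = pos i then 1 else 0) := by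
    intro r a
    simp [he, hb, Pi.single_apply]
  have hspan : ∀ z ∈ Submodule.span ℝ (Set.range e),
      (∀ a : Ω, (∀ i, a ≠ pos i) → z a = 0) ∧ ∑ i, z (pos i) = 0 := by
    intro z hz
    induction hz using Submodule.span_induction with
    | mem x hx =>
      obtain ⟨r, rfl⟩ := hx
      refine ⟨fun a ha => ?_, ?_⟩
      · rw [happly]
        exact Finset.sum_eq_zero fun i _ => by rw [if_neg (ha i), mul_zero]
      · simp only [happly, hposinj.eq_iff, mul_ite, mul_one, mul_zero, Finset.sum_ite_eq,
          Finset.mem_univ, if_true, ← Finset.mul_sum, hwsum]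
    | zero => simp
    | add x y _ _ hx hy =>
      refine ⟨fun a ha => ?_, ?_⟩
      · rw [PiLp.add_apply, hx.1 a ha, hy.1 a ha, add_zero]
      · simp only [PiLp.add_apply, Finset.sum_add_distrib, hx.2, hy.2, add_zero]
    | smul c x _ hx =>
      refine ⟨fun a ha => ?_, ?_⟩
      · rw [PiLp.smul_apply, hx.1 a ha, smul_zero]
      · simp only [PiLp.smul_apply, ← Finset.smul_sum, hx.2, smul_zero]
  refine le_gaussianWidth_of_orthonormal (finite_apGradients 3 Ω)
    ⟨_, ⟨0, fun a => Or.inl rfl, rfl⟩⟩ hn heo (by positivity) fun z hz r => ?_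
  obtain ⟨hz0, hzs⟩ := hspan z hz
  -- cosine weights on both outer blocks extract the Fourier coefficient of frequency `r + 1`
  obtain ⟨f', g', hf', hg', hfg⟩ := exists_rounding_bilinear (Finset.range m ×ˢ Finset.range m)
    (fun t => zeroExtend z (ψ (5 * m + 1 + t.1))) (fun t => (1 + t.2 : ℤ))
    (fun t => 2 * (5 * m + 1 + t.1 : ℤ) - (1 + t.2)) (cosWeight m (r + 1)) (cosWeight m (r + 1))
    (cosWeight_mem m _) (cosWeight_mem m _)
  obtain ⟨hL, hR⟩ := blockIndicator_apply hinj hf' hg'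
  set η := blockIndicator m ψ f' g' with hη
  set y : EuclideanSpace ℝ Ω := WithLp.toLp 2 fun a => η a with hy
  have hη01 : ∀ a, η a = 0 ∨ η a = 1 := by
    intro a; rw [hη, blockIndicator]; split_ifs <;> simp
  have hyη : ∀ a ∈ Ω, zeroExtend y a = η a := by
    intro a ha; rw [zeroExtend, dif_pos ha]
  refine ⟨_, ⟨y, fun a => hη01 a, rfl⟩, ?_⟩
  rw [real_inner_smul_left, inner_gradient_apCount_three, sum_apSet_blocks (m := m) ψ hΩ hψ]
  rotate_left
  · intro a ha
    rw [zeroExtend] at ha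
    split_ifs at ha with haΩ
    · by_contra hcon
      refine ha (hz0 ⟨a, haΩ⟩ fun i hi => hcon ?_)
      exact ⟨5 * m + 1 + (i : ℕ), by omega, by have := i.2; omega, (congrArg Subtype.val hi).symm⟩
    · exact absurd rfl ha
  · intro a ha
    rw [zeroExtend] at ha
    split_ifs at ha with haΩ
    · have ha : η a ≠ 0 := ha
      rw [hη, blockIndicator] at ha
      split_ifs at ha with hex
      · obtain ⟨n, hn, hna⟩ := hex
        exact ⟨n, by omega, hna⟩
      · exact absurd rfl ha
    · exact absurd rfl ha
  have hzpos : ∀ i : Fin m, zeroExtend z (ψ (5 * m + 1 + (i : ℕ))) = z (pos i) := by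
    intro i
    rw [zeroExtend, dif_pos (pos i).2]
  have hlow : m / 8 * ∑ i, w r i * z (pos i) =
      ∑ t ∈ Finset.range m ×ˢ Finset.range m, zeroExtend z (ψ (5 * m + 1 + t.1)) *
        (cosWeight m (r + 1) (1 + t.2) *
          cosWeight m (r + 1) (2 * (5 * m + 1 + t.1 : ℤ) - (1 + t.2))) := by
    rw [Finset.sum_product]
    simp only [← Finset.mul_sum]
    rw [← Fin.sum_univ_eq_sum_range (fun i : ℕ => zeroExtend z (ψ (5 * m + 1 + i)) *
      ∑ j ∈ Finset.range m, cosWeight m (r + 1) (1 + j) *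
          cosWeight m (r + 1) (2 * (5 * m + 1 + i : ℤ) - (1 + j)))]
    have h1 : ∀ i : Fin m, zeroExtend z (ψ (5 * m + 1 + (i : ℕ))) *
        ∑ j ∈ Finset.range m, cosWeight m (r + 1) (1 + j) *
          cosWeight m (r + 1) (2 * (5 * m + 1 + (i : ℕ) : ℤ) - (1 + j)) =
        m / 4 * z (pos i) + m / 8 * (w r i * z (pos i)) := by
      intro i
      rw [hzpos, sum_cosWeight_mul (by omega) (by have := r.2; omega)]
      simp only [hw]
      push_cast
      ring
    rw [Finset.sum_congr rfl fun i _ => h1 i, Finset.sum_add_distrib, ← Finset.mul_sum,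
      ← Finset.mul_sum, hzs]
    simp
  have hround : ∑ t ∈ Finset.range m ×ˢ Finset.range m, zeroExtend z (ψ (5 * m + 1 + t.1)) *
        (f' (1 + t.2) * g' (2 * (5 * m + 1 + t.1 : ℤ) - (1 + t.2))) =
      ∑ t ∈ Finset.range m ×ˢ Finset.range m, zeroExtend z (ψ (5 * m + 1 + t.1)) *
        (zeroExtend y (ψ (1 + t.2)) *
          zeroExtend y (ψ (2 * (5 * m + 1 + t.1) - (1 + t.2)))) := by
    refine Finset.sum_congr rfl fun t ht => ?_
    simp only [Finset.mem_product, Finset.mem_range] at ht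
    rw [hyη _ (hΩ _ (by omega) (by omega)), hyη _ (hΩ _ (by omega) (by omega)),
      hL _ (by omega) (by omega), hR _ (by omega) (by omega)]
  rw [← hround, hinner]
  have hsq : Real.sqrt (m / 2) * Real.sqrt (2 / m) = 1 := by
    rw [← Real.sqrt_mul (by positivity), show (m : ℝ) / 2 * (2 / m) = 1 by field_simp,
      Real.sqrt_one]
  calc (Ω.card : ℝ)⁻¹ * (m / 4 * Real.sqrt (m / 2)) *
        (Real.sqrt (2 / m) * ∑ i, w r i * z (pos i))
      = (Ω.card : ℝ)⁻¹ * (2 * (m / 8 * ∑ i, w r i * z (pos i))) := by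
        linear_combination ((Ω.card : ℝ)⁻¹ * (m / 4) * ∑ i, w r i * z (pos i)) * hsq
    _ ≤ _ := by
        rw [hlow]
        exact mul_le_mul_of_nonneg_left (mul_le_mul_of_nonneg_left hfg zero_le_two)
          (inv_nonneg.2 (Nat.cast_nonneg _))

end Blocks

/-! ### Asymptotics -/

/-- The lower bound for three-term progressions in a set that contains an isomorphic copy, for
relations among few elements, of the interval `[1, N]`. -/
theorem sqrt_mul_log_le_gaussianWidth {G : Type*} [AddCommGroup G] [DecidableEq G] {Ω : Finset G}
    (ψ : ℤ →+ G) (hcard : Real.exp 80 ≤ Ω.card) (hΩ : ∀ n : ℤ, 1 ≤ n → n ≤ Ω.card → ψ n ∈ Ω)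
    (hψ : ∀ x : ℤ, |x| < Ω.card → ψ x = 0 → x = 0) :
    1 / 21120 * Real.sqrt (Ω.card * Real.log Ω.card) ≤ gaussianWidth (apGradients 3 Ω) := by
  set N := Ω.card with hN
  set R : ℝ := (N : ℝ) with hR
  have hexp : (2 : ℝ) ^ 80 ≤ Real.exp 80 := by
    have h := pow_le_pow_left₀ zero_le_two
      (show (2 : ℝ) ≤ Real.exp 1 by linarith [Real.exp_one_gt_d9]) 80
    rwa [← Real.exp_nat_mul, mul_one] at h
  have hR960 : (960 : ℝ) ≤ R := le_trans (by norm_num) (hexp.trans hcard)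
  have hN960 : 960 ≤ N := by rw [hR] at hR960; exact_mod_cast hR960
  -- with `m = 4 n + 1` this gives `24 m ≤ N`, so that the blocks do not wrap around
  set n := N / 120 with hn
  have hn8 : 8 ≤ n := by omega
  have hnR : R / 240 ≤ n := by
    have h : N ≤ 240 * n := by omega
    have h' : R ≤ 240 * n := by rw [hR]; exact_mod_cast h
    linarith
  have hn0 : (0 : ℝ) < n := by linarith
  set m := 4 * n + 1 with hm
  have hmN : 24 * m ≤ N := by omega
  have hmR : R / 60 ≤ m := by
    rw [hm]; push_cast; linarith
  have hlogR : 80 ≤ Real.log R := (Real.le_log_iff_exp_le (by linarith)).2 hcard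
  have hlog240 : Real.log 240 ≤ 6 := by
    refine (Real.log_le_iff_le_exp (by norm_num)).2 ?_
    have h := pow_le_pow_left₀ (by norm_num)
      (show (2.7 : ℝ) ≤ Real.exp 1 by linarith [Real.exp_one_gt_d9]) 6
    rw [← Real.exp_nat_mul, Nat.cast_ofNat, mul_one] at h
    exact le_trans (by norm_num) h
  have hlogn : Real.log R - 6 ≤ Real.log n := by
    have h := Real.log_le_log (by positivity) hnR
    rw [Real.log_div (by positivity) (by norm_num)] at h
    linarith
  have hs : Real.sqrt (Real.log R) / 8 ≤ Real.sqrt (Real.log n) / 2 - 3 / 2 := by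
    have h1 : 3 / 4 * Real.sqrt (Real.log R) ≤ Real.sqrt (Real.log n) := by
      refine Real.le_sqrt_of_sq_le ?_
      rw [mul_pow, Real.sq_sqrt (by linarith)]
      linarith
    have h2 : 6 ≤ Real.sqrt (Real.log R) := Real.le_sqrt_of_sq_le (by linarith)
    linarith
  have hq : R / 240 * (Real.sqrt R / 11) ≤ m / 4 * Real.sqrt (m / 2) := by
    refine mul_le_mul (by linarith) (Real.le_sqrt_of_sq_le ?_) (by positivity) (by positivity)
    rw [div_pow, Real.sq_sqrt (by positivity)]
    linarith
  refine le_trans ?_ (le_gaussianWidth_apGradients_three hn8 hm ψ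
    (fun x h1 h2 => hΩ x h1 (by omega)) fun x hx => hψ x (by omega))
  rw [← hN, ← hR]
  calc 1 / 21120 * Real.sqrt (R * Real.log R)
      = R⁻¹ * (R / 240 * (Real.sqrt R / 11)) * (Real.sqrt (Real.log R) / 8) := by
        rw [Real.sqrt_mul (by positivity)]
        field_simp
        norm_num
    _ ≤ _ := by gcongr

theorem eventually_pnat_cast_ge (x : ℝ) : ∀ᶠ N : ℕ+ in atTop, x ≤ ((N : ℕ) : ℝ) :=
  (tendsto_natCast_atTop_atTop.comp tendsto_PNat_val_atTop_atTop).eventually_ge_atTop x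

/-- The three conclusions, for a family of sets `Ω N` of size `N` in which every division problem
has few solutions and which contain copies of `[1, N]`. -/
theorem isBigO_gaussianWidth_apGradients {G : ℕ+ → Type*} [∀ N, AddCommGroup (G N)]
    [∀ N, DecidableEq (G N)] (Ω : ∀ N, Finset (G N)) (hcard : ∀ N, (Ω N).card = N)
    {D : ℕ → ℕ} (hD : ∀ k, 3 ≤ k → 0 < D k) (hG : ∀ k N, FewDivisions (G N) k (D k))
    (ψ : ∀ N, ℤ →+ G N) (hΩ : ∀ (N : ℕ+) (n : ℤ), 1 ≤ n → n ≤ (N : ℕ) → ψ N n ∈ Ω N)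
    (hψ : ∀ (N : ℕ+) (x : ℤ), |x| < (N : ℕ) → ψ N x = 0 → x = 0) :
    (∀ k : ℕ, 3 ≤ k → (fun N => gaussianWidth (apGradients k (Ω N))) =O[atTop]
      fun N : ℕ+ => ((N : ℕ) : ℝ) ^ (1 - 1 / (2 * ((k : ℝ) - 1)))) ∧
    ((fun N => gaussianWidth (apGradients 3 (Ω N))) =Θ[atTop]
      fun N : ℕ+ => Real.sqrt (((N : ℕ) : ℝ) * Real.log ((N : ℕ) : ℝ))) ∧
    ((fun N => gaussianWidth (apGradients 4 (Ω N))) =O[atTop]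
      fun N : ℕ+ => ((N : ℕ) : ℝ) ^ (3 / 4 : ℝ) * Real.log ((N : ℕ) : ℝ) ^ (1 / 4 : ℝ)) := by
  refine ⟨fun k hk => ?_, ⟨?_, ?_⟩, ?_⟩
  · refine IsBigO.of_bound (k * (Real.log 2 * (((k - 1 : ℕ) : ℝ) * 2 ^ (k - 2)) +
      (1 / 2) * ((((k - 1 : ℕ) : ℝ) + 1) * (D k * D k)))) (Eventually.of_forall fun N => ?_)
    have h := gaussianWidth_apGradients_le_rpow hk (D k) (hG k N)
      (Finset.card_pos.1 (by rw [hcard]; exact N.pos))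
    rw [hcard] at h
    rwa [Real.norm_of_nonneg (gaussianWidth_apGradients_nonneg (by omega)),
      Real.norm_of_nonneg (by positivity)]
  · refine IsBigO.of_bound (6 * Real.sqrt (6 * D 3 * D 3 * Real.exp 1)) ?_
    filter_upwards [eventually_ge_atTop 2] with N hN
    have h := gaussianWidth_apGradients_three_le (hD 3 le_rfl) (hG 3 N)
      (by rw [hcard]; exact_mod_cast hN)
    rw [hcard] at h
    rwa [Real.norm_of_nonneg (gaussianWidth_apGradients_nonneg (by omega)),
      Real.norm_of_nonneg (by positivity)]
  · refine IsBigO.of_bound 21120 ?_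
    filter_upwards [eventually_pnat_cast_ge (Real.exp 80)] with N hN
    have h := sqrt_mul_log_le_gaussianWidth (ψ N) (by rw [hcard]; exact hN)
      (by rw [hcard]; exact hΩ N) (by rw [hcard]; exact hψ N)
    rw [hcard] at h
    rw [Real.norm_of_nonneg (gaussianWidth_apGradients_nonneg (by omega)),
      Real.norm_of_nonneg (by positivity)]
    linarith
  · refine IsBigO.of_bound (24 * D 4) ?_
    filter_upwards [eventually_ge_atTop 2] with N hN
    have h := gaussianWidth_apGradients_four_le (hD 4 (by norm_num)) (hG 4 N)
      (by rw [hcard]; exact_mod_cast hN)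
    rw [hcard] at h
    have hlog : 0 ≤ Real.log ((N : ℕ) : ℝ) := Real.log_natCast_nonneg _
    rwa [Real.norm_of_nonneg (gaussianWidth_apGradients_nonneg (by omega)),
      Real.norm_of_nonneg (by positivity)]

theorem theorem4p1 :
    -- the bound for every fixed `k ≥ 3`, for `Ω = [N]` and `Ω = ℤ/Nℤ`, as `N → ∞`
    (∀ k : ℕ, 3 ≤ k →
      ((fun N : ℕ+ => apWidthInterval k N) =O[atTop]
        fun N : ℕ+ => ((N : ℕ) : ℝ) ^ (1 - 1 / (2 * ((k : ℝ) - 1)))) ∧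
      ((fun N : ℕ+ => apWidthCyclic k N) =O[atTop]
        fun N : ℕ+ => ((N : ℕ) : ℝ) ^ (1 - 1 / (2 * ((k : ℝ) - 1))))) ∧
    -- the sharp order for `k = 3`
    ((fun N : ℕ+ => apWidthInterval 3 N) =Θ[atTop]
      fun N : ℕ+ => Real.sqrt (((N : ℕ) : ℝ) * Real.log ((N : ℕ) : ℝ))) ∧
    ((fun N : ℕ+ => apWidthCyclic 3 N) =Θ[atTop]
      fun N : ℕ+ => Real.sqrt (((N : ℕ) : ℝ) * Real.log ((N : ℕ) : ℝ))) ∧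
    -- the improved bound for `k = 4`
    ((fun N : ℕ+ => apWidthInterval 4 N) =O[atTop]
      fun N : ℕ+ => ((N : ℕ) : ℝ) ^ (3 / 4 : ℝ) * Real.log ((N : ℕ) : ℝ) ^ (1 / 4 : ℝ)) ∧
    ((fun N : ℕ+ => apWidthCyclic 4 N) =O[atTop]
      fun N : ℕ+ => ((N : ℕ) : ℝ) ^ (3 / 4 : ℝ) * Real.log ((N : ℕ) : ℝ) ^ (1 / 4 : ℝ)) := by

  obtain ⟨hI, hI3, hI4⟩ := isBigO_gaussianWidth_apGradients (G := fun _ : ℕ+ => ℤ)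
    (fun N => Finset.Icc (1 : ℤ) (N : ℕ)) (fun N => by simp) (D := fun _ => 1)
    (fun _ _ => one_pos) (fun k _ => fewDivisions_int k) (fun _ => AddMonoidHom.id ℤ)
    (fun N n h1 h2 => Finset.mem_Icc.2 ⟨h1, h2⟩) (fun _ _ _ h => h)
  obtain ⟨hC, hC3, hC4⟩ := isBigO_gaussianWidth_apGradients (G := fun N : ℕ+ => ZMod N)
    (fun N => Finset.univ) (fun N => by rw [Finset.card_univ, ZMod.card]) (D := fun k => k)
    (fun _ hk => by omega) (fun k N => fewDivisions_zmod k N) (fun N => Int.castAddHom (ZMod N))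
    (fun N n _ _ => Finset.mem_univ _) (fun N x hx h => by
      rw [Int.coe_castAddHom, ZMod.intCast_zmod_eq_zero_iff_dvd] at h
      exact Int.eq_zero_of_abs_lt_dvd h hx)
  exact ⟨fun k hk => ⟨hI k hk, hC k hk⟩, hI3, hC3, hI4, hC4⟩
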